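/- Let $d\ge 1$ be an integer, $W>0$, $\sigma>0$, $p\in(2,\infty]$, and $r\in\left(\frac{dp}{p-2},\infty\right]$ (with $\frac{dp}{p-2}=d$ if $p=\infty$); let $r^*\in[1,\infty)$ be the conjugate exponent, $\frac1r+\frac1{r^*}=1$. Put $$I(\xi)=W\xi^2(\xi-1)^2(\xi-\tfrac12)\,\mathbf 1_{[0,1]}(\xi),\qquad \eta_\tau(x)=\frac{e^{-|x|^2/2\tau^2}}{(2\pi)^{d/2}\tau^d}\quad(x\in\mathbb R^d,\ \tau>0),$$ with the convention $\eta_0\star h=h$. Let $V$ be a real Hilbert space of vector fields on $\mathbb R^d$ that is continuously embedded in the space of bounded $C^1$ vector fields with bounded first derivatives. Let $f_0\in L^{r^*}(\mathbb R^d)$, $u\in L^p([0,1],L^r(\mathbb R^d))$ and $v\in L^p([0,1],V)$ (Bochner spaces). For $T\in(0,1]$ let $X_T=C^0([0,T],L^{r^*}(\mathbb R^d))\cap C^0((0,T],W^{1,r^*}(\mathbb R^d))$ and let $P_T$ be the space of all $f\in X_T$ with $$\|f\|_{P_T}=\max\Big(\sup_{t\in[0,T]}\|f(t)\|_{L^{r^*}},\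 \sup_{t\in(0,T]}\sqrt t\,\|f(t)\|_{W^{1,r^*}}\Big)<\infty,$$ where $\|h\|_{W^{1,r^*}}^{r^*}=\|h\|_{L^{r^*}}^{r^*}+\sum_{i=1}^d\|\partial_i h\|_{L^{r^*}}^{r^*}$. Put $$\Psi(f)(t)=\eta_{\sigma\sqrt t}\star f_0+\int_0^t\eta_{\sigma\sqrt{t-s}}\star\big(I(f(s))+u(s)|\nabla f(s)|-v(s)^T\nabla f(s)\big)\,ds,$$ the integral being a Bochner integral in $L^{r^*}(\mathbb R^d)$. Then there is $T_0\in(0,1]$ such that the following holds for every $T\in(0,T_0]$. The integral in $\Psi(f)(t)$ exists for all $f\in P_T$ and $t\in[0,T]$, and $\Psi$ is a contraction of $P_T$: it maps $P_T$ into itself, and there is $\kappa<1$ with $\|\Psi(f)-\Psi(g)\|_{P_T}\le\kappa\|f-g\|_{P_T}$ for all $f,g\in P_T$. There is a solution $f\in P_T$ of the integral equation $$f(t)=\Psi(f)(t)\qquad\text{for all }t\in[0,T],$$ it satisfies $\lim_{t\to0}f(t)=f_0$ in $L^{r^*}(\mathbb R^d)$, and it is unique, not only in $P_T$ but among all $g\in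 X_T$ for which the integrals exist and the equation holds on $[0,T]$. -/

import Mathlib

open MeasureTheory Set Filter Topology
open scoped ENNReal NNReal ContDiff Convolution

noncomputable section

namespace AllenCahn

/-- Euclidean space `ℝ^d`. -/
abbrev E (d : ℕ) : Type := EuclideanSpace ℝ (Fin d)

/-- The space `L^q(ℝ^d)` of real functions, for Lebesgue measure. -/
abbrev LL (d : ℕ) (q : ℝ≥0∞) : Type := Lp ℝ q (volume : Measure (E d))

/-- The reaction term `I(ξ) = W ξ² (ξ - 1)² (ξ - 1/2) 1_{[0,1]}(ξ)`. -/
def reaction (W ξ : ℝ) : ℝ :=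
  W * ξ ^ 2 * (ξ - 1) ^ 2 * (ξ - 1 / 2) * (Icc (0 : ℝ) 1).indicator (fun _ => (1 : ℝ)) ξ

/-- The Gaussian `η_τ(x) = exp(-|x|² / (2τ²)) / ((2π)^{d/2} τ^d)`. -/
def gaussian (d : ℕ) (τ : ℝ) (x : E d) : ℝ :=
  Real.exp (-‖x‖ ^ 2 / (2 * τ ^ 2)) / ((2 * Real.pi) ^ ((d : ℝ) / 2) * τ ^ d)

/-- The function `η_{σ√t} ⋆ h`; for `t = 0` this is `h` (the kernel is then the Dirac mass). -/
def heatFun {d : ℕ} (σ t : ℝ) (h : E d → ℝ) : E d → ℝ :=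
  if t = 0 then h
  else convolution (gaussian d (σ * √t)) h (ContinuousLinearMap.mul ℝ ℝ) volume

open Classical in
/-- `η_{σ√t} ⋆ h` as an element of `L^q` (with value `0` if it does not belong to `L^q`). -/
def heatLp {d : ℕ} (q : ℝ≥0∞) (σ t : ℝ) (h : E d → ℝ) : LL d q :=
  if hm : MemLp (heatFun σ t h) q volume then hm.toLp _ else 0

/-- `g` is the weak partial derivative `∂_i f`, tested against smooth compactly supported
functions. -/
def HasWeakPartial {d : ℕ} {q : ℝ≥0∞} (i : Fin d) (f g : LL d q) : Prop :=
  ∀ φ : E d → ℝ, ContDiff ℝ ∞ φ → HasCompactSupport φ →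
    ∫ x, f x * fderiv ℝ φ x (EuclideanSpace.single i 1) = - ∫ x, g x * φ x

/-- Membership in `W^{1,q}(ℝ^d)`: all weak first-order derivatives exist and lie in `L^q`. -/
def MemW1 {d : ℕ} {q : ℝ≥0∞} (f : LL d q) : Prop :=
  ∀ i, ∃ g : LL d q, HasWeakPartial i f g

open Classical in
/-- The weak partial derivative `∂_i f` in `L^q` (`0` if there is none). -/
def weakPartial {d : ℕ} {q : ℝ≥0∞} (i : Fin d) (f : LL d q) : LL d q :=
  if h : ∃ g : LL d q, HasWeakPartial i f g then h.choose else 0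

/-- The weak gradient `∇f(x) = (∂_1 f(x), …, ∂_d f(x))`. -/
def weakGrad {d : ℕ} {q : ℝ≥0∞} (f : LL d q) (x : E d) : E d :=
  WithLp.toLp 2 (fun i => weakPartial i f x)

open Classical in
/-- The norm `(‖f‖_q^q + ∑_i ‖∂_i f‖_q^q)^{1/q}` of `W^{1,q}(ℝ^d)`, `1 ≤ q < ∞`, with value `∞`
outside `W^{1,q}`. -/
def w1Norm {d : ℕ} {q : ℝ≥0∞} (f : LL d q) : ℝ≥0∞ :=
  if MemW1 f then
    (‖f‖ₑ ^ q.toReal + ∑ i, ‖weakPartial i f‖ₑ ^ q.toReal) ^ (1 / q.toReal)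
  else ⊤

/-- `f ∈ C⁰([0,T], L^q) ∩ C⁰((0,T], W^{1,q})`. Only the values of `f` on `[0,T]` matter. -/
structure IsPath {d : ℕ} {q : ℝ≥0∞} [Fact (1 ≤ q)] (T : ℝ) (f : ℝ → LL d q) : Prop where
  continuousOn : ContinuousOn f (Icc 0 T)
  mem_w1 : ∀ t ∈ Ioc 0 T, MemW1 (f t)
  continuous_w1 : ∀ t ∈ Ioc 0 T,
    Tendsto (fun s => w1Norm (f s - f t)) (𝓝[Ioc 0 T] t) (𝓝 0)

/-- `‖f‖_{P_T} = max (sup_{[0,T]} ‖f(t)‖_{L^q}, sup_{(0,T]} √t ‖f(t)‖_{W^{1,q}})`, in `[0,∞]`. -/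
def pNorm {d : ℕ} {q : ℝ≥0∞} (T : ℝ) (f : ℝ → LL d q) : ℝ≥0∞ :=
  max (⨆ t ∈ Icc 0 T, ‖f t‖ₑ) (⨆ t ∈ Ioc 0 T, ENNReal.ofReal (√t) * w1Norm (f t))

/-- Membership in the space `P_T`. -/
def MemP {d : ℕ} {q : ℝ≥0∞} [Fact (1 ≤ q)] (T : ℝ) (f : ℝ → LL d q) : Prop :=
  IsPath T f ∧ pNorm T f < ⊤

/-- The linear map `ι` realizes the normed space `V` as a space of vector fields on `ℝ^d` that is
continuously embedded in the space `C¹(ℝ^d, ℝ^d)` of bounded `C¹` fields with bounded first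
derivatives. -/
structure IsC1Embedding {d : ℕ} {V : Type*} [NormedAddCommGroup V] [NormedSpace ℝ V]
    (ι : V →ₗ[ℝ] (E d → E d)) : Prop where
  injective : Function.Injective ι
  contDiff : ∀ w, ContDiff ℝ 1 (ι w)
  bound : ∃ C : ℝ, ∀ w x, ‖ι w x‖ ≤ C * ‖w‖ ∧ ‖fderiv ℝ (ι w) x‖ ≤ C * ‖w‖

section Duhamel

variable {d : ℕ} {q r : ℝ≥0∞} [Fact (1 ≤ q)] {V : Type*} [NormedAddCommGroup V]
  [InnerProductSpace ℝ V]

/-- The function `I(f(s)) + u(s) |∇f(s)| - v(s)ᵀ ∇f(s)` on `ℝ^d`. -/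
def source (W : ℝ) (ι : V →ₗ[ℝ] (E d → E d)) (u : ℝ → LL d r) (v : ℝ → V)
    (f : ℝ → LL d q) (s : ℝ) (x : E d) : ℝ :=
  reaction W (f s x) + u s x * ‖weakGrad (f s) x‖ - inner ℝ (ι (v s) x) (weakGrad (f s) x)

/-- `Ψ(f)(t) = η_{σ√t} ⋆ f₀ + ∫₀ᵗ η_{σ√(t-s)} ⋆ (I(f(s)) + u(s)|∇f(s)| - v(s)ᵀ∇f(s)) ds`, the
integral being a Bochner integral in `L^q`. -/
def Psi (W σ : ℝ) (ι : V →ₗ[ℝ] (E d → E d)) (f₀ : LL d q) (u : ℝ → LL d r) (v : ℝ → V)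
    (f : ℝ → LL d q) (t : ℝ) : LL d q :=
  heatLp q σ t f₀ + ∫ s in (0 : ℝ)..t, heatLp q σ (t - s) (source W ι u v f s)

/-- For every `t ∈ [0,T]` the integral in `Ψ(f)(t)` exists as a Bochner integral in `L^q`. -/
def DuhamelExists (W σ : ℝ) (ι : V →ₗ[ℝ] (E d → E d)) (u : ℝ → LL d r) (v : ℝ → V)
    (T : ℝ) (f : ℝ → LL d q) : Prop :=
  ∀ t ∈ Icc 0 T,
    (∀ᵐ s ∂(volume.restrict (Ioc 0 t)),
      MemLp (heatFun σ (t - s) (source W ι u v f s)) q volume) ∧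
    IntervalIntegrable (fun s => heatLp q σ (t - s) (source W ι u v f s)) volume 0 t

/-- `f` solves the Duhamel integral equation on `[0,T]`. -/
def IsMildSolution (W σ : ℝ) (ι : V →ₗ[ℝ] (E d → E d)) (f₀ : LL d q) (u : ℝ → LL d r)
    (v : ℝ → V) (T : ℝ) (f : ℝ → LL d q) : Prop :=
  DuhamelExists W σ ι u v T f ∧ ∀ t ∈ Icc 0 T, f t = Psi W σ ι f₀ u v f t

end Duhamel

end AllenCahn

end

open AllenCahn

/-! Write q for the conjugate exponent of r and α = d/(2r). By Hölder, u|∇f| lies in L¹, while I(f)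
- v·∇f lies in L^q. The source thus takes values in L¹ + L^q, modelled by pairs in `nonlin`, and it
is Lipschitz in (f, ∇f) with a constant m(s) controlled by 1 + ‖u(s)‖ + ‖v(s)‖, so that m ∈
L^p(0,1). Scaling of the Gaussian shows that for t ≤ 1 the heat operator from L¹ + L^q to L^q has
norm O(t^{-α}), and its gradient O(t^{-α-1/2}) (`isParabolic`).

In P_T the gradient is O(s^{-1/2}), so every estimate reduces to ∫₀ᵗ (t-s)^{-α-1/2} s^{-1/2} m(s)
ds. Hölder in time bounds it by K t^{θ-1/2} with θ = 1/2 - 1/p - α (`exists_kernel_bound`), and θ >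
0 is exactly the condition r > dp/(p-2). After multiplication by the weight √t, Ψ has Lipschitz
constant O(T^θ), which is small for small T.

The analysis is carried out for abstract operator families. Existence is a fixed point argument for
pairs (f, g), where g stands in for ∇f (`IsParabolic.exists_fixedPoint`). Since weak derivatives
commute with Bochner integrals, g is then identified as the weak gradient of f.

Uniqueness in X_T is harder than in P_T, because nothing bounds the gradient of a competitor near t
= 0. The equation is therefore restarted at a time c > 0, after which gradients are bounded. The
contraction estimate with weight √(t-c) gives ‖f(t) - f'(t)‖ ≤ 2(1+C)‖f(c) - f'(c)‖ with C
independent of c, and c → 0 only uses continuity in L^q (`IsParabolic.eqOn_of_evolution`). -/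

noncomputable section

namespace AllenCahn

/-! ### Weakly singular integrals in time. -/

section Kernel

theorem lintegral_Ioo_sub_left_rpow {c t b : ℝ} (hct : c < t) (hb : b < 1) :
    ∫⁻ s in Ioo c t, ENNReal.ofReal ((s - c) ^ (-b))
      = ENNReal.ofReal ((t - c) ^ (1 - b) / (1 - b)) := by
  have hi : IntervalIntegrable (fun s : ℝ => (s - c) ^ (-b)) volume c t := by
    have := (intervalIntegral.intervalIntegrable_rpow' (a := 0) (b := t - c) (r := -b)
      (by linarith)).comp_sub_right c
    simpa using this
  have hi' := (intervalIntegrable_iff_integrableOn_Ioo_of_le hct.le).1 hi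
  rw [← ofReal_integral_eq_lintegral_ofReal hi']
  · rw [← integral_Ioc_eq_integral_Ioo, ← intervalIntegral.integral_of_le hct.le,
      intervalIntegral.integral_comp_sub_right (fun s : ℝ => s ^ (-b)) c,
      integral_rpow (Or.inl (by linarith)), sub_self, Real.zero_rpow (by linarith)]
    congr 2
    · rw [sub_zero]; congr 1; ring
    · ring
  · filter_upwards [ae_restrict_mem measurableSet_Ioo] with s hs
    exact Real.rpow_nonneg (by linarith [hs.1]) _

theorem lintegral_Ioo_sub_right_rpow {c t b : ℝ} (hct : c < t) (hb : b < 1) :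
    ∫⁻ s in Ioo c t, ENNReal.ofReal ((t - s) ^ (-b))
      = ENNReal.ofReal ((t - c) ^ (1 - b) / (1 - b)) := by
  have hi : IntervalIntegrable (fun s : ℝ => (t - s) ^ (-b)) volume c t := by
    have := (intervalIntegral.intervalIntegrable_rpow' (a := t - c) (b := 0) (r := -b)
      (by linarith)).comp_sub_left t
    simpa using this
  have hi' := (intervalIntegrable_iff_integrableOn_Ioo_of_le hct.le).1 hi
  rw [← ofReal_integral_eq_lintegral_ofReal hi']
  · rw [← integral_Ioc_eq_integral_Ioo, ← intervalIntegral.integral_of_le hct.le,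
      intervalIntegral.integral_comp_sub_left (fun s : ℝ => s ^ (-b)) t,
      integral_rpow (Or.inl (by linarith)), sub_self, Real.zero_rpow (by linarith)]
    congr 2
    · rw [sub_zero]; congr 1; ring
    · ring
  · filter_upwards [ae_restrict_mem measurableSet_Ioo] with s hs
    exact Real.rpow_nonneg (by linarith [hs.2]) _

theorem eLpNorm_rpow_eq {S : Set ℝ} (hS : MeasurableSet S) {g : ℝ → ℝ} (hg : ∀ s ∈ S, 0 < g s)
    {P : ℝ≥0∞} (hP0 : P ≠ 0) (hPt : P ≠ ⊤) (b : ℝ) :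
    eLpNorm (fun s => (g s) ^ (-b)) P (volume.restrict S)
      = (∫⁻ s in S, ENNReal.ofReal ((g s) ^ (-(b * P.toReal)))) ^ (1 / P.toReal) := by
  rw [eLpNorm_eq_lintegral_rpow_enorm_toReal hP0 hPt]
  congr 1
  refine setLIntegral_congr_fun hS fun s hs => ?_
  have h := hg s hs
  rw [Real.enorm_eq_ofReal (Real.rpow_nonneg h.le _),
    ENNReal.ofReal_rpow_of_nonneg (Real.rpow_nonneg h.le _) ENNReal.toReal_nonneg,
    ← Real.rpow_mul h.le]
  congr 2; ring

theorem ofReal_div_rpow_eq {L b P : ℝ} (hL : 0 < L) (hP : 0 < P) (hb : b * P < 1) :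
    ENNReal.ofReal (L ^ (1 - b * P) / (1 - b * P)) ^ (1 / P)
      = ENNReal.ofReal ((1 - b * P)⁻¹ ^ (1 / P) * L ^ (1 / P - b)) := by
  have h1 : 0 < 1 - b * P := by linarith
  rw [ENNReal.ofReal_rpow_of_nonneg (by positivity) (by positivity), div_eq_mul_inv,
    Real.mul_rpow (by positivity) (by positivity), ← Real.rpow_mul hL.le, mul_comm]
  congr 3
  field_simp

/-- A product of two singular powers whose arguments add up to `L` is dominated by a sum of
single powers. -/
theorem rpow_neg_mul_rpow_neg_le {x y a b : ℝ} (hx : 0 < x) (hy : 0 < y) (ha : 0 ≤ a)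
    (hb : 0 ≤ b) :
    x ^ (-a) * y ^ (-b) ≤
      ((x + y) / 2) ^ (-a) * y ^ (-b) + ((x + y) / 2) ^ (-b) * x ^ (-a) := by
  have h1 : 0 < (x + y) / 2 := by linarith
  rcases le_total x y with h | h
  · have : y ^ (-b) ≤ ((x + y) / 2) ^ (-b) :=
      Real.rpow_le_rpow_of_nonpos h1 (by linarith) (by linarith)
    have h3 : 0 ≤ ((x + y) / 2) ^ (-a) * y ^ (-b) := by positivity
    have h4 := mul_le_mul_of_nonneg_left this (Real.rpow_nonneg hx.le (-a))
    linarith [mul_comm (x ^ (-a)) (((x + y) / 2) ^ (-b))]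
  · have : x ^ (-a) ≤ ((x + y) / 2) ^ (-a) :=
      Real.rpow_le_rpow_of_nonpos h1 (by linarith) (by linarith)
    have h3 : 0 ≤ ((x + y) / 2) ^ (-b) * x ^ (-a) := by positivity
    have h4 := mul_le_mul_of_nonneg_right this (Real.rpow_nonneg hy.le (-b))
    linarith

/-- Weakly singular kernels against a weight `m ∈ L^p`. -/
theorem exists_kernel_bound {p : ℝ≥0∞} {a b : ℝ} (ha : 0 ≤ a) (hb : 0 ≤ b)
    (hp1 : 1 ≤ p)
    (hap : a + p⁻¹.toReal < 1) (hbp : b + p⁻¹.toReal < 1) {m : ℝ → ℝ}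
    (hm : MemLp m p (volume.restrict (Icc (0 : ℝ) 1))) :
    ∃ K : ℝ, 0 ≤ K ∧ ∀ c t, 0 ≤ c → c < t → t ≤ 1 →
      IntegrableOn (fun s => (t - s) ^ (-a) * (s - c) ^ (-b) * m s) (Ioc c t) ∧
      ∫ s in Ioc c t, |(t - s) ^ (-a) * (s - c) ^ (-b) * m s|
        ≤ K * (t - c) ^ (1 - p⁻¹.toReal - a - b) := by
  -- The conjugate exponent of p, equal to 1 for p = ∞. The hypotheses a + 1/p < 1 and b + 1/p < 1
  -- say that aP < 1 and bP < 1, so each power alone is in L^P.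
  set P : ℝ≥0∞ := (1 - p⁻¹)⁻¹ with hPdef
  set x : ℝ := p⁻¹.toReal with hx
  have hx0 : 0 ≤ x := ENNReal.toReal_nonneg
  have hple : p⁻¹ ≤ 1 := ENNReal.inv_le_one.2 hp1
  have hpne : p⁻¹ ≠ ⊤ := ne_top_of_le_ne_top ENNReal.one_ne_top hple
  have hPx : (1 - p⁻¹).toReal = 1 - x := by
    rw [ENNReal.toReal_sub_of_le hple ENNReal.one_ne_top, ENNReal.toReal_one]
  have hPr : P.toReal = (1 - x)⁻¹ := by rw [hPdef, ENNReal.toReal_inv, hPx]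
  have h1x : 0 < 1 - x := by linarith
  have hPpos : 0 < P.toReal := by rw [hPr]; positivity
  have hP0 : P ≠ 0 := fun h => by rw [h] at hPpos; simp at hPpos
  have hPt : P ≠ ⊤ := fun h => by rw [h] at hPpos; simp at hPpos
  have : ENNReal.HolderTriple P p 1 := ⟨by
    rw [hPdef, inv_inv, inv_one]; exact tsub_add_cancel_of_le hple⟩
  have hP1 : 1 / P.toReal = 1 - x := by rw [hPr]; simp
  have haP : a * P.toReal < 1 := by
    rw [hPr, ← div_eq_mul_inv, div_lt_one h1x]; linarith
  have hbP : b * P.toReal < 1 := by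
    rw [hPr, ← div_eq_mul_inv, div_lt_one h1x]; linarith
  set ca : ℝ := (1 - a * P.toReal)⁻¹ ^ (1 / P.toReal)
  set cb : ℝ := (1 - b * P.toReal)⁻¹ ^ (1 / P.toReal)
  have hca : 0 ≤ ca := Real.rpow_nonneg (inv_nonneg.2 (by linarith)) _
  have hcb : 0 ≤ cb := Real.rpow_nonneg (inv_nonneg.2 (by linarith)) _
  set M := eLpNorm m p (volume.restrict (Icc (0 : ℝ) 1))
  have hM : M ≠ ⊤ := hm.2.ne
  refine ⟨(2 ^ a * cb + 2 ^ b * ca) * M.toReal, by positivity, fun c t hc hct ht => ?_⟩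
  have hL : 0 < t - c := by linarith
  set μ := volume.restrict (Ioo c t) with hμ
  have hma : Measurable (fun s : ℝ => (t - s) ^ (-a)) := by fun_prop
  have hmb : Measurable (fun s : ℝ => (s - c) ^ (-b)) := by fun_prop
  have ea : eLpNorm (fun s : ℝ => (t - s) ^ (-a)) P μ
      = ENNReal.ofReal (ca * (t - c) ^ (1 - x - a)) := by
    rw [hμ, eLpNorm_rpow_eq measurableSet_Ioo (fun s hs => sub_pos.2 hs.2) hP0 hPt,
      lintegral_Ioo_sub_right_rpow hct haP, ofReal_div_rpow_eq hL hPpos haP, hP1]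
    simp only [ca, hP1]
  have eb : eLpNorm (fun s : ℝ => (s - c) ^ (-b)) P μ
      = ENNReal.ofReal (cb * (t - c) ^ (1 - x - b)) := by
    rw [hμ, eLpNorm_rpow_eq measurableSet_Ioo (fun s hs => sub_pos.2 hs.1) hP0 hPt,
      lintegral_Ioo_sub_left_rpow hct hbP, ofReal_div_rpow_eq hL hPpos hbP, hP1]
    simp only [cb, hP1]
  set k : ℝ → ℝ := fun s => (t - s) ^ (-a) * (s - c) ^ (-b) with hk
  have hkm : Measurable k := hma.mul hmb
  have hklp : eLpNorm k P μ ≤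
      ENNReal.ofReal ((2 ^ a * cb + 2 ^ b * ca) * (t - c) ^ (1 - x - a - b)) := by
    -- The two singularities sit at opposite ends, so one factor is always at most its value at the
    -- midpoint. This replaces a Beta integral and still gives the exact power of t - c.
    have h1 : eLpNorm k P μ ≤ eLpNorm (((t - c) / 2) ^ (-a) • (fun s : ℝ => (s - c) ^ (-b)) +
        ((t - c) / 2) ^ (-b) • (fun s : ℝ => (t - s) ^ (-a))) P μ := by
      refine eLpNorm_mono_ae ?_
      filter_upwards [ae_restrict_mem measurableSet_Ioo] with s hs
      have h1 : 0 < t - s := sub_pos.2 hs.2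
      have h2 : 0 < s - c := sub_pos.2 hs.1
      have h3 := rpow_neg_mul_rpow_neg_le h1 h2 ha hb
      rw [show t - s + (s - c) = t - c by ring] at h3
      have h4 : 0 ≤ k s := by simp only [hk]; positivity
      rw [Real.norm_of_nonneg h4]
      exact h3.trans (le_abs_self _)
    refine h1.trans ((eLpNorm_add_le (by fun_prop) (by fun_prop) ?_).trans ?_)
    · rw [hPdef]
      exact ENNReal.one_le_inv.2 tsub_le_self
    rw [eLpNorm_const_smul, eLpNorm_const_smul, ea, eb,
      Real.enorm_eq_ofReal (by positivity), Real.enorm_eq_ofReal (by positivity),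
      ← ENNReal.ofReal_mul (by positivity), ← ENNReal.ofReal_mul (by positivity),
      ← ENNReal.ofReal_add (by positivity) (by positivity)]
    refine ENNReal.ofReal_le_ofReal (le_of_eq ?_)
    have e1 : ∀ e : ℝ, ((t - c) / 2) ^ (-e) = 2 ^ e * (t - c) ^ (-e) := fun e => by
      rw [Real.div_rpow hL.le (by norm_num), Real.rpow_neg (by norm_num : (0:ℝ) ≤ 2),
        div_inv_eq_mul, mul_comm]
    rw [e1, e1, show 1 - x - a - b = -a + (1 - x - b) by ring, Real.rpow_add hL,
      show (1 - x - a : ℝ) = (1 - x - b) + (b - a) by ring,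
      show (-b : ℝ) = -a + (a - b) by ring, Real.rpow_add hL, Real.rpow_add hL]
    have : (t - c) ^ (a - b) * (t - c) ^ (b - a) = 1 := by
      rw [← Real.rpow_add hL]; simp
    linear_combination (2 ^ b * ca * (t - c) ^ (-a) * (t - c) ^ (1 - x - b)) * this
  -- The norm of m over all of [0,1] is used, which makes the constant uniform in c and t.
  have hsub : Ioo c t ⊆ Icc 0 1 := fun s hs => ⟨hc.trans hs.1.le, hs.2.le.trans ht⟩
  have hmμ : eLpNorm m p μ ≤ M := eLpNorm_mono_measure _ (Measure.restrict_mono hsub le_rfl)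
  have hmm : AEStronglyMeasurable m μ := hm.1.mono_measure (Measure.restrict_mono hsub le_rfl)
  have hprod : eLpNorm (k • m) 1 μ ≤ ENNReal.ofReal
      ((2 ^ a * cb + 2 ^ b * ca) * M.toReal * (t - c) ^ (1 - x - a - b)) := by
    refine (eLpNorm_smul_le_mul_eLpNorm (p := P) (q := p) hmm
      hkm.aestronglyMeasurable).trans ((mul_le_mul' hklp hmμ).trans (le_of_eq ?_))
    rw [← ENNReal.ofReal_toReal hM, ← ENNReal.ofReal_mul (by positivity),
      ENNReal.toReal_ofReal ENNReal.toReal_nonneg]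
    congr 1; ring
  have hint : Integrable (k • m) μ := by
    rw [← memLp_one_iff_integrable]
    exact ⟨hkm.aestronglyMeasurable.smul hmm, hprod.trans_lt ENNReal.ofReal_lt_top⟩
  have hμ' : volume.restrict (Ioc c t) = μ := Measure.restrict_congr_set Ioo_ae_eq_Ioc.symm
  refine ⟨by rw [IntegrableOn, hμ']; exact hint, ?_⟩
  rw [hμ']
  have h5 : ENNReal.ofReal (∫ s, |(t - s) ^ (-a) * (s - c) ^ (-b) * m s| ∂μ)
      = eLpNorm (k • m) 1 μ := by
    rw [eLpNorm_one_eq_lintegral_enorm]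
    refine (ofReal_integral_eq_lintegral_ofReal hint.abs
      (ae_of_all _ fun _ => abs_nonneg _)).trans (lintegral_congr fun s => ?_)
    rw [← Real.norm_eq_abs, ofReal_norm]
  rw [← h5] at hprod
  exact (ENNReal.ofReal_le_ofReal_iff (by positivity)).1 hprod

end Kernel

/-! ### Abstract smoothing operators and their Duhamel integrals. -/

section Smoothing

variable {Z Y : Type*} [NormedAddCommGroup Z] [NormedSpace ℝ Z]
  [NormedAddCommGroup Y] [NormedSpace ℝ Y]

/-- `S` is a strongly continuous contraction semigroup on `Z` and `A τ`, `τ > 0`, is a family of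
operators with `S s ∘ A τ = A (s + τ)` whose norm is at most `C τ^{-β}` for `τ ≤ 1`. -/
structure IsSmoothing (C β : ℝ) (S : ℝ → Z →L[ℝ] Z) (A : ℝ → Y →L[ℝ] Z) : Prop where
  nonneg : 0 ≤ C
  contraction : ∀ t z, 0 ≤ t → ‖S t z‖ ≤ ‖z‖
  continuousOn : ∀ z, ContinuousOn (fun t => S t z) (Ici 0)
  comp : ∀ s τ y, 0 ≤ s → 0 < τ → S s (A τ y) = A (s + τ) y
  bound : ∀ τ y, 0 < τ → τ ≤ 1 → ‖A τ y‖ ≤ C * τ ^ (-β) * ‖y‖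

/-- The weight `m` integrates the kernels `(t - s)^{-a} (s - c)^{-1/2}`, with the growth
`(t - c)^{θ - 1/2}`. -/
structure HasKernelBound (m : ℝ → ℝ) (a θ K : ℝ) : Prop where
  weight_nonneg : ∀ s, 0 ≤ m s
  nonneg : 0 ≤ K
  exponent_pos : 0 < θ
  integrableOn : ∀ c t, 0 ≤ c → c < t → t ≤ 1 →
    IntegrableOn (fun s => (t - s) ^ (-a) * (s - c) ^ (-(1 / 2 : ℝ)) * m s) (Ioc c t)
  le : ∀ c t, 0 ≤ c → c < t → t ≤ 1 →
    ∫ s in Ioc c t, |(t - s) ^ (-a) * (s - c) ^ (-(1 / 2 : ℝ)) * m s|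
      ≤ K * (t - c) ^ (θ - 1 / 2)

variable {C β a θ K : ℝ} {S : ℝ → Z →L[ℝ] Z} {A : ℝ → Y →L[ℝ] Z} {m : ℝ → ℝ}

namespace IsSmoothing

/-- Strong continuity plus the uniform bound ‖S t‖ ≤ 1 gives joint continuity. Truncating the time
at 0 makes the map total. -/
theorem continuous_uncurry (h : IsSmoothing C β S A) :
    Continuous fun x : ℝ × Z => S (max x.1 0) x.2 := by
  rw [continuous_iff_continuousAt]
  rintro ⟨t, z⟩
  have h1 : Continuous fun τ : ℝ => S (max τ 0) z :=
    (h.continuousOn z).comp_continuous (by fun_prop) fun τ => mem_Ici.2 (le_max_right _ _)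
  have h2 : Tendsto (fun x : ℝ × Z => S (max x.1 0) (x.2 - z)) (𝓝 (t, z)) (𝓝 0) := by
    refine squeeze_zero_norm (fun x => h.contraction _ _ (le_max_right _ _)) ?_
    have : Continuous fun x : ℝ × Z => ‖x.2 - z‖ := by fun_prop
    simpa using this.tendsto (t, z)
  have h3 : Tendsto (fun x : ℝ × Z => S (max x.1 0) z) (𝓝 (t, z)) (𝓝 (S (max t 0) z)) :=
    (h1.comp continuous_fst).tendsto (t, z)
  have h4 := h2.add h3
  simp only [map_sub, sub_add_cancel, zero_add] at h4
  exact h4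

/-- Near a time t > 0 one has A τ = S(τ - t/2) A(t/2), so continuity is inherited from S. -/
theorem continuousOn_apply (h : IsSmoothing C β S A) (y : Y) :
    ContinuousOn (fun τ => A τ y) (Ioi 0) := by
  intro t ht
  have ht : 0 < t := ht
  have h1 : ContinuousAt (fun τ => S (max (τ - t / 2) 0) (A (t / 2) y)) t :=
    (h.continuous_uncurry.comp
      (by fun_prop : Continuous fun τ : ℝ => (τ - t / 2, A (t / 2) y))).continuousAt
  refine (h1.congr ?_).continuousWithinAt
  filter_upwards [lt_mem_nhds (show t / 2 < t by linarith)] with τ hτ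
  rw [max_eq_left (by linarith), h.comp _ _ _ (by linarith) (by linarith)]
  congr 2; ring

/-- The integrand is the pointwise limit of S(t - s - δ) A(δ) F(s) as δ = 1/(n+1) → 0. Each
approximation is measurable by joint continuity of S, and for fixed s < t the sequence is eventually
constant. -/
theorem aestronglyMeasurable (h : IsSmoothing C β S A) {F : ℝ → Y} {c t : ℝ}
    (hF : AEStronglyMeasurable F (volume.restrict (Ioc c t))) :
    AEStronglyMeasurable (fun s => A (t - s) (F s)) (volume.restrict (Ioc c t)) := by
  have hδ : ∀ n : ℕ, (0 : ℝ) < 1 / ((n : ℝ) + 1) := fun n => by positivity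
  refine aestronglyMeasurable_of_tendsto_ae atTop
    (f := fun (n : ℕ) s => S (max ((t - s) - 1 / ((n : ℝ) + 1)) 0) (A (1 / ((n : ℝ) + 1)) (F s)))
    (fun n => ?_) ?_
  · refine h.continuous_uncurry.comp_aestronglyMeasurable
      (f := fun s => ((t - s) - 1 / ((n : ℝ) + 1), A (1 / ((n : ℝ) + 1)) (F s)))
      (AEStronglyMeasurable.prodMk ?_ ?_)
    · exact (by fun_prop : Continuous fun s : ℝ => (t - s) - 1 / ((n : ℝ) + 1)).aestronglyMeasurable
    · exact (A _).continuous.comp_aestronglyMeasurable hF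
  · have hne : ∀ᵐ s ∂volume.restrict (Ioc c t), s ≠ t :=
      ae_restrict_of_ae (by simp [ae_iff])
    filter_upwards [ae_restrict_mem measurableSet_Ioc, hne] with s hs hst
    have hpos : 0 < t - s := sub_pos.2 (lt_of_le_of_ne hs.2 hst)
    refine tendsto_const_nhds.congr' ?_
    filter_upwards [(tendsto_one_div_add_atTop_nhds_zero_nat (𝕜 := ℝ)).eventually
      (gt_mem_nhds hpos)] with n hn
    rw [max_eq_left (by linarith), h.comp _ _ _ (by linarith) (hδ n)]
    congr 2; ring

/-- Smoothing that is better than the kernel exponent a is converted into the gain (t - c)^{a-β}.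
One kernel bound thereby serves both the operators and their gradients. -/
theorem norm_apply_le (h : IsSmoothing C β S A) (hk : HasKernelBound m a θ K) (hβ : β ≤ a)
    {F : ℝ → Y} {c t R : ℝ} (hc : 0 ≤ c) (hct : c < t) (ht : t ≤ 1)
    (hFR : ∀ᵐ s ∂volume.restrict (Ioc c t), ‖F s‖ ≤ R * ((s - c) ^ (-(1 / 2 : ℝ)) * m s)) :
    ∀ᵐ s ∂volume.restrict (Ioc c t), ‖A (t - s) (F s)‖ ≤
      C * R * (t - c) ^ (a - β) * ((t - s) ^ (-a) * (s - c) ^ (-(1 / 2 : ℝ)) * m s) := by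
  have hne : ∀ᵐ s ∂volume.restrict (Ioc c t), s ≠ t := ae_restrict_of_ae (by simp [ae_iff])
  filter_upwards [ae_restrict_mem measurableSet_Ioc, hne, hFR] with s hs hst hF
  have hpos : 0 < t - s := sub_pos.2 (lt_of_le_of_ne hs.2 hst)
  have hpos' : 0 < s - c := sub_pos.2 hs.1
  have hm := hk.weight_nonneg s
  have hC := h.nonneg
  have h1 := h.bound (t - s) (F s) hpos (by linarith)
  have h2 : (t - s) ^ (-β) ≤ (t - c) ^ (a - β) * (t - s) ^ (-a) := by
    rw [show -β = (a - β) + -a by ring, Real.rpow_add hpos]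
    gcongr
    linarith
  calc ‖A (t - s) (F s)‖ ≤ C * (t - s) ^ (-β) * ‖F s‖ := h1
    _ ≤ C * ((t - c) ^ (a - β) * (t - s) ^ (-a)) * (R * ((s - c) ^ (-(1 / 2 : ℝ)) * m s)) := by
        gcongr
    _ = _ := by ring

theorem integrableOn (h : IsSmoothing C β S A) (hk : HasKernelBound m a θ K) (hβ : β ≤ a)
    {F : ℝ → Y} {c t R : ℝ} (hc : 0 ≤ c) (hct : c < t) (ht : t ≤ 1)
    (hF : AEStronglyMeasurable F (volume.restrict (Ioc c t)))
    (hFR : ∀ᵐ s ∂volume.restrict (Ioc c t), ‖F s‖ ≤ R * ((s - c) ^ (-(1 / 2 : ℝ)) * m s)) :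
    IntegrableOn (fun s => A (t - s) (F s)) (Ioc c t) :=
  ((hk.integrableOn c t hc hct ht).const_mul _).mono' (h.aestronglyMeasurable hF)
    (h.norm_apply_le hk hβ hc hct ht hFR)

theorem norm_integral_le (h : IsSmoothing C β S A) (hk : HasKernelBound m a θ K) (hβ : β ≤ a)
    {F : ℝ → Y} {c t R : ℝ} (hc : 0 ≤ c) (hct : c < t) (ht : t ≤ 1) (hR : 0 ≤ R)
    (hFR : ∀ᵐ s ∂volume.restrict (Ioc c t), ‖F s‖ ≤ R * ((s - c) ^ (-(1 / 2 : ℝ)) * m s)) :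
    ‖∫ s in Ioc c t, A (t - s) (F s)‖ ≤ C * R * K * (t - c) ^ (a - β + θ - 1 / 2) := by
  have hL : 0 < t - c := sub_pos.2 hct
  have hC := h.nonneg
  have hi := hk.integrableOn c t hc hct ht
  calc ‖∫ s in Ioc c t, A (t - s) (F s)‖
      ≤ ∫ s in Ioc c t, C * R * (t - c) ^ (a - β) *
          ((t - s) ^ (-a) * (s - c) ^ (-(1 / 2 : ℝ)) * m s) :=
        norm_integral_le_of_norm_le (hi.const_mul _) (h.norm_apply_le hk hβ hc hct ht hFR)
    _ = C * R * (t - c) ^ (a - β) *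
          ∫ s in Ioc c t, ((t - s) ^ (-a) * (s - c) ^ (-(1 / 2 : ℝ)) * m s) :=
        integral_const_mul _ _
    _ ≤ C * R * (t - c) ^ (a - β) * (K * (t - c) ^ (θ - 1 / 2)) := by
        gcongr
        exact (integral_mono hi hi.abs fun s => le_abs_self _).trans (hk.le c t hc hct ht)
    _ = _ := by
        rw [show a - β + θ - 1 / 2 = (a - β) + (θ - 1 / 2) by ring, Real.rpow_add hL]; ring

/-- Splitting of a Duhamel integral at an intermediate time, in a form that allows for two
different smoothing families before and after that time. -/
theorem integral_split [CompleteSpace Z] {W : Type*} [NormedAddCommGroup W] [NormedSpace ℝ W]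
    [CompleteSpace W] {A₁ : ℝ → Y →L[ℝ] W} {G : W →L[ℝ] Z}
    {F : ℝ → Y} {c b t : ℝ} (hcb : c ≤ b) (hbt : b ≤ t)
    (hG : ∀ s y, s < b → G (A₁ (b - s) y) = A (t - s) y)
    (hi₁ : IntegrableOn (fun s => A₁ (b - s) (F s)) (Ioc c b))
    (hi₂ : IntegrableOn (fun s => A (t - s) (F s)) (Ioc b t)) :
    IntegrableOn (fun s => A (t - s) (F s)) (Ioc c t) ∧
    ∫ s in Ioc c t, A (t - s) (F s) =
      G (∫ s in Ioc c b, A₁ (b - s) (F s)) + ∫ s in Ioc b t, A (t - s) (F s) := by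
  have hne : ∀ᵐ s ∂volume.restrict (Ioc c b), s ≠ b := ae_restrict_of_ae (by simp [ae_iff])
  have heq : (fun s => G (A₁ (b - s) (F s))) =ᵐ[volume.restrict (Ioc c b)]
      fun s => A (t - s) (F s) := by
    filter_upwards [ae_restrict_mem measurableSet_Ioc, hne] with s hs hsb
    exact hG s _ (lt_of_le_of_ne hs.2 hsb)
  have hi₃ : IntegrableOn (fun s => A (t - s) (F s)) (Ioc c b) :=
    (G.integrable_comp hi₁).congr heq
  rw [← Ioc_union_Ioc_eq_Ioc hcb hbt]
  refine ⟨hi₃.union hi₂, ?_⟩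
  rw [setIntegral_union (Ioc_disjoint_Ioc_of_le le_rfl) measurableSet_Ioc hi₃ hi₂,
    ← G.integral_comp_comm hi₁, integral_congr_ae heq]

/-- Cut the integral at c = t - δ. For t' near t the part over (c, t'] is uniformly small, and the
rest is S(t' - c) applied to a fixed vector, which is continuous in t'. -/
theorem continuousOn_integral [CompleteSpace Z] (h : IsSmoothing C β S A)
    (hk : HasKernelBound m a θ K) (hβ : β ≤ a)
    {F : ℝ → Y} {T R : ℝ} (hT : T ≤ 1) (hR : 0 ≤ R)
    (hF : AEStronglyMeasurable F (volume.restrict (Ioc 0 T)))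
    (hFR : ∀ᵐ s ∂volume.restrict (Ioc 0 T), ‖F s‖ ≤ R * (s ^ (-(1 / 2 : ℝ)) * m s)) :
    ContinuousOn (fun t => ∫ s in Ioc 0 t, A (t - s) (F s)) (Ioc 0 T) := by
  set D : ℝ → Z := fun t => ∫ s in Ioc 0 t, A (t - s) (F s) with hD
  have hC := h.nonneg
  have hK := hk.nonneg
  intro t ht
  have ht0 : 0 < t := ht.1
  rw [Metric.continuousWithinAt_iff']
  intro ε hε
  set e := a - β + θ with he
  have hepos : 0 < e := by have := hk.exponent_pos; rw [he]; linarith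
  set Q := C * R * (t / 2) ^ (-(1 / 2 : ℝ)) * K with hQ
  have hQ0 : 0 ≤ Q := by positivity
  -- The bound δ ≤ t/2 keeps s^{-1/2} below (t/2)^{-1/2} after the cut. The length 2δ leaves room
  -- for t' up to t + δ.
  obtain ⟨δ, hδ, hδt, hδe⟩ : ∃ δ, 0 < δ ∧ δ ≤ t / 2 ∧ Q * (2 * δ) ^ e < ε / 3 := by
    have hcont : Tendsto (fun δ : ℝ => Q * (2 * δ) ^ e) (𝓝[>] 0) (𝓝 0) := by
      have : ContinuousAt (fun δ : ℝ => Q * (2 * δ) ^ e) 0 := by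
        refine ContinuousAt.mul continuousAt_const (ContinuousAt.rpow_const (by fun_prop) ?_)
        exact Or.inr hepos.le
      have h0 := this.tendsto
      simp only [mul_zero, Real.zero_rpow hepos.ne'] at h0
      exact h0.mono_left nhdsWithin_le_nhds
    have h1 := hcont.eventually (gt_mem_nhds (show 0 < ε / 3 by linarith))
    have h2 : ∀ᶠ δ in 𝓝[>] (0 : ℝ), δ ≤ t / 2 :=
      nhdsWithin_le_nhds (ge_mem_nhds (by linarith))
    obtain ⟨δ, hδ1, hδ2, hδ3⟩ := (h1.and (h2.and self_mem_nhdsWithin)).exists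
    exact ⟨δ, hδ3, hδ2, hδ1⟩
  set c := t - δ with hc
  have hc0 : 0 < c := by linarith
  have hct : c < t := by linarith
  have hcT : c ≤ T := hct.le.trans ht.2
  have hFm : ∀ b t', 0 ≤ b → t' ≤ T → AEStronglyMeasurable F (volume.restrict (Ioc b t')) :=
    fun b t' hb ht' => hF.mono_measure (Measure.restrict_mono (Ioc_subset_Ioc hb ht') le_rfl)
  have hFb : ∀ b t', 0 ≤ b → t' ≤ T →
      ∀ᵐ s ∂volume.restrict (Ioc b t'), ‖F s‖ ≤ R * (s ^ (-(1 / 2 : ℝ)) * m s) :=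
    fun b t' hb ht' => ae_mono (Measure.restrict_mono (Ioc_subset_Ioc hb ht') le_rfl) hFR
  have hic : IntegrableOn (fun s => A (c - s) (F s)) (Ioc 0 c) := by
    refine h.integrableOn hk hβ le_rfl hc0 (hcT.trans hT) (hFm 0 c le_rfl hcT) (R := R) ?_
    simpa using hFb 0 c le_rfl hcT
  have key : ∀ t', c < t' → t' ≤ T → t' - c ≤ 2 * δ →
      ‖D t' - S (t' - c) (D c)‖ < ε / 3 := by
    intro t' hct' ht' hd
    have hL : 0 < t' - c := by linarith
    -- The kernel bound is stated for a weight singular at the lower endpoint c. The factor ((t' -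
    -- c)/(s - c))^{1/2} ≥ 1 is inserted to reach that form.
    have hb : ∀ᵐ s ∂volume.restrict (Ioc c t'), ‖F s‖ ≤
        (R * ((t / 2) ^ (-(1 / 2 : ℝ)) * (t' - c) ^ (1 / 2 : ℝ))) *
          ((s - c) ^ (-(1 / 2 : ℝ)) * m s) := by
      filter_upwards [hFb c t' hc0.le ht', ae_restrict_mem measurableSet_Ioc] with s h1 hs
      refine h1.trans ?_
      have hsc : 0 < s - c := sub_pos.2 hs.1
      have hm := hk.weight_nonneg s
      have h2 : s ^ (-(1 / 2 : ℝ)) ≤ (t / 2) ^ (-(1 / 2 : ℝ)) :=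
        Real.rpow_le_rpow_of_nonpos (by linarith) (by linarith [hs.1]) (by norm_num)
      have h3 : 1 ≤ (t' - c) ^ (1 / 2 : ℝ) * (s - c) ^ (-(1 / 2 : ℝ)) := by
        rw [Real.rpow_neg hsc.le, ← div_eq_mul_inv, one_le_div (by positivity)]
        exact Real.rpow_le_rpow hsc.le (by linarith [hs.2]) (by norm_num)
      have h4 : s ^ (-(1 / 2 : ℝ)) ≤ (t / 2) ^ (-(1 / 2 : ℝ)) *
          ((t' - c) ^ (1 / 2 : ℝ) * (s - c) ^ (-(1 / 2 : ℝ))) :=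
        h2.trans (le_mul_of_one_le_right (by positivity) h3)
      calc R * (s ^ (-(1 / 2 : ℝ)) * m s) ≤ R * (((t / 2) ^ (-(1 / 2 : ℝ)) *
          ((t' - c) ^ (1 / 2 : ℝ) * (s - c) ^ (-(1 / 2 : ℝ)))) * m s) := by gcongr
        _ = _ := by ring
    have hi2 := h.integrableOn hk hβ hc0.le hct' (ht'.trans hT) (hFm c t' hc0.le ht') hb
    have hs := integral_split (A := A) (A₁ := A) (G := S (t' - c)) hc0.le hct'.le
      (fun s y hs => by rw [h.comp _ _ _ hL.le (sub_pos.2 hs)]; congr 2; ring) hic hi2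
    have hn := h.norm_integral_le hk hβ hc0.le hct' (ht'.trans hT) (by positivity) hb
    simp only [hD]
    rw [hs.2, add_sub_cancel_left]
    refine (hn.trans (le_of_eq ?_)).trans_lt ((mul_le_mul_of_nonneg_left
      (Real.rpow_le_rpow hL.le hd hepos.le) hQ0).trans_lt hδe)
    rw [hQ, show e = 1 / 2 + (a - β + θ - 1 / 2) by rw [he]; ring, Real.rpow_add hL]
    ring
  have hS : ContinuousAt (fun t' => S (max (t' - c) 0) (D c)) t :=
    (h.continuous_uncurry.comp
      (by fun_prop : Continuous fun t' : ℝ => (t' - c, D c))).continuousAt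
  have hS' := (Metric.continuousAt_iff'.1 hS) (ε / 3) (by linarith)
  filter_upwards [nhdsWithin_le_nhds hS', self_mem_nhdsWithin,
    nhdsWithin_le_nhds (lt_mem_nhds hct),
    nhdsWithin_le_nhds (ge_mem_nhds (show t < c + 2 * δ by linarith))] with t' h1 h2 h3 h4
  rw [max_eq_left (by linarith), max_eq_left (by linarith)] at h1
  have k1 := key t' h3 h2.2 (by linarith)
  have k2 := key t hct ht.2 (by linarith)
  rw [← dist_eq_norm] at k1 k2
  calc dist (D t') (D t) ≤ dist (D t') (S (t' - c) (D c)) +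
        dist (S (t' - c) (D c)) (S (t - c) (D c)) + dist (S (t - c) (D c)) (D t) :=
        dist_triangle4 _ _ _ _
    _ < ε := by rw [dist_comm (S (t - c) (D c)) (D t)]; linarith

end IsSmoothing

end Smoothing

/-! ### Abstract Lipschitz nonlinearities. -/

section Nonlinearity

variable {X X' Y : Type*} [NormedAddCommGroup X] [NormedAddCommGroup X'] [NormedAddCommGroup Y]
  {m : ℝ → ℝ} {N : ℝ → X → X' → Y}

/-- A time-dependent nonlinearity vanishing at the origin, with Lipschitz constant `m s` at
time `s`. -/
structure IsNonlinearity (m : ℝ → ℝ) (N : ℝ → X → X' → Y) : Prop where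
  zero_apply : ∀ s, N s 0 0 = 0
  lipschitz : ∀ s x y x' y', ‖N s x y - N s x' y'‖ ≤ m s * (‖x - x'‖ + ‖y - y'‖)
  measurable : ∀ (T : ℝ) (f : ℝ → X) (g : ℝ → X'), T ≤ 1 →
    AEStronglyMeasurable f (volume.restrict (Ioc 0 T)) →
    AEStronglyMeasurable g (volume.restrict (Ioc 0 T)) →
    AEStronglyMeasurable (fun s => N s (f s) (g s)) (volume.restrict (Ioc 0 T))

/-- Since s - c ≤ 1, the difference in the first argument may also be charged with the weight (s -
c)^{-1/2} of the second. This is the origin of the factor 2. -/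
theorem IsNonlinearity.norm_sub_le (hN : IsNonlinearity m N) (hm : ∀ s, 0 ≤ m s) {c s R : ℝ}
    {x x' : X} {y y' : X'} (hcs : c < s) (hs : s - c ≤ 1) (hx : ‖x - x'‖ ≤ R)
    (hy : √(s - c) * ‖y - y'‖ ≤ R) :
    ‖N s x y - N s x' y'‖ ≤ 2 * R * ((s - c) ^ (-(1 / 2 : ℝ)) * m s) := by
  have hpos : 0 < s - c := sub_pos.2 hcs
  have hR : 0 ≤ R := (norm_nonneg _).trans hx
  have hsq : 0 < √(s - c) := Real.sqrt_pos.2 hpos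
  have hm := hm s
  have h1 : (s - c) ^ (-(1 / 2 : ℝ)) = (√(s - c))⁻¹ := by
    rw [Real.rpow_neg hpos.le, Real.sqrt_eq_rpow]
  have h2 : ‖y - y'‖ ≤ R * (√(s - c))⁻¹ := by
    rw [← div_eq_mul_inv, le_div_iff₀ hsq]; linarith
  have h3 : R ≤ R * (√(s - c))⁻¹ :=
    le_mul_of_one_le_right hR ((one_le_inv₀ hsq).2 (Real.sqrt_le_one.2 hs))
  rw [h1]
  calc ‖N s x y - N s x' y'‖ ≤ m s * (‖x - x'‖ + ‖y - y'‖) := hN.lipschitz ..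
    _ ≤ m s * (R * (√(s - c))⁻¹ + R * (√(s - c))⁻¹) := by gcongr; linarith
    _ = _ := by ring

theorem IsNonlinearity.norm_le (hN : IsNonlinearity m N) (hm : ∀ s, 0 ≤ m s) {c s R : ℝ}
    {x : X} {y : X'} (hcs : c < s) (hs : s - c ≤ 1) (hx : ‖x‖ ≤ R)
    (hy : √(s - c) * ‖y‖ ≤ R) :
    ‖N s x y‖ ≤ 2 * R * ((s - c) ^ (-(1 / 2 : ℝ)) * m s) := by
  have := hN.norm_sub_le hm (x := x) (x' := 0) (y := y) (y' := 0) hcs hs (by simpa) (by simpa)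
  simpa [hN.zero_apply] using this

theorem IsNonlinearity.aestronglyMeasurable_path (hN : IsNonlinearity m N) {T : ℝ} (hT : T ≤ 1)
    {f : ℝ → X} {g : ℝ → X'} (hf : ContinuousOn f (Ioc 0 T)) (hg : ContinuousOn g (Ioc 0 T)) :
    AEStronglyMeasurable (fun s => N s (f s) (g s)) (volume.restrict (Ioc 0 T)) :=
  hN.measurable T _ _ hT (hf.aestronglyMeasurable measurableSet_Ioc)
    (hg.aestronglyMeasurable measurableSet_Ioc)

theorem IsNonlinearity.ae_norm_le_path (hN : IsNonlinearity m N) (hm : ∀ s, 0 ≤ m s) {T R : ℝ}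
    (hT : T ≤ 1) {f : ℝ → X} {g : ℝ → X'} (hf : ∀ s ∈ Ioc 0 T, ‖f s‖ ≤ R)
    (hg : ∀ s ∈ Ioc 0 T, √s * ‖g s‖ ≤ R) :
    ∀ᵐ s ∂volume.restrict (Ioc 0 T),
      ‖N s (f s) (g s)‖ ≤ 2 * R * (s ^ (-(1 / 2 : ℝ)) * m s) := by
  filter_upwards [ae_restrict_mem measurableSet_Ioc] with s hs
  have := hN.norm_le hm hs.1 (by linarith [hs.2]) (hf s hs) (y := g s) (by simpa using hg s hs)
  rwa [sub_zero] at this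

end Nonlinearity

/-! ### Estimates, continuity and uniqueness for abstract Duhamel integrals. -/

section Nonlinear

variable {X X' Y : Type*} [NormedAddCommGroup X] [NormedSpace ℝ X] [NormedAddCommGroup X']
  [NormedSpace ℝ X'] [NormedAddCommGroup Y] [NormedSpace ℝ Y]

/-- A semigroup `S` on `X` with its extension `A` to `Y`, together with their "gradients" `G` and
`B` with values in `X'`, which gain half a power of the time. -/
structure IsParabolic (C α : ℝ) (S : ℝ → X →L[ℝ] X) (S' : ℝ → X' →L[ℝ] X')
    (A : ℝ → Y →L[ℝ] X) (B : ℝ → Y →L[ℝ] X') (G : ℝ → X →L[ℝ] X') : Prop where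
  smoothing : IsSmoothing C α S A
  grad_smoothing : IsSmoothing C (α + 1 / 2) S' B
  grad_semigroup : IsSmoothing C (1 / 2) S' G
  zero_apply : ∀ x, S 0 x = x
  add_apply : ∀ s t x, 0 < s → 0 < t → S s (S t x) = S (s + t) x

/-- The mild solution `S(t) x₀ + ∫₀ᵗ A(t - s) F(s) ds`. -/
def duhamel {Z : Type*} [NormedAddCommGroup Z] [NormedSpace ℝ Z] (S : ℝ → X →L[ℝ] Z)
    (A : ℝ → Y →L[ℝ] Z) (x₀ : X) (F : ℝ → Y) (t : ℝ) : Z :=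
  S t x₀ + ∫ s in Ioc 0 t, A (t - s) (F s)

variable {C α θ K : ℝ} {m : ℝ → ℝ} {S : ℝ → X →L[ℝ] X} {S' : ℝ → X' →L[ℝ] X'}
  {A : ℝ → Y →L[ℝ] X} {B : ℝ → Y →L[ℝ] X'} {G : ℝ → X →L[ℝ] X'} {N : ℝ → X → X' → Y}

theorem sqrt_mul_rpow_sub_half {x : ℝ} (hx : 0 < x) (θ : ℝ) :
    √x * x ^ (θ - 1 / 2) = x ^ θ := by
  rw [Real.sqrt_eq_rpow, ← Real.rpow_add hx]; congr 1; ring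

/-- The kernel exponent α + 1/2 is sharp for the gradient, whose integral is O((t-c)^{θ-1/2}) and is
repaired by the weight √(t-c). For A there is half a power to spare, so both components obey the
same bound. -/
theorem IsParabolic.norm_integral_le (h : IsParabolic C α S S' A B G)
    (hk : HasKernelBound m (α + 1 / 2) θ K)
    {F : ℝ → Y} {c t R : ℝ} (hc : 0 ≤ c) (hct : c < t) (ht : t ≤ 1) (hR : 0 ≤ R)
    (hFR : ∀ᵐ s ∂volume.restrict (Ioc c t), ‖F s‖ ≤ R * ((s - c) ^ (-(1 / 2 : ℝ)) * m s)) :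
    ‖∫ s in Ioc c t, A (t - s) (F s)‖ ≤ C * R * K * (t - c) ^ θ ∧
    √(t - c) * ‖∫ s in Ioc c t, B (t - s) (F s)‖ ≤ C * R * K * (t - c) ^ θ := by
  constructor
  · have := h.smoothing.norm_integral_le hk (by linarith) hc hct ht hR hFR
    rwa [show α + 1 / 2 - α + θ - 1 / 2 = θ by ring] at this
  · have := h.grad_smoothing.norm_integral_le hk le_rfl hc hct ht hR hFR
    rw [sub_self, zero_add] at this
    refine (mul_le_mul_of_nonneg_left this (Real.sqrt_nonneg _)).trans (le_of_eq ?_)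
    rw [← sqrt_mul_rpow_sub_half (sub_pos.2 hct) θ]; ring

theorem IsParabolic.sqrt_mul_norm_grad_le (h : IsParabolic C α S S' A B G) {t : ℝ} (ht : 0 < t)
    (ht1 : t ≤ 1) (x : X) : √t * ‖G t x‖ ≤ C * ‖x‖ := by
  have h1 := h.grad_semigroup.bound t x ht ht1
  refine (mul_le_mul_of_nonneg_left h1 (Real.sqrt_nonneg _)).trans (le_of_eq ?_)
  have := sqrt_mul_rpow_sub_half ht 0
  rw [zero_sub, Real.rpow_zero] at this
  linear_combination C * ‖x‖ * this

/-- The difference of two Duhamel integrals in the weighted norm. -/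
theorem IsParabolic.norm_integral_sub_le (h : IsParabolic C α S S' A B G)
    (hk : HasKernelBound m (α + 1 / 2) θ K)
    {F F' : ℝ → Y} {c t R R₁ : ℝ} (hc : 0 ≤ c) (hct : c < t) (ht : t ≤ 1) (hR : 0 ≤ R)
    (hF : AEStronglyMeasurable F (volume.restrict (Ioc c t)))
    (hF' : AEStronglyMeasurable F' (volume.restrict (Ioc c t)))
    (hFR : ∀ᵐ s ∂volume.restrict (Ioc c t), ‖F s‖ ≤ R₁ * ((s - c) ^ (-(1 / 2 : ℝ)) * m s))
    (hFR' : ∀ᵐ s ∂volume.restrict (Ioc c t), ‖F' s‖ ≤ R₁ * ((s - c) ^ (-(1 / 2 : ℝ)) * m s))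
    (hFF : ∀ᵐ s ∂volume.restrict (Ioc c t),
      ‖F s - F' s‖ ≤ R * ((s - c) ^ (-(1 / 2 : ℝ)) * m s)) :
    ‖(∫ s in Ioc c t, A (t - s) (F s)) - ∫ s in Ioc c t, A (t - s) (F' s)‖
      ≤ C * R * K * (t - c) ^ θ ∧
    √(t - c) * ‖(∫ s in Ioc c t, B (t - s) (F s)) - ∫ s in Ioc c t, B (t - s) (F' s)‖
      ≤ C * R * K * (t - c) ^ θ := by
  have h1 := h.norm_integral_le hk hc hct ht hR hFF
  simp only [map_sub] at h1
  rwa [integral_sub (h.smoothing.integrableOn hk (by linarith) hc hct ht hF hFR)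
    (h.smoothing.integrableOn hk (by linarith) hc hct ht hF' hFR'),
    integral_sub (h.grad_smoothing.integrableOn hk le_rfl hc hct ht hF hFR)
    (h.grad_smoothing.integrableOn hk le_rfl hc hct ht hF' hFR')] at h1

theorem IsParabolic.continuousOn_duhamel [CompleteSpace X] (h : IsParabolic C α S S' A B G)
    (hk : HasKernelBound m (α + 1 / 2) θ K) {F : ℝ → Y} {T R : ℝ} (hT : T ≤ 1) (hR : 0 ≤ R)
    (hF : AEStronglyMeasurable F (volume.restrict (Ioc 0 T)))
    (hFR : ∀ᵐ s ∂volume.restrict (Ioc 0 T), ‖F s‖ ≤ R * (s ^ (-(1 / 2 : ℝ)) * m s)) (x₀ : X) :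
    ContinuousOn (duhamel S A x₀ F) (Icc 0 T) := by
  refine ((h.smoothing.continuousOn x₀).mono fun t ht => ht.1).add ?_
  intro t ht
  rcases eq_or_lt_of_le ht.1 with h0 | h0
  -- At time 0 the integral is over the empty set, and for t' > 0 it is at most C R K t'^θ.
  · rw [← h0]
    have hlim : Tendsto (fun t : ℝ => C * R * K * t ^ θ) (𝓝 0) (𝓝 0) := by
      have : ContinuousAt (fun t : ℝ => C * R * K * t ^ θ) 0 :=
        ContinuousAt.mul continuousAt_const
          (ContinuousAt.rpow_const continuousAt_id (Or.inr hk.exponent_pos.le))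
      simpa [Real.zero_rpow hk.exponent_pos.ne'] using this.tendsto
    simp only [ContinuousWithinAt, Ioc_self, Measure.restrict_empty, integral_zero_measure]
    refine squeeze_zero_norm' ?_ (hlim.mono_left nhdsWithin_le_nhds)
    filter_upwards [self_mem_nhdsWithin] with t' ht'
    rcases eq_or_lt_of_le ht'.1 with h1 | h1
    · simp [← h1, Real.zero_rpow hk.exponent_pos.ne']
    · have := (h.norm_integral_le hk (F := F) le_rfl h1 (ht'.2.trans hT) hR (by
        simp only [sub_zero]
        exact ae_mono (Measure.restrict_mono (Ioc_subset_Ioc_right ht'.2) le_rfl) hFR)).1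
      simpa using this
  · have := h.smoothing.continuousOn_integral hk (by linarith) hT hR hF hFR t ⟨h0, ht.2⟩
    refine this.mono_of_mem_nhdsWithin ?_
    filter_upwards [self_mem_nhdsWithin, nhdsWithin_le_nhds (lt_mem_nhds h0)] with s hs hs0
    exact ⟨hs0, hs.2⟩

theorem IsParabolic.continuousOn_grad_duhamel [CompleteSpace X']
    (h : IsParabolic C α S S' A B G)
    (hk : HasKernelBound m (α + 1 / 2) θ K) {F : ℝ → Y} {T R : ℝ} (hT : T ≤ 1) (hR : 0 ≤ R)
    (hF : AEStronglyMeasurable F (volume.restrict (Ioc 0 T)))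
    (hFR : ∀ᵐ s ∂volume.restrict (Ioc 0 T), ‖F s‖ ≤ R * (s ^ (-(1 / 2 : ℝ)) * m s)) (x₀ : X) :
    ContinuousOn (duhamel G B x₀ F) (Ioc 0 T) :=
  ((h.grad_semigroup.continuousOn_apply x₀).mono fun _ ht => ht.1).add
    (h.grad_smoothing.continuousOn_integral hk le_rfl hT hR hF hFR)

theorem IsParabolic.norm_duhamel_le (h : IsParabolic C α S S' A B G)
    (hk : HasKernelBound m (α + 1 / 2) θ K) {F : ℝ → Y} {T R : ℝ} (hT : T ≤ 1) (hR : 0 ≤ R)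
    (hFR : ∀ᵐ s ∂volume.restrict (Ioc 0 T), ‖F s‖ ≤ R * (s ^ (-(1 / 2 : ℝ)) * m s)) (x₀ : X)
    {t : ℝ} (ht : t ∈ Ioc 0 T) :
    ‖duhamel S A x₀ F t‖ ≤ ‖x₀‖ + C * R * K ∧
    √t * ‖duhamel G B x₀ F t‖ ≤ C * ‖x₀‖ + C * R * K := by
  have ht1 : t ≤ 1 := ht.2.trans hT
  have h1 := h.norm_integral_le hk (F := F) le_rfl ht.1 ht1 hR (by
    simp only [sub_zero]
    exact ae_mono (Measure.restrict_mono (Ioc_subset_Ioc_right ht.2) le_rfl) hFR)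
  rw [sub_zero] at h1
  have h2 : C * R * K * t ^ θ ≤ C * R * K := by
    have := h.smoothing.nonneg
    have := hk.nonneg
    exact mul_le_of_le_one_right (by positivity)
      (Real.rpow_le_one ht.1.le ht1 hk.exponent_pos.le)
  constructor
  · refine (norm_add_le _ _).trans ?_
    gcongr
    · exact h.smoothing.contraction t x₀ ht.1.le
    · exact h1.1.trans h2
  · refine (mul_le_mul_of_nonneg_left (norm_add_le _ _) (Real.sqrt_nonneg _)).trans ?_
    rw [mul_add]
    exact add_le_add (h.sqrt_mul_norm_grad_le ht.1 ht1 x₀) (h1.2.trans h2)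

/-- Two trajectories which satisfy the integral equation from every positive initial time and
have the same initial value coincide. -/
theorem IsParabolic.eqOn_of_evolution (h : IsParabolic C α S S' A B G)
    (hk : HasKernelBound m (α + 1 / 2) θ K) (hN : IsNonlinearity m N)
    {T : ℝ} (hT : T ≤ 1) (hsmall : 2 * C * K * T ^ θ ≤ 1 / 2)
    {f f' : ℝ → X} {g g' : ℝ → X'}
    (hf : ContinuousOn f (Icc 0 T)) (hf' : ContinuousOn f' (Icc 0 T))
    (hg : ContinuousOn g (Ioc 0 T)) (hg' : ContinuousOn g' (Ioc 0 T)) (h0 : f 0 = f' 0)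
    (ef : ∀ c t, 0 < c → c < t → t ≤ T →
      f t = S (t - c) (f c) + ∫ s in Ioc c t, A (t - s) (N s (f s) (g s)))
    (ef' : ∀ c t, 0 < c → c < t → t ≤ T →
      f' t = S (t - c) (f' c) + ∫ s in Ioc c t, A (t - s) (N s (f' s) (g' s)))
    (eg : ∀ c t, 0 < c → c < t → t ≤ T →
      g t = G (t - c) (f c) + ∫ s in Ioc c t, B (t - s) (N s (f s) (g s)))
    (eg' : ∀ c t, 0 < c → c < t → t ≤ T →
      g' t = G (t - c) (f' c) + ∫ s in Ioc c t, B (t - s) (N s (f' s) (g' s))) :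
    EqOn f f' (Icc 0 T) := by
  have hC := h.smoothing.nonneg
  have hK := hk.nonneg
  have hmeas : ∀ {f : ℝ → X} {g : ℝ → X'}, ContinuousOn f (Icc 0 T) → ContinuousOn g (Ioc 0 T) →
      AEStronglyMeasurable (fun s => N s (f s) (g s)) (volume.restrict (Ioc 0 T)) :=
    fun hf hg => hN.measurable T _ _ hT
      ((hf.mono Ioc_subset_Icc_self).aestronglyMeasurable measurableSet_Ioc)
      (hg.aestronglyMeasurable measurableSet_Ioc)
  -- Only compactness of [c, T] is available. The bound may blow up as c → 0.
  have hbdd : ∀ c, 0 < c → ∃ R, 0 ≤ R ∧ ∀ s ∈ Icc c T,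
      ‖f s‖ ≤ R ∧ ‖f' s‖ ≤ R ∧ ‖g s‖ ≤ R ∧ ‖g' s‖ ≤ R := by
    intro c hc
    have s1 : Icc c T ⊆ Icc 0 T := Icc_subset_Icc_left hc.le
    have s2 : Icc c T ⊆ Ioc 0 T := fun s hs => ⟨hc.trans_le hs.1, hs.2⟩
    obtain ⟨R1, h1⟩ := isCompact_Icc.exists_bound_of_continuousOn (hf.mono s1)
    obtain ⟨R2, h2⟩ := isCompact_Icc.exists_bound_of_continuousOn (hf'.mono s1)
    obtain ⟨R3, h3⟩ := isCompact_Icc.exists_bound_of_continuousOn (hg.mono s2)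
    obtain ⟨R4, h4⟩ := isCompact_Icc.exists_bound_of_continuousOn (hg'.mono s2)
    refine ⟨max 0 (max (max R1 R2) (max R3 R4)), le_max_left _ _, fun s hs => ?_⟩
    have e1 := h1 s hs
    have e2 := h2 s hs
    have e3 := h3 s hs
    have e4 := h4 s hs
    simp only [le_max_iff]
    tauto
  -- The essential point is that the constant does not depend on c, although the bound just obtained
  -- does.
  have key : ∀ c t, 0 < c → c < t → t ≤ T → ‖f t - f' t‖ ≤ 2 * (1 + C) * ‖f c - f' c‖ := by
    intro c t hc hct htT
    obtain ⟨R₀, hR₀, hb⟩ := hbdd c hc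
    have hsq : ∀ s ∈ Icc c T, √(s - c) ≤ 1 := fun s hs =>
      Real.sqrt_le_one.2 (by linarith [hs.2])
    have hFb : ∀ t, c < t → t ≤ T → ∀ᵐ s ∂volume.restrict (Ioc c t),
        ‖N s (f s) (g s)‖ ≤ (2 * R₀) * ((s - c) ^ (-(1 / 2 : ℝ)) * m s) ∧
        ‖N s (f' s) (g' s)‖ ≤ (2 * R₀) * ((s - c) ^ (-(1 / 2 : ℝ)) * m s) := by
      intro t _ ht
      filter_upwards [ae_restrict_mem measurableSet_Ioc] with s hs
      have hs' : s ∈ Icc c T := ⟨hs.1.le, hs.2.trans ht⟩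
      obtain ⟨b1, b2, b3, b4⟩ := hb s hs'
      refine ⟨hN.norm_le hk.weight_nonneg hs.1 (by linarith [hs'.2]) b1 ?_,
        hN.norm_le hk.weight_nonneg hs.1 (by linarith [hs'.2]) b2 ?_⟩
      · exact (mul_le_of_le_one_left (norm_nonneg _) (hsq s hs')).trans b3
      · exact (mul_le_of_le_one_left (norm_nonneg _) (hsq s hs')).trans b4
    -- With w = ‖f c - f' c‖, one use of the equation improves a bound R to (1 + C)w + R/2. The
    -- fixed point of this map is 2(1 + C)w, and the crude initial excess 2R₀ is halved at each
    -- round.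
    have step : ∀ n : ℕ, ∀ s ∈ Ioc c T,
        ‖f s - f' s‖ ≤ 2 * (1 + C) * ‖f c - f' c‖ + 2 * R₀ / 2 ^ n ∧
        √(s - c) * ‖g s - g' s‖ ≤ 2 * (1 + C) * ‖f c - f' c‖ + 2 * R₀ / 2 ^ n := by
      intro n
      induction n with
      | zero =>
        intro s hs
        have hs' : s ∈ Icc c T := ⟨hs.1.le, hs.2⟩
        obtain ⟨b1, b2, b3, b4⟩ := hb s hs'
        have e1 := norm_sub_le (f s) (f' s)
        have e2 := norm_sub_le (g s) (g' s)
        have e3 := mul_le_of_le_one_left (norm_nonneg (g s - g' s)) (hsq s hs')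
        have e4 : 0 ≤ 2 * (1 + C) * ‖f c - f' c‖ := by positivity
        simp only [pow_zero, div_one]
        constructor <;> linarith
      | succ n ih =>
        set R := 2 * (1 + C) * ‖f c - f' c‖ + 2 * R₀ / 2 ^ n with hRdef
        have hR : 0 ≤ R := by positivity
        intro s hs
        have hs1 : s ≤ 1 := hs.2.trans hT
        have hmono : volume.restrict (Ioc c s) ≤ volume.restrict (Ioc 0 T) :=
          Measure.restrict_mono (Ioc_subset_Ioc hc.le hs.2) le_rfl
        have hd := h.norm_integral_sub_le hk hc.le hs.1 hs1 (R := 2 * R) (by positivity)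
          ((hmeas hf hg).mono_measure hmono) ((hmeas hf' hg').mono_measure hmono)
          ((hFb s hs.1 hs.2).mono fun _ h => h.1) ((hFb s hs.1 hs.2).mono fun _ h => h.2) (by
            filter_upwards [ae_restrict_mem measurableSet_Ioc] with τ hτ
            have hτ' : τ ∈ Ioc c T := ⟨hτ.1, hτ.2.trans hs.2⟩
            exact hN.norm_sub_le hk.weight_nonneg hτ.1 (by linarith [hτ'.2])
              (ih τ hτ').1 (ih τ hτ').2)
        have hsm : C * (2 * R) * K * (s - c) ^ θ ≤ R / 2 := by
          have : (s - c) ^ θ ≤ T ^ θ :=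
            Real.rpow_le_rpow (by linarith [hs.1]) (by linarith [hs.2]) hk.exponent_pos.le
          calc C * (2 * R) * K * (s - c) ^ θ ≤ C * (2 * R) * K * T ^ θ := by gcongr
            _ = R * (2 * C * K * T ^ θ) := by ring
            _ ≤ R * (1 / 2) := by gcongr
            _ = R / 2 := by ring
        have hhalf : R / 2 = (1 + C) * ‖f c - f' c‖ + 2 * R₀ / 2 ^ (n + 1) := by
          rw [hRdef, pow_succ]; field_simp
        have hpos : 0 < s - c := sub_pos.2 hs.1
        have hsc1 : s - c ≤ 1 := by linarith
        have hw := norm_nonneg (f c - f' c)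
        have hCw : 0 ≤ C * ‖f c - f' c‖ := by positivity
        constructor
        · have e : f s - f' s = S (s - c) (f c - f' c) +
              ((∫ τ in Ioc c s, A (s - τ) (N τ (f τ) (g τ))) -
                ∫ τ in Ioc c s, A (s - τ) (N τ (f' τ) (g' τ))) := by
            rw [ef c s hc hs.1 hs.2, ef' c s hc hs.1 hs.2, map_sub]; abel
          rw [e]
          refine (norm_add_le _ _).trans ?_
          have := h.smoothing.contraction (s - c) (f c - f' c) hpos.le
          linarith [hd.1]
        · have e : g s - g' s = G (s - c) (f c - f' c) +
              ((∫ τ in Ioc c s, B (s - τ) (N τ (f τ) (g τ))) -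
                ∫ τ in Ioc c s, B (s - τ) (N τ (f' τ) (g' τ))) := by
            rw [eg c s hc hs.1 hs.2, eg' c s hc hs.1 hs.2, map_sub]; abel
          rw [e]
          refine (mul_le_mul_of_nonneg_left (norm_add_le _ _) (Real.sqrt_nonneg _)).trans ?_
          rw [mul_add]
          have := h.sqrt_mul_norm_grad_le hpos hsc1 (f c - f' c)
          linarith [hd.2]
    have hlim : Tendsto (fun n : ℕ => 2 * (1 + C) * ‖f c - f' c‖ + 2 * R₀ / 2 ^ n) atTop
        (𝓝 (2 * (1 + C) * ‖f c - f' c‖ + 0)) := by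
      refine tendsto_const_nhds.add ?_
      have := (tendsto_pow_atTop_nhds_zero_of_lt_one (r := (1 / 2 : ℝ)) (by norm_num)
        (by norm_num)).const_mul (2 * R₀)
      simpa [div_eq_mul_inv] using this
    rw [add_zero] at hlim
    exact ge_of_tendsto' hlim fun n => (step n t ⟨hct, htT⟩).1
  intro t ht
  rcases eq_or_lt_of_le ht.1 with h1 | h1
  · rw [← h1, h0]
  have hT0 : 0 < T := h1.trans_le ht.2
  -- As c → 0 the right-hand side tends to 0 by continuity in X alone. No information on g near 0
  -- enters.
  have hw : ContinuousWithinAt (fun c => 2 * (1 + C) * ‖f c - f' c‖) (Icc 0 T) 0 :=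
    ((((hf.sub hf').norm).const_smul (2 * (1 + C))) 0 ⟨le_rfl, hT0.le⟩)
  have hlim : Tendsto (fun c => 2 * (1 + C) * ‖f c - f' c‖) (𝓝[>] 0) (𝓝 0) := by
    have := hw.tendsto
    simp only [h0, sub_self, norm_zero, mul_zero] at this
    refine this.mono_left ?_
    rw [← nhdsWithin_Ioc_eq_nhdsGT hT0]
    exact nhdsWithin_mono _ Ioc_subset_Icc_self
  have h2 : ‖f t - f' t‖ ≤ 0 := by
    refine ge_of_tendsto hlim ?_
    filter_upwards [Ioo_mem_nhdsGT h1] with c hc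
    exact key c t hc.1 hc.2 ht.2
  exact sub_eq_zero.1 (norm_le_zero_iff.1 h2)

end Nonlinear

open scoped BoundedContinuousFunction

/-! ### Bounded continuous paths with a weighted second component. -/

section Path

variable {X X' : Type*} [NormedAddCommGroup X] [NormedAddCommGroup X']

open Classical in
/-- The first component of a path on `(0,T]`, extended by zero. -/
def pathFst {T : ℝ} (x : Ioc (0 : ℝ) T →ᵇ X × X') (s : ℝ) : X :=
  if h : s ∈ Ioc (0 : ℝ) T then (x ⟨s, h⟩).1 else 0

theorem pathFst_apply {T s : ℝ} (x : Ioc (0 : ℝ) T →ᵇ X × X') (h : s ∈ Ioc (0 : ℝ) T) :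
    pathFst x s = (x ⟨s, h⟩).1 := dif_pos h

theorem continuousOn_pathFst {T : ℝ} (x : Ioc (0 : ℝ) T →ᵇ X × X') :
    ContinuousOn (pathFst x) (Ioc 0 T) := by
  rw [continuousOn_iff_continuous_domRestrict]
  have : (Ioc 0 T).domRestrict (pathFst x) = fun s => (x s).1 := by
    ext s; exact pathFst_apply x s.2
  rw [this]; fun_prop

variable [NormedSpace ℝ X']

open Classical in
/-- The second component of a path on `(0,T]`, divided by `√s` and extended by zero. -/
def pathSnd {T : ℝ} (x : Ioc (0 : ℝ) T →ᵇ X × X') (s : ℝ) : X' :=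
  if h : s ∈ Ioc (0 : ℝ) T then (√s)⁻¹ • (x ⟨s, h⟩).2 else 0

theorem sqrt_smul_pathSnd {T s : ℝ} (x : Ioc (0 : ℝ) T →ᵇ X × X') (h : s ∈ Ioc (0 : ℝ) T) :
    √s • pathSnd x s = (x ⟨s, h⟩).2 := by
  rw [pathSnd, dif_pos h, smul_inv_smul₀ (Real.sqrt_pos.2 h.1).ne']

theorem continuousOn_pathSnd {T : ℝ} (x : Ioc (0 : ℝ) T →ᵇ X × X') :
    ContinuousOn (pathSnd x) (Ioc 0 T) := by
  rw [continuousOn_iff_continuous_domRestrict]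
  have : (Ioc 0 T).domRestrict (pathSnd x) = fun s : Ioc (0 : ℝ) T => (√(s : ℝ))⁻¹ • (x s).2 := by
    ext s; exact dif_pos s.2
  rw [this]
  refine Continuous.smul (Continuous.inv₀ (by fun_prop) fun s => (Real.sqrt_pos.2 s.2.1).ne') ?_
  fun_prop

end Path

/-! ### The contraction and its fixed point. -/

section FixedPoint

variable {X X' Y : Type*} [NormedAddCommGroup X] [NormedSpace ℝ X] [NormedAddCommGroup X']
  [NormedSpace ℝ X'] [NormedAddCommGroup Y] [NormedSpace ℝ Y]

variable {C α θ K : ℝ} {m : ℝ → ℝ} {S : ℝ → X →L[ℝ] X} {S' : ℝ → X' →L[ℝ] X'}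
  {A : ℝ → Y →L[ℝ] X} {B : ℝ → Y →L[ℝ] X'} {G : ℝ → X →L[ℝ] X'} {N : ℝ → X → X' → Y}

/-- The solution map is a contraction for the weighted norm, with constant `2CKT^θ`. -/
theorem IsParabolic.norm_duhamel_sub_le (h : IsParabolic C α S S' A B G)
    (hk : HasKernelBound m (α + 1 / 2) θ K) (hN : IsNonlinearity m N) {T R R₁ : ℝ}
    (hT : T ≤ 1) (hR : 0 ≤ R) {f f' : ℝ → X} {g g' : ℝ → X'}
    (hf : ContinuousOn f (Ioc 0 T)) (hg : ContinuousOn g (Ioc 0 T))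
    (hf' : ContinuousOn f' (Ioc 0 T)) (hg' : ContinuousOn g' (Ioc 0 T))
    (bf : ∀ s ∈ Ioc 0 T, ‖f s‖ ≤ R₁) (bg : ∀ s ∈ Ioc 0 T, √s * ‖g s‖ ≤ R₁)
    (bf' : ∀ s ∈ Ioc 0 T, ‖f' s‖ ≤ R₁) (bg' : ∀ s ∈ Ioc 0 T, √s * ‖g' s‖ ≤ R₁)
    (df : ∀ s ∈ Ioc 0 T, ‖f s - f' s‖ ≤ R) (dg : ∀ s ∈ Ioc 0 T, √s * ‖g s - g' s‖ ≤ R)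
    (x₀ : X) {t : ℝ} (ht : t ∈ Ioc 0 T) :
    ‖duhamel S A x₀ (fun s => N s (f s) (g s)) t - duhamel S A x₀ (fun s => N s (f' s) (g' s)) t‖
      ≤ 2 * C * K * T ^ θ * R ∧
    √t * ‖duhamel G B x₀ (fun s => N s (f s) (g s)) t
      - duhamel G B x₀ (fun s => N s (f' s) (g' s)) t‖ ≤ 2 * C * K * T ^ θ * R := by
  have hmono : volume.restrict (Ioc 0 t) ≤ volume.restrict (Ioc 0 T) :=
    Measure.restrict_mono (Ioc_subset_Ioc_right ht.2) le_rfl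
  have hC := h.smoothing.nonneg
  have hK := hk.nonneg
  have hd := h.norm_integral_sub_le hk le_rfl ht.1 (ht.2.trans hT) (R := 2 * R) (R₁ := 2 * R₁)
    (by positivity)
    ((hN.aestronglyMeasurable_path hT hf hg).mono_measure hmono)
    ((hN.aestronglyMeasurable_path hT hf' hg').mono_measure hmono)
    (by simp only [sub_zero]; exact ae_mono hmono (hN.ae_norm_le_path hk.weight_nonneg hT bf bg))
    (by simp only [sub_zero]; exact ae_mono hmono (hN.ae_norm_le_path hk.weight_nonneg hT bf' bg'))
    (by
      filter_upwards [ae_restrict_mem measurableSet_Ioc] with s hs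
      have hs' : s ∈ Ioc 0 T := ⟨hs.1, hs.2.trans ht.2⟩
      exact hN.norm_sub_le hk.weight_nonneg hs.1 (by linarith [hs'.2]) (df s hs')
        (by simpa using dg s hs'))
  rw [sub_zero] at hd
  have hsm : C * (2 * R) * K * t ^ θ ≤ 2 * C * K * T ^ θ * R := by
    have : t ^ θ ≤ T ^ θ := Real.rpow_le_rpow ht.1.le ht.2 hk.exponent_pos.le
    calc C * (2 * R) * K * t ^ θ ≤ C * (2 * R) * K * T ^ θ := by gcongr
      _ = _ := by ring
  simp only [duhamel, add_sub_add_left_eq_sub]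
  exact ⟨hd.1.trans hsm, hd.2.trans hsm⟩

/-- The Banach fixed point theorem is applied in the complete space of bounded continuous maps t ↦
(f(t), √t g(t)) on (0,T]. Here g is an independent unknown, so no closedness of a gradient operator
is needed. -/
theorem IsParabolic.exists_fixedPoint [CompleteSpace X] [CompleteSpace X']
    (h : IsParabolic C α S S' A B G)
    (hk : HasKernelBound m (α + 1 / 2) θ K) (hN : IsNonlinearity m N)
    {T : ℝ} (hT : T ≤ 1) (hsmall : 2 * C * K * T ^ θ ≤ 1 / 2) (x₀ : X) :
    ∃ (f : ℝ → X) (g : ℝ → X') (R : ℝ), ContinuousOn f (Icc 0 T) ∧ ContinuousOn g (Ioc 0 T) ∧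
      (∀ t ∈ Icc 0 T, ‖f t‖ ≤ R) ∧ (∀ t ∈ Ioc 0 T, √t * ‖g t‖ ≤ R) ∧
      (∀ t ∈ Icc 0 T, f t = duhamel S A x₀ (fun s => N s (f s) (g s)) t) ∧
      (∀ t ∈ Ioc 0 T, g t = duhamel G B x₀ (fun s => N s (f s) (g s)) t) := by
  have hC := h.smoothing.nonneg
  have hK := hk.nonneg
  let F : (Ioc (0 : ℝ) T →ᵇ X × X') → ℝ → Y := fun x s => N s (pathFst x s) (pathSnd x s)
  have b1 : ∀ (x : Ioc (0 : ℝ) T →ᵇ X × X'), ∀ s ∈ Ioc 0 T, ‖pathFst x s‖ ≤ ‖x‖ := by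
    intro x s hs
    rw [pathFst_apply x hs]
    exact (norm_fst_le _).trans (x.norm_coe_le_norm _)
  have b2 : ∀ (x : Ioc (0 : ℝ) T →ᵇ X × X'), ∀ s ∈ Ioc 0 T, √s * ‖pathSnd x s‖ ≤ ‖x‖ := by
    intro x s hs
    rw [← Real.norm_of_nonneg (Real.sqrt_nonneg s), ← norm_smul, sqrt_smul_pathSnd x hs]
    exact (norm_snd_le _).trans (x.norm_coe_le_norm _)
  have hFm := fun x => hN.aestronglyMeasurable_path hT (continuousOn_pathFst x)
    (continuousOn_pathSnd x)
  have hFb := fun x => hN.ae_norm_le_path hk.weight_nonneg hT (b1 x) (b2 x)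
  have hx2 : ∀ x : Ioc (0 : ℝ) T →ᵇ X × X', 0 ≤ 2 * ‖x‖ := fun x => by positivity
  have hc1 := fun x => h.continuousOn_duhamel hk hT (hx2 x) (hFm x) (hFb x) x₀
  have hc2 := fun x => h.continuousOn_grad_duhamel hk hT (hx2 x) (hFm x) (hFb x) x₀
  have hbd := fun x => fun t (ht : t ∈ Ioc (0 : ℝ) T) =>
    h.norm_duhamel_le hk hT (hx2 x) (hFb x) x₀ ht
  let Φ : (Ioc (0 : ℝ) T →ᵇ X × X') → (Ioc (0 : ℝ) T →ᵇ X × X') := fun x =>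
    BoundedContinuousFunction.ofNormedAddCommGroup
      (fun t => (duhamel S A x₀ (F x) t, √(t : ℝ) • duhamel G B x₀ (F x) t))
      (by
        refine Continuous.prodMk ?_ (Continuous.smul (by fun_prop) ?_)
        · exact ((hc1 x).mono Ioc_subset_Icc_self).domRestrict
        · exact (hc2 x).domRestrict)
      ((1 + C) * ‖x₀‖ + C * (2 * ‖x‖) * K)
      (by
        intro t
        have := hbd x t t.2
        have e1 := norm_nonneg x₀
        have e2 := mul_nonneg hC e1
        refine max_le (this.1.trans (by linarith)) ?_
        rw [norm_smul, Real.norm_of_nonneg (Real.sqrt_nonneg _)]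
        exact this.2.trans (by linarith))
  have hΦ : ContractingWith (1 / 2 : ℝ≥0) Φ := by
    refine ⟨NNReal.half_lt_self one_ne_zero, LipschitzWith.of_dist_le_mul fun x y => ?_⟩
    rw [BoundedContinuousFunction.dist_le (by positivity)]
    intro t
    have d1 : ∀ s ∈ Ioc 0 T, ‖pathFst x s - pathFst y s‖ ≤ dist x y := by
      intro s hs
      rw [pathFst_apply x hs, pathFst_apply y hs, ← Prod.fst_sub, dist_eq_norm]
      exact (norm_fst_le _).trans ((x - y).norm_coe_le_norm ⟨s, hs⟩)
    have d2 : ∀ s ∈ Ioc 0 T, √s * ‖pathSnd x s - pathSnd y s‖ ≤ dist x y := by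
      intro s hs
      rw [← Real.norm_of_nonneg (Real.sqrt_nonneg s), ← norm_smul, smul_sub,
        sqrt_smul_pathSnd x hs, sqrt_smul_pathSnd y hs, ← Prod.snd_sub, dist_eq_norm]
      exact (norm_snd_le _).trans ((x - y).norm_coe_le_norm ⟨s, hs⟩)
    have hd := h.norm_duhamel_sub_le hk hN hT (R := dist x y) (R₁ := max ‖x‖ ‖y‖) dist_nonneg
      (continuousOn_pathFst x) (continuousOn_pathSnd x) (continuousOn_pathFst y)
      (continuousOn_pathSnd y)
      (fun s hs => (b1 x s hs).trans (le_max_left _ _))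
      (fun s hs => (b2 x s hs).trans (le_max_left _ _))
      (fun s hs => (b1 y s hs).trans (le_max_right _ _))
      (fun s hs => (b2 y s hs).trans (le_max_right _ _)) d1 d2 x₀ t.2
    have hle : 2 * C * K * T ^ θ * dist x y ≤ ((1 / 2 : ℝ≥0) : ℝ) * dist x y := by
      have : ((1 / 2 : ℝ≥0) : ℝ) = 1 / 2 := by norm_num
      rw [this]; gcongr
    rw [dist_eq_norm]
    refine max_le (hd.1.trans hle) ?_
    refine le_trans (le_of_eq ?_) (hd.2.trans hle)
    change ‖√(t : ℝ) • duhamel G B x₀ (F x) t - √(t : ℝ) • duhamel G B x₀ (F y) t‖ = _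
    rw [← smul_sub, norm_smul, Real.norm_of_nonneg (Real.sqrt_nonneg _)]
  set x := ContractingWith.fixedPoint Φ hΦ with hx
  have hfix : Φ x = x := ContractingWith.fixedPoint_isFixedPt hΦ
  have e1 : ∀ t ∈ Ioc 0 T, pathFst x t = duhamel S A x₀ (F x) t := by
    intro t ht
    rw [pathFst_apply x ht, ← congrArg (fun z => z ⟨t, ht⟩) hfix]
    rfl
  have e2 : ∀ t ∈ Ioc 0 T, pathSnd x t = duhamel G B x₀ (F x) t := by
    intro t ht
    have h1 : √t • pathSnd x t = √t • duhamel G B x₀ (F x) t := by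
      rw [sqrt_smul_pathSnd x ht, ← congrArg (fun z => z ⟨t, ht⟩) hfix]
      rfl
    exact smul_right_injective _ (Real.sqrt_pos.2 ht.1).ne' h1
  -- The fixed point lives on (0,T], and `pathFst` has the default value 0 at time 0. The Duhamel
  -- expression agrees with it on (0,T] and has the correct value and continuity at 0.
  refine ⟨duhamel S A x₀ (F x), pathSnd x, ‖x₀‖ + ‖x‖, hc1 x, continuousOn_pathSnd x, ?_,
    fun t ht => (b2 x t ht).trans (by linarith [norm_nonneg x₀]), ?_, ?_⟩
  · intro t ht
    rcases eq_or_lt_of_le ht.1 with h1 | h1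
    · simp [← h1, duhamel, h.zero_apply]
    · rw [← e1 t ⟨h1, ht.2⟩]
      exact (b1 x t ⟨h1, ht.2⟩).trans (by linarith [norm_nonneg x₀])
  · intro t ht
    simp only [duhamel]
    congr 1
    refine setIntegral_congr_fun measurableSet_Ioc fun s hs => ?_
    have := e1 s ⟨hs.1, hs.2.trans ht.2⟩
    simp only [duhamel] at this
    simp only [F, this]
  · intro t ht
    rw [e2 t ht]
    simp only [duhamel]
    congr 1
    refine setIntegral_congr_fun measurableSet_Ioc fun s hs => ?_
    have := e1 s ⟨hs.1, hs.2.trans ht.2⟩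
    simp only [duhamel] at this
    simp only [F, this]

end FixedPoint

/-! ### Translations of L^q and the pairing with the dual exponent. -/

section Translation

variable {d : ℕ} {q : ℝ≥0∞} [Fact (1 ≤ q)]

/-- The translation `h ↦ h(· - y)` on `L^q`. -/
def shift (y : E d) : LL d q →ₗᵢ[ℝ] LL d q :=
  Lp.compMeasurePreservingₗᵢ ℝ (fun x => x - y) (measurePreserving_sub_right volume y)

theorem shift_coe (y : E d) (h : LL d q) : shift y h =ᵐ[volume] fun x => h (x - y) :=
  Lp.coeFn_compMeasurePreserving h (measurePreserving_sub_right volume y)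

theorem shift_shift (y z : E d) (h : LL d q) : shift y (shift z h) = shift (z + y) h := by
  refine Lp.ext ?_
  have h1 : (fun x => shift z h (x - y)) =ᵐ[volume] fun x => h (x - y - z) :=
    (measurePreserving_sub_right volume y).quasiMeasurePreserving.ae_eq_comp (shift_coe z h)
  filter_upwards [shift_coe y (shift z h), h1, shift_coe (z + y) h] with x e1 e2 e3
  rw [e1, e2, e3]
  congr 1; abel

/-- This is where q < ∞ is essential. It makes convolution a Bochner integral of translates and
gives strong continuity of the heat semigroup. -/
theorem continuous_shift (hq : q ≠ ⊤) (h : LL d q) : Continuous fun y : E d => shift y h := by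
  let g : C(E d, C(E d, E d)) :=
    (ContinuousMap.mk (fun a : E d × E d => a.2 - a.1) (by fun_prop)).curry
  exact (continuous_const (y := h)).compMeasurePreservingLp g.continuous
    (fun y => measurePreserving_sub_right volume y) hq

instance fact_one_le_conjExponent : Fact (1 ≤ ENNReal.conjExponent q) := ⟨le_self_add⟩

/-- The functional `f ↦ ∫ f φ` on `L^q`, for `φ` in the dual space. -/
def pairing (φ : E d → ℝ) (hφ : MemLp φ (ENNReal.conjExponent q) volume) : LL d q →L[ℝ] ℝ :=
  ((ContinuousLinearMap.mul ℝ ℝ).lpPairing volume q (ENNReal.conjExponent q)).flip (hφ.toLp φ)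

theorem pairing_apply (φ : E d → ℝ) (hφ : MemLp φ (ENNReal.conjExponent q) volume)
    (f : LL d q) : pairing φ hφ f = ∫ x, f x * φ x := by
  rw [pairing, ContinuousLinearMap.flip_apply, ContinuousLinearMap.lpPairing_eq_integral]
  refine integral_congr_ae ?_
  filter_upwards [hφ.coeFn_toLp] with x hx
  simp [hx]

theorem integrable_mul_dual {φ : E d → ℝ} (hφ : MemLp φ (ENNReal.conjExponent q) volume)
    (f : LL d q) : Integrable (fun x => f x * φ x) :=
  (Lp.memLp f).integrable_mul hφ

theorem memLp_indicator_one {p : ℝ≥0∞} {s : Set (E d)} (hs : MeasurableSet s)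
    (hμ : volume s < ⊤) : MemLp (s.indicator (1 : E d → ℝ)) p volume :=
  memLp_indicator_const p hs 1 (Or.inr hμ.ne)

end Translation

/-! ### Convolution as a Bochner integral of translates. -/

section Convolution

variable {d : ℕ} {q : ℝ≥0∞} [Fact (1 ≤ q)]

instance fact_one_ne_top : Fact ((1 : ℝ≥0∞) ≠ ⊤) := ⟨ENNReal.one_ne_top⟩

/-- This licenses Fubini. By Hölder and translation invariance the inner integral over x is at most
|k(y)| ‖φ‖ ‖h‖, which is integrable in y. -/
theorem integrable_prod_mul_sub {φ : E d → ℝ}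
    (hφ : MemLp φ (ENNReal.conjExponent q) volume) (k : LL d 1) (h : LL d q) :
    Integrable (fun z : E d × E d => k z.1 * (h (z.2 - z.1) * φ z.2))
      (volume.prod volume) := by
  have hm : AEStronglyMeasurable (fun z : E d × E d => k z.1 * (h (z.2 - z.1) * φ z.2))
      (volume.prod volume) := by
    refine (L1.integrable_coeFn k).1.comp_fst.mul (AEStronglyMeasurable.mul ?_ hφ.1.comp_snd)
    have := (quasiMeasurePreserving_sub (volume : Measure (E d)) volume).comp
      (Measure.measurePreserving_swap (μ := (volume : Measure (E d)))
        (ν := volume)).quasiMeasurePreserving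
    exact (Lp.aestronglyMeasurable h).comp_quasiMeasurePreserving this
  have hcomp : ∀ y : E d, ∀ᵐ x, shift y h x = h (x - y) := fun y => shift_coe y h
  have habs : MemLp (fun x => ‖φ x‖) (ENNReal.conjExponent q) volume := hφ.norm
  rw [integrable_prod_iff hm]
  constructor
  · refine ae_of_all _ fun y => ?_
    refine ((integrable_mul_dual hφ (shift y h)).congr ?_).const_mul (k y)
    filter_upwards [hcomp y] with x hx
    rw [hx]
  · have hbound : ∀ y, ∫ x, ‖k y * (h (x - y) * φ x)‖ ≤
        ‖k y‖ * (‖hφ.toLp φ‖ * ‖h‖) := by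
      intro y
      simp only [norm_mul]
      rw [integral_const_mul]
      gcongr
      have e1 : ∫ x, ‖h (x - y)‖ * ‖φ x‖ = ∫ x, ‖shift y h x‖ * ‖φ x‖ := by
        refine integral_congr_ae ?_
        filter_upwards [hcomp y] with x hx
        rw [hx]
      have e2 : ∫ x, ‖shift y h x‖ * ‖φ x‖ =
          ‖(ContinuousLinearMap.mul ℝ ℝ).holder 1 (hφ.toLp φ) (shift y h)‖ := by
        rw [L1.norm_eq_integral_norm]
        refine integral_congr_ae ?_
        filter_upwards [(ContinuousLinearMap.mul ℝ ℝ).coeFn_holder (r := 1) (hφ.toLp φ)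
          (shift y h), hφ.coeFn_toLp] with x hx hx'
        rw [hx, hx', ContinuousLinearMap.mul_apply', norm_mul, mul_comm]
      rw [e1, e2]
      refine ((ContinuousLinearMap.mul ℝ ℝ).norm_holder_apply_apply_le _ _).trans ?_
      rw [LinearIsometry.norm_map]
      have := ContinuousLinearMap.opNorm_mul_le ℝ ℝ
      have h0 : 0 ≤ ‖hφ.toLp φ‖ * ‖h‖ := by positivity
      nlinarith
    refine ((L1.integrable_coeFn k).norm.mul_const (‖hφ.toLp φ‖ * ‖h‖)).mono'
      hm.norm.integral_prod_right' (ae_of_all _ fun y => ?_)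
    rw [Real.norm_of_nonneg (integral_nonneg fun _ => norm_nonneg _)]
    exact hbound y

variable [hq : Fact (q ≠ ⊤)]

theorem integrable_smul_shift {k : E d → ℝ} (hk : Integrable k) (h : LL d q) :
    Integrable (fun y => k y • shift y h) :=
  (hk.norm.mul_const ‖h‖).mono'
    (hk.1.smul (continuous_shift hq.out h).aestronglyMeasurable)
    (ae_of_all _ fun y => by rw [norm_smul, LinearIsometry.norm_map])

/-- Convolution `L¹ × L^q → L^q` as a bilinear map, `k ⋆ h = ∫ k(y) h(· - y) dy`. -/
def cvₗ : LL d 1 →ₗ[ℝ] LL d q →ₗ[ℝ] LL d q :=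
  LinearMap.mk₂ ℝ (fun k h => ∫ y, k y • shift y h)
    (fun k k' h => by
      rw [← integral_add (integrable_smul_shift (L1.integrable_coeFn k) h)
        (integrable_smul_shift (L1.integrable_coeFn k') h)]
      refine integral_congr_ae ?_
      filter_upwards [Lp.coeFn_add k k'] with y hy
      rw [hy, Pi.add_apply, add_smul])
    (fun c k h => by
      rw [← integral_smul]
      refine integral_congr_ae ?_
      filter_upwards [Lp.coeFn_smul c k] with y hy
      rw [hy, Pi.smul_apply, smul_assoc])
    (fun k h h' => by
      rw [← integral_add (integrable_smul_shift (L1.integrable_coeFn k) h)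
        (integrable_smul_shift (L1.integrable_coeFn k) h')]
      simp only [map_add, smul_add])
    (fun c k h => by
      rw [← integral_smul]
      simp only [map_smul, smul_comm c])

/-- Convolution `L¹ × L^q → L^q` as a continuous bilinear map. -/
def cv : LL d 1 →L[ℝ] LL d q →L[ℝ] LL d q :=
  LinearMap.mkContinuous₂ cvₗ 1 fun k h => by
    rw [one_mul, L1.norm_eq_integral_norm, ← integral_mul_const]
    refine (norm_integral_le_integral_norm _).trans (le_of_eq ?_)
    simp only [norm_smul, LinearIsometry.norm_map]

theorem cv_apply (k : LL d 1) (h : LL d q) : cv k h = ∫ y, k y • shift y h := rfl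

theorem norm_cv_le (k : LL d 1) (h : LL d q) : ‖cv k h‖ ≤ ‖k‖ * ‖h‖ := by
  rw [cv_apply, L1.norm_eq_integral_norm, ← integral_mul_const]
  refine (norm_integral_le_integral_norm _).trans (le_of_eq ?_)
  simp only [norm_smul, LinearIsometry.norm_map]

/-- Translations commute with each other and, being continuous and linear, pass through the Bochner
integral. Associativity and commutation of convolutions follow from this without Fubini. -/
theorem cv_shift_right (k : LL d 1) (h : LL d q) (z : E d) :
    cv k (shift z h) = shift z (cv k h) := by
  rw [cv_apply, cv_apply]
  have := (shift z : LL d q →ₗᵢ[ℝ] LL d q).toContinuousLinearMap.integral_comp_comm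
    (integrable_smul_shift (L1.integrable_coeFn k) h)
  refine Eq.trans ?_ this
  refine integral_congr_ae (ae_of_all _ fun y => ?_)
  simp [shift_shift, add_comm]

theorem cv_shift_left (k : LL d 1) (h : LL d q) (z : E d) :
    cv (shift z k) h = shift z (cv k h) := by
  rw [← cv_shift_right, cv_apply, cv_apply,
    ← integral_sub_right_eq_self (fun y => k y • shift y (shift z h)) z]
  refine integral_congr_ae ?_
  filter_upwards [shift_coe z k] with y hy
  simp only [hy, shift_shift]
  congr 2; abel_nf

/-- The continuous map k ↦ k ⋆ h is pulled through the integral defining k₁ ⋆ k₂, and it commutes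
with the translations found there. -/
theorem cv_assoc (k₁ k₂ : LL d 1) (h : LL d q) : cv (cv k₁ k₂) h = cv k₁ (cv k₂ h) := by
  have h1 := (cv.flip h : LL d 1 →L[ℝ] LL d q).integral_comp_comm
    (integrable_smul_shift (L1.integrable_coeFn k₁) k₂)
  rw [cv_apply k₁ k₂, cv_apply k₁ (cv k₂ h)]
  refine h1.symm.trans (integral_congr_ae (ae_of_all _ fun y => ?_))
  simp only [map_smul, ContinuousLinearMap.flip_apply, cv_shift_left]

theorem cv_comm_apply (k₁ k₂ : LL d 1) (h : LL d q) :
    cv k₁ (cv k₂ h) = cv k₂ (cv k₁ h) := by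
  have h1 := (cv k₁ : LL d q →L[ℝ] LL d q).integral_comp_comm
    (integrable_smul_shift (L1.integrable_coeFn k₂) h)
  rw [cv_apply k₂ h, cv_apply k₂ (cv k₁ h)]
  refine h1.symm.trans (integral_congr_ae (ae_of_all _ fun y => ?_))
  simp only [map_smul, cv_shift_right]

/-- The pairing of a convolution with a dual function, before exchanging the integrals. -/
theorem integral_cv_mul {φ : E d → ℝ} (hφ : MemLp φ (ENNReal.conjExponent q) volume)
    (k : LL d 1) (h : LL d q) :
    ∫ x, cv k h x * φ x = ∫ y, k y * ∫ x, h (x - y) * φ x := by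
  rw [← pairing_apply φ hφ, cv_apply, ← (pairing φ hφ).integral_comp_comm
    (integrable_smul_shift (L1.integrable_coeFn k) h)]
  refine integral_congr_ae (ae_of_all _ fun y => ?_)
  simp only [map_smul, smul_eq_mul, pairing_apply]
  congr 1
  refine integral_congr_ae ?_
  filter_upwards [shift_coe y h] with x hx
  rw [hx]

theorem integral_cv_mul_eq {φ : E d → ℝ} (hφ : MemLp φ (ENNReal.conjExponent q) volume)
    (k : LL d 1) (h : LL d q) :
    ∫ x, cv k h x * φ x = ∫ x, (∫ y, k y * h (x - y)) * φ x := by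
  rw [integral_cv_mul hφ]
  have := integral_integral_swap (f := fun y x => k y * (h (x - y) * φ x))
    (integrable_prod_mul_sub hφ k h)
  simp only [integral_const_mul] at this
  rw [this]
  refine integral_congr_ae (ae_of_all _ fun x => ?_)
  simp only [← mul_assoc]
  rw [integral_mul_const]

/-- The Bochner integral defining `cv k h` is the pointwise convolution. -/
theorem cv_coe (k : LL d 1) (h : LL d q) :
    cv k h =ᵐ[volume] fun x => ∫ y, k y * h (x - y) := by
  have e : ∀ (s : Set (E d)) (f : E d → ℝ),
      (fun x => f x * s.indicator 1 x) = s.indicator f := by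
    intro s f; ext x; by_cases hx : x ∈ s <;> simp [hx]
  -- Indicators of sets of finite measure lie in every dual space, so the dual pairing computes all
  -- set integrals.
  refine ae_eq_of_forall_setIntegral_eq_of_sigmaFinite (fun s hs hμ => ?_) (fun s hs hμ => ?_)
    (fun s hs hμ => ?_)
  · have := integrable_mul_dual (memLp_indicator_one hs hμ) (cv k h)
    rwa [e, integrable_indicator_iff hs] at this
  · have := (integrable_prod_mul_sub (memLp_indicator_one hs hμ) k h).integral_prod_right
    simp only [← mul_assoc] at this
    simp only [integral_mul_const] at this
    rwa [e, integrable_indicator_iff hs] at this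
  · have := integral_cv_mul_eq (memLp_indicator_one hs hμ) k h
    rwa [e, e, integral_indicator hs, integral_indicator hs] at this

end Convolution

/-! ### Calculus of weak derivatives. -/

section WeakDerivative

variable {d : ℕ} {q : ℝ≥0∞}

/-- The partial derivative `∂_i φ` of a function. -/
def partialDeriv (i : Fin d) (φ : E d → ℝ) (x : E d) : ℝ :=
  fderiv ℝ φ x (EuclideanSpace.single i 1)

theorem continuous_partialDeriv {φ : E d → ℝ} (i : Fin d) (hφ : ContDiff ℝ ∞ φ) :
    Continuous (partialDeriv i φ) :=
  (hφ.continuous_fderiv (by simp)).clm_apply continuous_const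

theorem hasCompactSupport_partialDeriv {φ : E d → ℝ} (i : Fin d) (hφ : HasCompactSupport φ) :
    HasCompactSupport (partialDeriv i φ) := hφ.fderiv_apply ℝ _

theorem memLp_test {φ : E d → ℝ} {p : ℝ≥0∞} (hφ : Continuous φ) (hc : HasCompactSupport φ) :
    MemLp φ p volume := hφ.memLp_of_hasCompactSupport hc

theorem hasCompactSupport_comp_add {φ : E d → ℝ} (hc : HasCompactSupport φ) (z : E d) :
    HasCompactSupport fun x => φ (x + z) :=
  hc.comp_homeomorph (Homeomorph.addRight z)

variable [Fact (1 ≤ q)]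

theorem HasWeakPartial.unique {i : Fin d} {f g g' : LL d q} (h : HasWeakPartial i f g)
    (h' : HasWeakPartial i f g') : g = g' := by
  refine Lp.ext ?_
  have hli : LocallyIntegrable (fun x => g x - g' x) volume :=
    (((Lp.memLp g).locallyIntegrable Fact.out).sub ((Lp.memLp g').locallyIntegrable Fact.out))
  have := ae_eq_zero_of_integral_contDiff_smul_eq_zero hli (fun φ hφ hc => ?_)
  · filter_upwards [this] with x hx using sub_eq_zero.1 hx
  · have e1 := h φ hφ hc
    have e2 := h' φ hφ hc
    have hm : MemLp φ (ENNReal.conjExponent q) volume := memLp_test hφ.continuous hc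
    have e3 : ∫ x, g x * φ x = ∫ x, g' x * φ x := by linarith
    have e4 : (fun x => φ x • (g x - g' x)) = fun x => g x * φ x - g' x * φ x := by
      ext x; simp only [smul_eq_mul]; ring
    rw [e4, integral_sub (integrable_mul_dual hm g) (integrable_mul_dual hm g'), e3, sub_self]

/-- Expressed through continuous linear functionals, the relation is visibly stable under linear
combinations and Bochner integrals. -/
theorem hasWeakPartial_iff {i : Fin d} {f g : LL d q} : HasWeakPartial i f g ↔
    ∀ (φ : E d → ℝ) (hφ : ContDiff ℝ ∞ φ) (hc : HasCompactSupport φ),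
      pairing (partialDeriv i φ) (memLp_test (continuous_partialDeriv i hφ)
        (hasCompactSupport_partialDeriv i hc)) f
      = - pairing φ (memLp_test hφ.continuous hc) g := by
  simp only [pairing_apply]
  rfl

theorem HasWeakPartial.add {i : Fin d} {f g f' g' : LL d q} (h : HasWeakPartial i f g)
    (h' : HasWeakPartial i f' g') : HasWeakPartial i (f + f') (g + g') := by
  rw [hasWeakPartial_iff] at *
  intro φ hφ hc
  rw [map_add, map_add, h φ hφ hc, h' φ hφ hc]; ring

theorem HasWeakPartial.sub {i : Fin d} {f g f' g' : LL d q} (h : HasWeakPartial i f g)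
    (h' : HasWeakPartial i f' g') : HasWeakPartial i (f - f') (g - g') := by
  rw [hasWeakPartial_iff] at *
  intro φ hφ hc
  rw [map_sub, map_sub, h φ hφ hc, h' φ hφ hc]; ring

theorem HasWeakPartial.smul {i : Fin d} {f g : LL d q} (c : ℝ) (h : HasWeakPartial i f g) :
    HasWeakPartial i (c • f) (c • g) := by
  rw [hasWeakPartial_iff] at *
  intro φ hφ hc
  rw [map_smul, map_smul, h φ hφ hc, smul_neg]

theorem HasWeakPartial.integral {α : Type*} [MeasurableSpace α] {μ : Measure α} {i : Fin d}
    {f g : α → LL d q} (hf : Integrable f μ) (hg : Integrable g μ)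
    (h : ∀ᵐ s ∂μ, HasWeakPartial i (f s) (g s)) :
    HasWeakPartial i (∫ s, f s ∂μ) (∫ s, g s ∂μ) := by
  rw [hasWeakPartial_iff]
  intro φ hφ hc
  rw [← ContinuousLinearMap.integral_comp_comm _ hf, ← ContinuousLinearMap.integral_comp_comm _ hg,
    ← integral_neg]
  refine integral_congr_ae ?_
  filter_upwards [h] with s hs
  exact hasWeakPartial_iff.1 hs φ hφ hc

theorem integral_shift_mul (z : E d) (h : LL d q) (φ : E d → ℝ) :
    ∫ x, shift z h x * φ x = ∫ x, h x * φ (x + z) := by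
  rw [← integral_sub_right_eq_self (fun x => h x * φ (x + z)) z]
  refine integral_congr_ae ?_
  filter_upwards [shift_coe z h] with x hx
  rw [hx, sub_add_cancel]

theorem HasWeakPartial.shift {i : Fin d} {f g : LL d q} (h : HasWeakPartial i f g) (z : E d) :
    HasWeakPartial i (shift z f) (shift z g) := by
  intro φ hφ hc
  have h1 := h (fun x => φ (x + z)) (hφ.comp (contDiff_id.add contDiff_const))
    (hasCompactSupport_comp_add hc z)
  rw [integral_shift_mul z f (fun x => fderiv ℝ φ x (EuclideanSpace.single i 1)),
    integral_shift_mul, ← h1]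
  refine integral_congr_ae (ae_of_all _ fun x => ?_)
  simp only [fderiv_comp_add_right]

variable [hq : Fact (q ≠ ⊤)]

theorem HasWeakPartial.cv_right {i : Fin d} {f g : LL d q} (h : HasWeakPartial i f g)
    (k : LL d 1) : HasWeakPartial i (cv k f) (cv k g) :=
  HasWeakPartial.integral (integrable_smul_shift (L1.integrable_coeFn k) f)
    (integrable_smul_shift (L1.integrable_coeFn k) g)
    (ae_of_all _ fun y => (h.shift y).smul _)

/-- The pairing of a convolution with a test function, with all derivatives on the kernel side. -/
theorem integral_cv_mul_test {φ : E d → ℝ} (hφ : Continuous φ) (hc : HasCompactSupport φ)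
    (k : LL d 1) (h : LL d q) :
    ∫ x, cv k h x * φ x = ∫ z, h z * ∫ y, k y * φ (y + z) := by
  have hm : MemLp φ (ENNReal.conjExponent q) volume := memLp_test hφ hc
  rw [integral_cv_mul hm]
  -- The shear (y, z) ↦ (y, y + z) preserves the product measure and turns h(x - y) φ(x) into h(z)
  -- φ(y + z).
  have hint := ((measurePreserving_prod_add (volume : Measure (E d)) volume).integrable_comp
    (integrable_prod_mul_sub hm k h).1).2 (integrable_prod_mul_sub hm k h)
  have hint' : Integrable (Function.uncurry fun y z => k y * (h z * φ (y + z)))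
      ((volume : Measure (E d)).prod volume) := by
    refine hint.congr (ae_of_all _ fun w => ?_)
    simp [Function.uncurry]
  have hsw := integral_integral_swap hint'
  have e1 : ∀ y : E d, ∫ x, h (x - y) * φ x = ∫ z, h z * φ (y + z) := by
    intro y
    rw [← integral_sub_right_eq_self (fun z => h z * φ (y + z)) y]
    simp
  simp only [e1]
  simp only [integral_const_mul] at hsw
  rw [hsw]
  refine integral_congr_ae (ae_of_all _ fun z => ?_)
  simp only
  rw [← integral_const_mul]
  refine integral_congr_ae (ae_of_all _ fun y => ?_)
  simp only
  ring

/-- After Fubini the kernel k is paired with a translated test function, to which the hypothesis on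
k applies for each translate. No differentiability of h enters, which is the regularizing effect. -/
theorem HasWeakPartial.cv_left {i : Fin d} {k k' : LL d 1} (hk : HasWeakPartial i k k')
    (h : LL d q) : HasWeakPartial i (cv k h) (cv k' h) := by
  intro φ hφ hc
  rw [integral_cv_mul_test hφ.continuous hc]
  have := integral_cv_mul_test (continuous_partialDeriv i hφ)
    (hasCompactSupport_partialDeriv i hc) k h
  refine this.trans ?_
  rw [← integral_neg]
  refine integral_congr_ae (ae_of_all _ fun z => ?_)
  have h1 := hk (fun x => φ (x + z)) (hφ.comp (contDiff_id.add contDiff_const))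
    (hasCompactSupport_comp_add hc z)
  simp only [fderiv_comp_add_right] at h1
  simp only [partialDeriv]
  rw [h1]; ring

end WeakDerivative

/-! ### Gaussians: integrability, scaling, derivatives, semigroup property. -/

section Gaussian

variable {d : ℕ}

theorem integrable_exp_neg_mul_sq_norm {b : ℝ} (hb : 0 < b) :
    Integrable (fun x : E d => Real.exp (-b * ‖x‖ ^ 2)) := by
  -- The integral is known to equal a positive number, whereas a non-integrable function has
  -- integral 0 by convention.
  by_contra h
  have h1 := GaussianFourier.integral_rexp_neg_mul_sq_norm (V := E d) hb
  rw [integral_undef h] at h1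
  exact (Real.rpow_pos_of_pos (div_pos Real.pi_pos hb) _).ne h1

theorem memLp_exp_neg_mul_sq_norm {b : ℝ} (hb : 0 < b) {p : ℝ≥0∞} (hp : p ≠ 0) :
    MemLp (fun x : E d => Real.exp (-b * ‖x‖ ^ 2)) p volume := by
  have hm : AEStronglyMeasurable (fun x : E d => Real.exp (-b * ‖x‖ ^ 2)) volume :=
    (by fun_prop : Continuous fun x : E d => Real.exp (-b * ‖x‖ ^ 2)).aestronglyMeasurable
  by_cases ht : p = ⊤
  · subst ht
    refine memLp_top_of_bound hm 1 (ae_of_all _ fun x => ?_)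
    rw [Real.norm_of_nonneg (Real.exp_nonneg _), Real.exp_le_one_iff]
    have : 0 ≤ b * ‖x‖ ^ 2 := by positivity
    linarith
  · rw [← integrable_norm_rpow_iff hm hp ht]
    have hpp : 0 < p.toReal := ENNReal.toReal_pos hp ht
    refine (integrable_exp_neg_mul_sq_norm (b := b * p.toReal) (by positivity)).congr
      (ae_of_all _ fun x => ?_)
    simp only
    rw [Real.norm_of_nonneg (Real.exp_nonneg _), ← Real.exp_mul]
    congr 1; ring

theorem gaussian_eq (τ : ℝ) (x : E d) :
    gaussian d τ x = ((2 * Real.pi) ^ ((d : ℝ) / 2) * τ ^ d)⁻¹ *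
      Real.exp (-(1 / (2 * τ ^ 2)) * ‖x‖ ^ 2) := by
  rw [gaussian, div_eq_inv_mul]
  congr 2; ring

theorem contDiff_gaussian (τ : ℝ) : ContDiff ℝ ∞ (gaussian d τ) := by
  have : gaussian d τ = fun x => ((2 * Real.pi) ^ ((d : ℝ) / 2) * τ ^ d)⁻¹ *
      Real.exp (-(1 / (2 * τ ^ 2)) * ‖x‖ ^ 2) := funext (gaussian_eq τ)
  rw [this]
  exact contDiff_const.mul (Real.contDiff_exp.comp (contDiff_const.mul (contDiff_norm_sq ℝ)))

theorem continuous_gaussian (τ : ℝ) : Continuous (gaussian d τ) := (contDiff_gaussian τ).continuous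

theorem memLp_gaussian {τ : ℝ} (hτ : 0 < τ) {p : ℝ≥0∞} (hp : p ≠ 0) :
    MemLp (gaussian d τ) p volume := by
  have : gaussian d τ = fun x => ((2 * Real.pi) ^ ((d : ℝ) / 2) * τ ^ d)⁻¹ *
      Real.exp (-(1 / (2 * τ ^ 2)) * ‖x‖ ^ 2) := funext (gaussian_eq τ)
  rw [this]
  exact (memLp_exp_neg_mul_sq_norm (by positivity) hp).const_mul _

theorem integral_gaussian_eq_one {τ : ℝ} (hτ : 0 < τ) : ∫ x, gaussian d τ x = 1 := by
  simp only [gaussian_eq]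
  rw [integral_const_mul, GaussianFourier.integral_rexp_neg_mul_sq_norm (by positivity)]
  have h1 : Real.pi / (1 / (2 * τ ^ 2)) = (2 * Real.pi) * τ ^ 2 := by field_simp
  rw [h1, Real.mul_rpow (x := 2 * Real.pi) (y := τ ^ 2) (by positivity) (by positivity), finrank_euclideanSpace, Fintype.card_fin,
    ← Real.rpow_natCast τ 2, ← Real.rpow_mul hτ.le,
    show ((2 : ℕ) : ℝ) * ((d : ℝ) / 2) = (d : ℝ) by push_cast; ring, Real.rpow_natCast]
  exact inv_mul_cancel₀ (by positivity)

theorem gaussian_nonneg {τ : ℝ} (hτ : 0 ≤ τ) (x : E d) : 0 ≤ gaussian d τ x := by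
  rw [gaussian]; positivity

theorem gaussian_scale {τ : ℝ} (hτ : 0 < τ) (x : E d) :
    gaussian d τ x = (τ ^ d)⁻¹ * gaussian d 1 (τ⁻¹ • x) := by
  rw [gaussian_eq, gaussian_eq, norm_smul, Real.norm_of_nonneg (by positivity)]
  have : -(1 / (2 * τ ^ 2)) * ‖x‖ ^ 2 = -(1 / (2 * 1 ^ 2)) * (τ⁻¹ * ‖x‖) ^ 2 := by
    field_simp
  rw [this, one_pow, mul_one, mul_inv]
  ring

theorem partialDeriv_gaussian (i : Fin d) (τ : ℝ) (x : E d) :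
    partialDeriv i (gaussian d τ) x = -(x i / τ ^ 2) * gaussian d τ x := by
  have hfun : gaussian d τ = fun x => ((2 * Real.pi) ^ ((d : ℝ) / 2) * τ ^ d)⁻¹ *
      Real.exp (-(1 / (2 * τ ^ 2)) * ‖x‖ ^ 2) := funext (gaussian_eq τ)
  have h1 : HasFDerivAt (fun x : E d => ‖x‖ ^ 2) (2 • (innerSL ℝ x)) x :=
    (hasStrictFDerivAt_norm_sq x).hasFDerivAt
  have h2 := ((h1.const_mul (-(1 / (2 * τ ^ 2)))).exp).const_mul
    (((2 * Real.pi) ^ ((d : ℝ) / 2) * τ ^ d)⁻¹)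
  rw [← hfun] at h2
  rw [partialDeriv, h2.fderiv, gaussian_eq]
  simp only [smul_apply, innerSL_apply_apply, EuclideanSpace.inner_single_right,
    smul_eq_mul, nsmul_eq_mul]
  simp
  ring

theorem partialDeriv_gaussian_scale (i : Fin d) {τ : ℝ} (hτ : 0 < τ) (x : E d) :
    partialDeriv i (gaussian d τ) x =
      τ⁻¹ * (τ ^ d)⁻¹ * partialDeriv i (gaussian d 1) (τ⁻¹ • x) := by
  rw [partialDeriv_gaussian, partialDeriv_gaussian, gaussian_scale hτ]
  simp only [PiLp.smul_apply, smul_eq_mul]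
  field_simp

theorem memLp_partialDeriv_gaussian (i : Fin d) {τ : ℝ} (hτ : 0 < τ) {p : ℝ≥0∞} (hp : p ≠ 0) :
    MemLp (partialDeriv i (gaussian d τ)) p volume := by
  set b := 1 / (2 * τ ^ 2) with hb
  have hb0 : 0 < b := by positivity
  set c := ((2 * Real.pi) ^ ((d : ℝ) / 2) * τ ^ d)⁻¹ with hc
  have hc0 : 0 < c := by positivity
  refine MemLp.of_le_mul (c := (1 + 2 / b) / τ ^ 2 * c)
    (memLp_exp_neg_mul_sq_norm (half_pos hb0) hp)
    (continuous_partialDeriv i (contDiff_gaussian τ)).aestronglyMeasurable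
    (ae_of_all _ fun x => ?_)
  rw [partialDeriv_gaussian, gaussian_eq, Real.norm_of_nonneg (Real.exp_nonneg _), norm_mul,
    norm_neg, norm_div, norm_mul, Real.norm_of_nonneg (Real.exp_nonneg _),
    Real.norm_of_nonneg hc0.le, Real.norm_of_nonneg (by positivity : (0 : ℝ) ≤ τ ^ 2)]
  have h1 : ‖x i‖ ≤ ‖x‖ := PiLp.norm_apply_le x i
  -- Half of the Gaussian decay absorbs the linear factor from the derivative, and the other half
  -- remains for integrability.
  have h2 : ‖x‖ ≤ (1 + 2 / b) * Real.exp (b / 2 * ‖x‖ ^ 2) := by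
    have e1 := Real.add_one_le_exp (b / 2 * ‖x‖ ^ 2)
    have e2 : ‖x‖ ≤ 1 + ‖x‖ ^ 2 := by nlinarith [sq_nonneg (‖x‖ - 1)]
    have e3 : 1 + ‖x‖ ^ 2 ≤ (1 + 2 / b) * (b / 2 * ‖x‖ ^ 2 + 1) := by
      have : (1 + 2 / b) * (b / 2 * ‖x‖ ^ 2 + 1)
          = 1 + ‖x‖ ^ 2 + (b / 2 * ‖x‖ ^ 2 + 2 / b) := by field_simp; ring
      rw [this]
      have : 0 ≤ b / 2 * ‖x‖ ^ 2 + 2 / b := by positivity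
      linarith
    refine e2.trans (e3.trans ?_)
    gcongr
  have h3 : Real.exp (b / 2 * ‖x‖ ^ 2) * Real.exp (-b * ‖x‖ ^ 2)
      = Real.exp (-(b / 2) * ‖x‖ ^ 2) := by
    rw [← Real.exp_add]; congr 1; ring
  calc ‖x i‖ / τ ^ 2 * (c * Real.exp (-b * ‖x‖ ^ 2))
      ≤ ((1 + 2 / b) * Real.exp (b / 2 * ‖x‖ ^ 2)) / τ ^ 2 *
        (c * Real.exp (-b * ‖x‖ ^ 2)) := by gcongr; exact h1.trans h2
    _ = (1 + 2 / b) / τ ^ 2 * c *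
        (Real.exp (b / 2 * ‖x‖ ^ 2) * Real.exp (-b * ‖x‖ ^ 2)) := by ring
    _ = _ := by rw [h3]

/-- The semigroup property of the Gaussians. -/
theorem integral_gaussian_mul_gaussian {a b s : ℝ} (ha : 0 < a) (hb : 0 < b) (hs : 0 < s)
    (h : s ^ 2 = a ^ 2 + b ^ 2) (x : E d) :
    ∫ y, gaussian d a y * gaussian d b (x - y) = gaussian d s x := by
  set τ := a * b / s with hτ
  have hτ0 : 0 < τ := by positivity
  -- Completing the square in y: the product is η_s(x) times a Gaussian of width ab/s centred at
  -- (a²/s²)x, which has total mass 1.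
  have key : ∀ y : E d, gaussian d a y * gaussian d b (x - y)
      = gaussian d s x * gaussian d τ (y - (a ^ 2 / s ^ 2) • x) := by
    intro y
    simp only [gaussian]
    rw [div_mul_div_comm, div_mul_div_comm, ← Real.exp_add, ← Real.exp_add]
    congr 1
    · congr 1
      rw [norm_sub_sq_real, norm_sub_sq_real, norm_smul, inner_smul_right,
        Real.norm_of_nonneg (by positivity), real_inner_comm x y, hτ]
      have hb2 : b ^ 2 = s ^ 2 - a ^ 2 := by linarith
      field_simp
      rw [hb2]
      ring
    · rw [hτ, div_pow, mul_pow]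
      field_simp
  simp only [key]
  rw [integral_const_mul, integral_sub_right_eq_self (fun y => gaussian d τ y),
    integral_gaussian_eq_one hτ0, mul_one]

/-- The behaviour of the `L^q` norm under dilations. -/
theorem eLpNorm_comp_inv_smul {q : ℝ≥0∞} (hq : q ≠ ⊤) {g : E d → ℝ} (hg : Continuous g) {τ : ℝ}
    (hτ : 0 < τ) :
    eLpNorm (fun x => g (τ⁻¹ • x)) q volume
      = ENNReal.ofReal (τ ^ ((d : ℝ) * q⁻¹.toReal)) * eLpNorm g q volume := by
  have h1 := eLpNorm_map_measure (p := q) (μ := (volume : Measure (E d)))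
    (f := fun x => τ⁻¹ • x) (g := g) hg.aestronglyMeasurable (by fun_prop)
  change _ = eLpNorm (fun x => g (τ⁻¹ • x)) q volume at h1
  rw [← h1, Measure.map_addHaar_smul _ (inv_ne_zero hτ.ne'), eLpNorm_smul_measure_of_ne_top hq,
    finrank_euclideanSpace, Fintype.card_fin, inv_pow, inv_inv, abs_of_pos (by positivity),
    smul_eq_mul, ENNReal.ofReal_rpow_of_pos (by positivity), one_div, ← Real.rpow_natCast,
    ← Real.rpow_mul hτ.le]

end Gaussian

/-! ### The Gaussian and its derivatives as elements of L^q. -/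

section HeatKernel

variable {d : ℕ}

open Classical in
/-- The class of `f` in `L^q`, or `0` if `f` does not belong to `L^q`. -/
def toLL (q : ℝ≥0∞) (f : E d → ℝ) : LL d q := if h : MemLp f q volume then h.toLp f else 0

theorem toLL_coe {q : ℝ≥0∞} {f : E d → ℝ} (h : MemLp f q volume) : toLL q f =ᵐ[volume] f := by
  rw [toLL, dif_pos h]; exact h.coeFn_toLp

theorem enorm_toLL {q : ℝ≥0∞} {f : E d → ℝ} (h : MemLp f q volume) :
    ‖toLL q f‖ₑ = eLpNorm f q volume := by
  rw [Lp.enorm_def]; exact eLpNorm_congr_ae (toLL_coe h)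

/-- The Gaussian `η_τ` as an element of `L^q`. -/
def gK (d : ℕ) (q : ℝ≥0∞) (τ : ℝ) : LL d q := toLL q (gaussian d τ)

/-- The derivative `∂_i η_τ` of the Gaussian as an element of `L^q`. -/
def dK (q : ℝ≥0∞) (i : Fin d) (τ : ℝ) : LL d q := toLL q (partialDeriv i (gaussian d τ))

variable {q : ℝ≥0∞} [hq1 : Fact (1 ≤ q)]

theorem exponent_ne_zero : q ≠ 0 := (zero_lt_one.trans_le hq1.out).ne'

theorem gK_coe {τ : ℝ} (hτ : 0 < τ) : gK d q τ =ᵐ[volume] gaussian d τ :=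
  toLL_coe (memLp_gaussian hτ exponent_ne_zero)

theorem dK_coe (i : Fin d) {τ : ℝ} (hτ : 0 < τ) :
    dK q i τ =ᵐ[volume] partialDeriv i (gaussian d τ) :=
  toLL_coe (memLp_partialDeriv_gaussian i hτ exponent_ne_zero)

theorem hasWeakPartial_gK (i : Fin d) {τ : ℝ} (hτ : 0 < τ) :
    HasWeakPartial i (gK d q τ) (dK q i τ) := by
  intro φ hφ hc
  have e1 : ∫ x, gK d q τ x * fderiv ℝ φ x (EuclideanSpace.single i 1)
      = ∫ x, gaussian d τ x * fderiv ℝ φ x (EuclideanSpace.single i 1) := by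
    refine integral_congr_ae ?_
    filter_upwards [gK_coe (q := q) hτ] with x hx
    rw [hx]
  have e2 : ∫ x, dK q i τ x * φ x
      = ∫ x, fderiv ℝ (gaussian d τ) x (EuclideanSpace.single i 1) * φ x := by
    refine integral_congr_ae ?_
    filter_upwards [dK_coe (q := q) i hτ] with x hx
    rw [hx]; rfl
  rw [e1, e2]
  have hg1 := memLp_gaussian (d := d) hτ one_ne_zero
  have hg2 := memLp_partialDeriv_gaussian i hτ one_ne_zero
  refine integral_mul_fderiv_eq_neg_fderiv_mul_of_integrable ?_ ?_ ?_ ?_ ?_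
  · exact hg2.integrable_mul (q := ⊤) (memLp_test hφ.continuous hc)
  · exact hg1.integrable_mul (q := ⊤) (memLp_test (continuous_partialDeriv i hφ)
      (hasCompactSupport_partialDeriv i hc))
  · exact hg1.integrable_mul (q := ⊤) (memLp_test hφ.continuous hc)
  · exact fun x _ => (contDiff_gaussian τ).differentiable (by simp) x
  · exact fun x _ => hφ.differentiable (by simp) x

variable [hqt : Fact (q ≠ ⊤)]

/-- Dilation by τ contributes τ^{d/q} to the norm and the prefactor τ^{-d-e}. The case e = 0 is the
Gaussian and e = 1 its derivatives. -/
theorem norm_toLL_scale {k₁ k : E d → ℝ} {τ e : ℝ} (hτ : 0 < τ) (hk₁ : Continuous k₁)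
    (hm₁ : MemLp k₁ q volume) (hm : MemLp k q volume)
    (hk : ∀ x, k x = τ ^ (-e) * (τ ^ d)⁻¹ * k₁ (τ⁻¹ • x)) :
    ‖toLL q k‖ = ‖toLL q k₁‖ * τ ^ (-((d : ℝ) * (1 - q⁻¹.toReal)) - e) := by
  have hk' : k = (τ ^ (-e) * (τ ^ d)⁻¹) • fun x => k₁ (τ⁻¹ • x) := funext hk
  have h1 : ‖toLL q k‖ₑ = ENNReal.ofReal (τ ^ (-((d : ℝ) * (1 - q⁻¹.toReal)) - e)) *
      ‖toLL q k₁‖ₑ := by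
    rw [enorm_toLL hm, enorm_toLL hm₁, hk', eLpNorm_const_smul,
      eLpNorm_comp_inv_smul hqt.out hk₁ hτ, ← mul_assoc, Real.enorm_eq_ofReal (by positivity),
      ← ENNReal.ofReal_mul (by positivity)]
    congr 2
    rw [← Real.rpow_natCast, ← Real.rpow_neg hτ.le, ← Real.rpow_add hτ, ← Real.rpow_add hτ]
    congr 1; ring
  have h2 := congrArg ENNReal.toReal h1
  rw [ENNReal.toReal_mul, ENNReal.toReal_ofReal (by positivity), toReal_enorm, toReal_enorm] at h2
  rw [h2, mul_comm]

theorem norm_gK {τ : ℝ} (hτ : 0 < τ) :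
    ‖gK d q τ‖ = ‖gK d q 1‖ * τ ^ (-((d : ℝ) * (1 - q⁻¹.toReal))) := by
  have := norm_toLL_scale (q := q) (e := 0) hτ (continuous_gaussian (d := d) 1)
    (memLp_gaussian one_pos exponent_ne_zero) (memLp_gaussian hτ exponent_ne_zero)
    (fun x => by rw [neg_zero, Real.rpow_zero, one_mul]; exact gaussian_scale hτ x)
  rwa [sub_zero] at this

theorem norm_dK (i : Fin d) {τ : ℝ} (hτ : 0 < τ) :
    ‖dK q i τ‖ = ‖dK q i 1‖ * τ ^ (-((d : ℝ) * (1 - q⁻¹.toReal)) - 1) :=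
  norm_toLL_scale hτ (continuous_partialDeriv i (contDiff_gaussian 1))
    (memLp_partialDeriv_gaussian i one_pos exponent_ne_zero)
    (memLp_partialDeriv_gaussian i hτ exponent_ne_zero)
    (fun x => by rw [Real.rpow_neg_one]; exact partialDeriv_gaussian_scale i hτ x)

theorem norm_gK_one {τ : ℝ} (hτ : 0 < τ) : ‖gK d 1 τ‖ = 1 := by
  rw [L1.norm_eq_integral_norm, ← integral_gaussian_eq_one (d := d) hτ]
  refine integral_congr_ae ?_
  filter_upwards [gK_coe (q := 1) hτ] with x hx
  rw [hx, Real.norm_of_nonneg (gaussian_nonneg hτ.le x)]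

theorem cv_gK_gK {a b s : ℝ} (ha : 0 < a) (hb : 0 < b) (hs : 0 < s)
    (h : s ^ 2 = a ^ 2 + b ^ 2) : cv (gK d 1 a) (gK d q b) = gK d q s := by
  refine Lp.ext ?_
  filter_upwards [cv_coe (gK d 1 a) (gK d q b), gK_coe (d := d) (q := q) hs] with x h1 h2
  rw [h1, h2, ← integral_gaussian_mul_gaussian ha hb hs h]
  refine integral_congr_ae ?_
  have h3 := (quasiMeasurePreserving_sub_left (volume : Measure (E d)) x).ae_eq_comp
    (gK_coe (q := q) hb)
  filter_upwards [gK_coe (d := d) (q := 1) ha, h3] with y e1 e2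
  rw [e1]
  exact congrArg _ e2

/-- Both sides are weak derivatives of the same Gaussian, by differentiating the semigroup identity,
and weak derivatives are unique. -/
theorem cv_gK_dK (i : Fin d) {a b s : ℝ} (ha : 0 < a) (hb : 0 < b) (hs : 0 < s)
    (h : s ^ 2 = a ^ 2 + b ^ 2) : cv (gK d 1 a) (dK q i b) = dK q i s := by
  have h1 := (hasWeakPartial_gK (q := q) i hb).cv_right (gK d 1 a)
  rw [cv_gK_gK ha hb hs h] at h1
  exact h1.unique (hasWeakPartial_gK i hs)

/-- The substitution y = τz moves τ from the kernel into the translation. The right-hand side then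
makes sense at τ = 0 too, and dominated convergence gives continuity there. -/
theorem cv_gK_eq_integral {τ : ℝ} (hτ : 0 < τ) (h : LL d q) :
    cv (gK d 1 τ) h = ∫ y, gaussian d 1 y • shift (τ • y) h := by
  have h1 : cv (gK d 1 τ) h = ∫ y, gaussian d τ y • shift y h := by
    rw [cv_apply]
    refine integral_congr_ae ?_
    filter_upwards [gK_coe (d := d) (q := 1) hτ] with y hy
    rw [hy]
  have h2 := Measure.integral_comp_inv_smul_of_nonneg (volume : Measure (E d))
    (fun y => gaussian d 1 y • shift (τ • y) h) hτ.le
  rw [finrank_euclideanSpace, Fintype.card_fin] at h2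
  refine smul_right_injective (LL d q) (r := τ ^ d) (by positivity) (Eq.trans ?_ h2)
  simp only
  rw [h1, ← integral_smul]
  refine integral_congr_ae (ae_of_all _ fun y => ?_)
  simp only
  rw [smul_inv_smul₀ hτ.ne', gaussian_scale hτ, smul_smul, mul_inv_cancel_left₀ (by positivity)]

end HeatKernel

/-! ### The heat operators on L^q and on L¹ + L^q. -/

section HeatOperators

variable {d : ℕ} {q : ℝ≥0∞}

variable (d q) in
/-- The exponent of the smoothing `L¹ → L^q`. -/
def smoothingExponent : ℝ := (d : ℝ) * (1 - q⁻¹.toReal) / 2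

variable [Fact (1 ≤ q)]

theorem smoothingExponent_nonneg : 0 ≤ smoothingExponent d q := by
  have h1 : q⁻¹ ≤ 1 := ENNReal.inv_le_one.2 Fact.out
  have h2 : q⁻¹.toReal ≤ 1 := by
    simpa using ENNReal.toReal_mono ENNReal.one_ne_top h1
  have h3 : 0 ≤ 1 - q⁻¹.toReal := by linarith
  rw [smoothingExponent]; positivity

variable [hqt : Fact (q ≠ ⊤)]

/-- The heat semigroup `h ↦ η_{σ√t} ⋆ h` on `L^q`. -/
def heatOp (σ t : ℝ) : LL d q →L[ℝ] LL d q :=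
  if t = 0 then ContinuousLinearMap.id ℝ _ else cv (gK d 1 (σ * √t))

/-- The heat semigroup acting on each component of a tuple. -/
def heatOpPi (σ t : ℝ) : (Fin d → LL d q) →L[ℝ] (Fin d → LL d q) :=
  ContinuousLinearMap.pi fun i => (heatOp σ t).comp (ContinuousLinearMap.proj i)

/-- The map `(y₁, y₂) ↦ y₁ ⋆ k + k₁ ⋆ y₂` from `L¹ × L^q` to `L^q`. -/
def sumCv (k₁ : LL d 1) (k : LL d q) : LL d 1 × LL d q →L[ℝ] LL d q :=
  (cv.flip k).comp (ContinuousLinearMap.fst ℝ _ _) + (cv k₁).comp (ContinuousLinearMap.snd ℝ _ _)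

/-- The heat semigroup as a family of operators from `L¹ × L^q`, viewed as `L¹ + L^q`,
to `L^q`. -/
def heatSum (σ t : ℝ) : LL d 1 × LL d q →L[ℝ] LL d q :=
  sumCv (gK d 1 (σ * √t)) (gK d q (σ * √t))

/-- The gradient of `heatSum`. -/
def gradSum (σ t : ℝ) : LL d 1 × LL d q →L[ℝ] (Fin d → LL d q) :=
  ContinuousLinearMap.pi fun i => sumCv (dK 1 i (σ * √t)) (dK q i (σ * √t))

/-- The gradient of `heatOp`. -/
def gradOp (σ t : ℝ) : LL d q →L[ℝ] (Fin d → LL d q) :=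
  ContinuousLinearMap.pi fun i => cv (dK 1 i (σ * √t))

theorem sumCv_apply (k₁ : LL d 1) (k : LL d q) (y : LL d 1 × LL d q) :
    sumCv k₁ k y = cv y.1 k + cv k₁ y.2 := rfl

theorem heatOp_zero (σ : ℝ) (h : LL d q) : heatOp σ 0 h = h := by simp [heatOp]

theorem heatOp_pos (σ : ℝ) {t : ℝ} (ht : 0 < t) (h : LL d q) :
    heatOp σ t h = cv (gK d 1 (σ * √t)) h := by simp [heatOp, ht.ne']

theorem scale_pos {σ t : ℝ} (hσ : 0 < σ) (ht : 0 < t) : 0 < σ * √t :=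
  mul_pos hσ (Real.sqrt_pos.2 ht)

theorem scale_sq {σ s t : ℝ} (hs : 0 ≤ s) (ht : 0 ≤ t) :
    (σ * √(s + t)) ^ 2 = (σ * √s) ^ 2 + (σ * √t) ^ 2 := by
  rw [mul_pow, mul_pow, mul_pow, Real.sq_sqrt hs, Real.sq_sqrt ht, Real.sq_sqrt (by linarith)]
  ring

theorem heatOp_eq_integral {σ t : ℝ} (hσ : 0 < σ) (ht : 0 ≤ t) (h : LL d q) :
    heatOp σ t h = ∫ y, gaussian d 1 y • shift ((σ * √t) • y) h := by
  rcases ht.eq_or_lt with h0 | h0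
  · rw [← h0, heatOp_zero]
    have e : ∀ y : E d, shift ((σ * √0) • y) h = h := by
      intro y
      rw [Real.sqrt_zero, mul_zero, zero_smul]
      refine Lp.ext ?_
      filter_upwards [shift_coe (0 : E d) h] with x hx
      rw [hx, sub_zero]
    simp only [e]
    rw [integral_smul_const, integral_gaussian_eq_one one_pos, one_smul]
  · rw [heatOp_pos σ h0, cv_gK_eq_integral (scale_pos hσ h0)]

theorem continuousOn_heatOp {σ : ℝ} (hσ : 0 < σ) (h : LL d q) :
    ContinuousOn (fun t => heatOp σ t h) (Ici 0) := by
  have hc : Continuous fun t : ℝ => ∫ y, gaussian d 1 y • shift ((σ * √t) • y) h := by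
    refine continuous_of_dominated (bound := fun y => gaussian d 1 y * ‖h‖) (fun t => ?_)
      (fun t => ae_of_all _ fun y => ?_) ?_ (ae_of_all _ fun y => ?_)
    · refine ((continuous_gaussian 1).smul ((continuous_shift hqt.out h).comp ?_))
        |>.aestronglyMeasurable
      fun_prop
    · rw [norm_smul, LinearIsometry.norm_map, Real.norm_of_nonneg (gaussian_nonneg zero_le_one y)]
    · exact (memLp_one_iff_integrable.1 (memLp_gaussian one_pos one_ne_zero)).mul_const _
    · refine Continuous.const_smul ((continuous_shift hqt.out h).comp ?_) (gaussian d 1 y)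
      fun_prop
  exact hc.continuousOn.congr fun t ht => heatOp_eq_integral hσ ht h

theorem norm_heatOp_le {σ t : ℝ} (hσ : 0 < σ) (ht : 0 ≤ t) (h : LL d q) :
    ‖heatOp σ t h‖ ≤ ‖h‖ := by
  rcases ht.eq_or_lt with h0 | h0
  · rw [← h0, heatOp_zero]
  · rw [heatOp_pos σ h0]
    refine (norm_cv_le _ _).trans ?_
    rw [norm_gK_one (scale_pos hσ h0), one_mul]

theorem norm_sumCv_le (k₁ : LL d 1) (k : LL d q) (y : LL d 1 × LL d q) :
    ‖sumCv k₁ k y‖ ≤ (‖k‖ + ‖k₁‖) * ‖y‖ := by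
  rw [sumCv_apply, add_mul]
  refine (norm_add_le _ _).trans (add_le_add ((norm_cv_le _ _).trans ?_)
    ((norm_cv_le _ _).trans ?_))
  · rw [mul_comm]; gcongr; exact norm_fst_le y
  · gcongr; exact norm_snd_le y

/-- Composition with a convolution operator. -/
theorem cv_sumCv (k₀ k₁ : LL d 1) (k : LL d q) (y : LL d 1 × LL d q) :
    cv k₀ (sumCv k₁ k y) = sumCv (cv k₀ k₁) (cv k₀ k) y := by
  rw [sumCv_apply, sumCv_apply, map_add, cv_comm_apply, cv_assoc]

theorem scale_rpow {σ t : ℝ} (hσ : 0 < σ) (ht : 0 < t) (e : ℝ) :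
    (σ * √t) ^ e = σ ^ e * t ^ (e / 2) := by
  rw [Real.mul_rpow hσ.le (Real.sqrt_nonneg _), Real.sqrt_eq_rpow, ← Real.rpow_mul ht.le]
  congr 2; ring

variable (d q) in
/-- A constant bounding all the heat operators. -/
def heatConst (σ : ℝ) : ℝ :=
  ‖gK d q 1‖ * σ ^ (-(2 * smoothingExponent d q)) + 1 +
    ∑ i : Fin d, (‖dK q i 1‖ * σ ^ (-(2 * smoothingExponent d q) - 1) +
      ‖dK (1 : ℝ≥0∞) i 1‖ * σ ^ (-1 : ℝ))

theorem norm_gK_scale {σ t : ℝ} (hσ : 0 < σ) (ht : 0 < t) :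
    ‖gK d q (σ * √t)‖ = ‖gK d q 1‖ * σ ^ (-(2 * smoothingExponent d q)) *
      t ^ (-smoothingExponent d q) := by
  rw [norm_gK (scale_pos hσ ht), scale_rpow hσ ht, mul_assoc, smoothingExponent]
  congr 3 <;> ring

theorem norm_dK_scale (i : Fin d) {σ t : ℝ} (hσ : 0 < σ) (ht : 0 < t) :
    ‖dK q i (σ * √t)‖ = ‖dK q i 1‖ * σ ^ (-(2 * smoothingExponent d q) - 1) *
      t ^ (-(smoothingExponent d q + 1 / 2)) := by
  rw [norm_dK i (scale_pos hσ ht), scale_rpow hσ ht, mul_assoc, smoothingExponent]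
  congr 3 <;> ring

theorem norm_dK_one_scale (i : Fin d) {σ t : ℝ} (hσ : 0 < σ) (ht : 0 < t) :
    ‖dK 1 i (σ * √t)‖ = ‖dK 1 i 1‖ * σ ^ (-1 : ℝ) * t ^ (-(1 / 2) : ℝ) := by
  have := norm_dK_scale (q := 1) i hσ ht
  simpa [smoothingExponent] using this

/-- On the L¹ component the smoothing costs t^{-α}, on the L^q component nothing, and a derivative
costs a further t^{-1/2} in each case. For t ≤ 1 the L¹ rates dominate. The composition laws are the
semigroup property of the Gaussians. -/
theorem isParabolic {σ : ℝ} (hσ : 0 < σ) :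
    IsParabolic (heatConst d q σ) (smoothingExponent d q) (heatOp (d := d) (q := q) σ)
      (heatOpPi σ) (heatSum σ) (gradSum σ) (gradOp σ) := by
  set α := smoothingExponent d q with hα
  have hα0 : 0 ≤ α := smoothingExponent_nonneg
  have hterm : ∀ i : Fin d, 0 ≤ ‖dK q i 1‖ * σ ^ (-(2 * α) - 1) +
      ‖dK (1 : ℝ≥0∞) i 1‖ * σ ^ (-1 : ℝ) := fun i => by positivity
  have hsum : 0 ≤ ∑ i : Fin d, (‖dK q i 1‖ * σ ^ (-(2 * α) - 1) +
      ‖dK (1 : ℝ≥0∞) i 1‖ * σ ^ (-1 : ℝ)) := Finset.sum_nonneg fun i _ => hterm i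
  have hfst : 0 ≤ ‖gK d q 1‖ * σ ^ (-(2 * α)) := by positivity
  have hC0 : 0 ≤ heatConst d q σ := by rw [heatConst]; linarith
  have hCA : ‖gK d q 1‖ * σ ^ (-(2 * α)) + 1 ≤ heatConst d q σ := by rw [heatConst]; linarith
  have hCB : ∀ i : Fin d, ‖dK q i 1‖ * σ ^ (-(2 * α) - 1) +
      ‖dK (1 : ℝ≥0∞) i 1‖ * σ ^ (-1 : ℝ) ≤ heatConst d q σ := by
    intro i
    have := Finset.single_le_sum (fun j _ => hterm j) (Finset.mem_univ i)
    rw [heatConst]; linarith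
  have hpi_contr : ∀ (t : ℝ) (z : Fin d → LL d q), 0 ≤ t → ‖heatOpPi σ t z‖ ≤ ‖z‖ := by
    intro t z ht
    refine (pi_norm_le_iff_of_nonneg (norm_nonneg _)).2 fun i => ?_
    exact (norm_heatOp_le hσ ht (z i)).trans (norm_le_pi_norm z i)
  have hpi_cont : ∀ z : Fin d → LL d q, ContinuousOn (fun t => heatOpPi σ t z) (Ici 0) := by
    intro z
    refine continuousOn_pi.2 fun i => ?_
    exact continuousOn_heatOp hσ (z i)
  refine ⟨⟨hC0, fun t z ht => norm_heatOp_le hσ ht z, fun z => continuousOn_heatOp hσ z,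
    fun s τ y hs hτ => ?_, fun τ y hτ hτ1 => ?_⟩,
    ⟨hC0, hpi_contr, hpi_cont, fun s τ y hs hτ => ?_, fun τ y hτ hτ1 => ?_⟩,
    ⟨hC0, hpi_contr, hpi_cont, fun s τ y hs hτ => ?_, fun τ y hτ hτ1 => ?_⟩,
    fun x => heatOp_zero σ x, fun s t x hs ht => ?_⟩
  · rcases hs.eq_or_lt with h0 | h0
    · rw [← h0, heatOp_zero, zero_add]
    · rw [heatOp_pos σ h0, heatSum, heatSum, cv_sumCv,
        cv_gK_gK (scale_pos hσ h0) (scale_pos hσ hτ) (scale_pos hσ (by linarith))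
          (scale_sq hs hτ.le),
        cv_gK_gK (scale_pos hσ h0) (scale_pos hσ hτ) (scale_pos hσ (by linarith))
          (scale_sq hs hτ.le)]
  · refine (norm_sumCv_le _ _ _).trans ?_
    gcongr
    rw [norm_gK_one (scale_pos hσ hτ), norm_gK_scale hσ hτ]
    have h1 : 1 ≤ τ ^ (-α) := Real.one_le_rpow_of_pos_of_le_one_of_nonpos hτ hτ1 (by linarith)
    calc _ ≤ (‖gK d q 1‖ * σ ^ (-(2 * α)) + 1) * τ ^ (-α) := by rw [add_mul, one_mul]; gcongr
      _ ≤ _ := by gcongr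
  · refine funext fun i => ?_
    change heatOp σ s (sumCv _ _ y) = sumCv _ _ y
    rcases hs.eq_or_lt with h0 | h0
    · rw [← h0, heatOp_zero, zero_add]
    · rw [heatOp_pos σ h0, cv_sumCv,
        cv_gK_dK i (scale_pos hσ h0) (scale_pos hσ hτ) (scale_pos hσ (by linarith))
          (scale_sq hs hτ.le),
        cv_gK_dK i (scale_pos hσ h0) (scale_pos hσ hτ) (scale_pos hσ (by linarith))
          (scale_sq hs hτ.le)]
  · refine (pi_norm_le_iff_of_nonneg (by positivity)).2 fun i => ?_
    change ‖sumCv _ _ y‖ ≤ _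
    refine (norm_sumCv_le _ _ _).trans ?_
    gcongr
    rw [norm_dK_one_scale i hσ hτ, norm_dK_scale i hσ hτ]
    have h1 : τ ^ (-(1 / 2) : ℝ) ≤ τ ^ (-(α + 1 / 2)) :=
      Real.rpow_le_rpow_of_exponent_ge hτ hτ1 (by linarith)
    calc _ ≤ (‖dK q i 1‖ * σ ^ (-(2 * α) - 1) + ‖dK (1 : ℝ≥0∞) i 1‖ * σ ^ (-1 : ℝ)) *
          τ ^ (-(α + 1 / 2)) := by rw [add_mul]; gcongr
      _ ≤ _ := by gcongr; exact hCB i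
  · refine funext fun i => ?_
    change heatOp σ s (cv _ y) = cv _ y
    rcases hs.eq_or_lt with h0 | h0
    · rw [← h0, heatOp_zero, zero_add]
    · rw [heatOp_pos σ h0, ← cv_assoc,
        cv_gK_dK i (scale_pos hσ h0) (scale_pos hσ hτ) (scale_pos hσ (by linarith))
          (scale_sq hs hτ.le)]
  · refine (pi_norm_le_iff_of_nonneg (by positivity)).2 fun i => ?_
    change ‖cv _ y‖ ≤ _
    refine (norm_cv_le _ _).trans ?_
    gcongr
    rw [norm_dK_one_scale i hσ hτ]
    gcongr
    refine le_trans ?_ (hCB i)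
    have : 0 ≤ ‖dK q i 1‖ * σ ^ (-(2 * α) - 1) := by positivity
    linarith
  · rw [heatOp_pos σ hs, heatOp_pos σ ht, heatOp_pos σ (by linarith), ← cv_assoc,
      cv_gK_gK (scale_pos hσ hs) (scale_pos hσ ht) (scale_pos hσ (by linarith))
        (scale_sq hs.le ht.le)]

theorem hasWeakPartial_heatSum {σ t : ℝ} (hσ : 0 < σ) (ht : 0 < t) (y : LL d 1 × LL d q)
    (i : Fin d) : HasWeakPartial i (heatSum σ t y) (gradSum σ t y i) :=
  ((hasWeakPartial_gK i (scale_pos hσ ht)).cv_right y.1).add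
    ((hasWeakPartial_gK i (scale_pos hσ ht)).cv_left y.2)

theorem hasWeakPartial_heatOp {σ t : ℝ} (hσ : 0 < σ) (ht : 0 < t) (x : LL d q)
    (i : Fin d) : HasWeakPartial i (heatOp σ t x) (gradOp σ t x i) := by
  rw [heatOp_pos σ ht]
  exact (hasWeakPartial_gK i (scale_pos hσ ht)).cv_left x

end HeatOperators

/-! ### Lipschitz continuity of the reaction term. -/

section Reaction

theorem reaction_zero (W : ℝ) : reaction W 0 = 0 := by simp [reaction]

/-- The polynomial vanishes at 0 and at 1, so cutting it off outside [0,1] amounts to composing it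
with the projection onto [0,1], which is 1-Lipschitz. -/
theorem reaction_eq_projIcc (W ξ : ℝ) : reaction W ξ =
    W * ((max 0 (min 1 ξ) * (max 0 (min 1 ξ) - 1)) ^ 2 * (max 0 (min 1 ξ) - 1 / 2)) := by
  by_cases h : ξ ∈ Icc (0 : ℝ) 1
  · rw [reaction, indicator_of_mem h, min_eq_right h.2, max_eq_right h.1]; ring
  · rw [reaction, indicator_of_notMem h]
    rcases le_total ξ 0 with h0 | h0
    · rw [min_eq_right (h0.trans zero_le_one), max_eq_left h0]; ring
    · have : 1 ≤ ξ := by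
        by_contra h1
        exact h ⟨h0, (not_le.1 h1).le⟩
      rw [min_eq_left this, max_eq_right zero_le_one]; ring

/-- Factoring out x - y leaves a quotient bounded by 1 · (1/2) · (1/2) + 1/4 on the unit square. -/
theorem abs_reaction_polynomial_sub_le {x y : ℝ} (hx : x ∈ Icc (0 : ℝ) 1)
    (hy : y ∈ Icc (0 : ℝ) 1) :
    |(x * (x - 1)) ^ 2 * (x - 1 / 2) - (y * (y - 1)) ^ 2 * (y - 1 / 2)| ≤ |x - y| := by
  have e : (x * (x - 1)) ^ 2 * (x - 1 / 2) - (y * (y - 1)) ^ 2 * (y - 1 / 2) =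
      (x - y) * ((x + y - 1) * (x * (x - 1) + y * (y - 1)) * (x - 1 / 2) +
        (y * (y - 1)) ^ 2) := by ring
  rw [e, abs_mul]
  refine mul_le_of_le_one_right (abs_nonneg _) ?_
  have b1 : |x + y - 1| ≤ 1 := abs_le.2 ⟨by linarith [hx.1, hy.1], by linarith [hx.2, hy.2]⟩
  have ax : |x * (x - 1)| ≤ 1 / 4 :=
    abs_le.2 ⟨by nlinarith [sq_nonneg (x - 1 / 2)], by nlinarith [hx.1, hx.2]⟩
  have ay : |y * (y - 1)| ≤ 1 / 4 :=
    abs_le.2 ⟨by nlinarith [sq_nonneg (y - 1 / 2)], by nlinarith [hy.1, hy.2]⟩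
  have b2 : |x * (x - 1) + y * (y - 1)| ≤ 1 / 2 := (abs_add_le _ _).trans (by linarith)
  have b3 : |x - 1 / 2| ≤ 1 / 2 := abs_le.2 ⟨by linarith [hx.1], by linarith [hx.2]⟩
  have b4 : |(y * (y - 1)) ^ 2| ≤ 1 / 4 := by
    rw [abs_pow]
    nlinarith [abs_nonneg (y * (y - 1))]
  refine (abs_add_le _ _).trans ?_
  rw [abs_mul, abs_mul]
  have b5 : |x + y - 1| * |x * (x - 1) + y * (y - 1)| * |x - 1 / 2| ≤ 1 * (1 / 2) * (1 / 2) := by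
    gcongr
  linarith

theorem lipschitzWith_reaction {W : ℝ} (hW : 0 ≤ W) :
    LipschitzWith W.toNNReal (reaction W) := by
  refine LipschitzWith.of_dist_le_mul fun ξ ζ => ?_
  rw [Real.coe_toNNReal W hW, Real.dist_eq, Real.dist_eq, reaction_eq_projIcc,
    reaction_eq_projIcc, ← mul_sub, abs_mul, abs_of_nonneg hW]
  refine mul_le_mul_of_nonneg_left ?_ hW
  have hmem : ∀ ξ : ℝ, max 0 (min 1 ξ) ∈ Icc (0 : ℝ) 1 := fun ξ =>
    ⟨le_max_left _ _, max_le zero_le_one (min_le_left _ _)⟩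
  refine (abs_reaction_polynomial_sub_le (hmem ξ) (hmem ζ)).trans ?_
  refine (abs_max_sub_max_le_max _ _ _ _).trans (max_le (by simp) ?_)
  exact (abs_min_sub_min_le_max _ _ _ _).trans (max_le (by simp) le_rfl)

end Reaction

/-! ### The source term as a nonlinearity with values in L¹ × L^q. -/

section Source

variable {d : ℕ} {q r : ℝ≥0∞} [Fact (1 ≤ q)] [Fact (1 ≤ r)] {V : Type*} [NormedAddCommGroup V]
  [InnerProductSpace ℝ V]

/-- The vector-valued function with the given components. -/
def vec : (Fin d → LL d q) →L[ℝ] Lp (E d) q (volume : Measure (E d)) :=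
  ∑ i : Fin d, (((ContinuousLinearMap.toSpanSingleton ℝ
    (EuclideanSpace.single i (1 : ℝ) : E d)).compLpL q volume).comp
      (ContinuousLinearMap.proj i))

theorem vec_coe (b : Fin d → LL d q) :
    vec b =ᵐ[volume] fun x => WithLp.toLp 2 (fun i => b i x) := by
  have h1 : ∀ i : Fin d, ∀ᵐ x, ((ContinuousLinearMap.toSpanSingleton ℝ
      (EuclideanSpace.single i (1 : ℝ) : E d)).compLpL q volume (b i)) x
      = b i x • (EuclideanSpace.single i (1 : ℝ) : E d) := fun i => by
    filter_upwards [ContinuousLinearMap.coeFn_compLpL (p := q) (μ := volume)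
      (ContinuousLinearMap.toSpanSingleton ℝ (EuclideanSpace.single i (1 : ℝ) : E d)) (b i)]
      with x hx
    rw [hx, ContinuousLinearMap.toSpanSingleton_apply]
  have h2 : vec b = ∑ i : Fin d, (ContinuousLinearMap.toSpanSingleton ℝ
      (EuclideanSpace.single i (1 : ℝ) : E d)).compLpL q volume (b i) := by
    simp [vec]
  rw [h2]
  filter_upwards [Lp.coeFn_finsetSum Finset.univ (fun i => (ContinuousLinearMap.toSpanSingleton ℝ
      (EuclideanSpace.single i (1 : ℝ) : E d)).compLpL q volume (b i)), ae_all_iff.2 h1]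
    with x hx hx'
  rw [hx]
  ext j
  simp [hx', Pi.single_apply]

/-- The function `x ↦ |b(x)|` in `L^q`. -/
def normLL (b : Fin d → LL d q) : LL d q := lipschitzWith_one_norm.compLp norm_zero (vec b)

theorem normLL_coe (b : Fin d → LL d q) :
    normLL b =ᵐ[volume] fun x => ‖(WithLp.toLp 2 (fun i => b i x) : E d)‖ := by
  filter_upwards [LipschitzWith.coeFn_compLp lipschitzWith_one_norm norm_zero (vec b),
    vec_coe b] with x h1 h2
  rw [normLL, h1, Function.comp_apply, h2]

theorem norm_normLL_sub_le (b b' : Fin d → LL d q) :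
    ‖normLL b - normLL b'‖ ≤ ‖(vec : (Fin d → LL d q) →L[ℝ] _)‖ * ‖b - b'‖ := by
  have := lipschitzWith_one_norm.norm_compLp_sub_le (E := E d) norm_zero (vec b) (vec b')
  rw [NNReal.coe_one, one_mul, ← map_sub] at this
  exact this.trans (ContinuousLinearMap.le_opNorm _ _)

theorem continuous_normLL : Continuous (normLL : (Fin d → LL d q) → LL d q) :=
  (LipschitzWith.continuous_compLp lipschitzWith_one_norm norm_zero).comp
    (vec : (Fin d → LL d q) →L[ℝ] _).continuous

theorem IsC1Embedding.memLp_top {ι : V →ₗ[ℝ] (E d → E d)} (hι : IsC1Embedding ι) (w : V) :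
    MemLp (ι w) ⊤ (volume : Measure (E d)) := by
  obtain ⟨C, hC⟩ := hι.bound
  exact memLp_top_of_bound (hι.contDiff w).continuous.aestronglyMeasurable (C * ‖w‖)
    (ae_of_all _ fun x => (hC w x).1)

/-- The embedding of `V` into the bounded measurable vector fields. -/
def fieldLL {ι : V →ₗ[ℝ] (E d → E d)} (hι : IsC1Embedding ι) :
    V →L[ℝ] Lp (E d) ⊤ (volume : Measure (E d)) :=
  LinearMap.mkContinuous
    { toFun := fun w => (hι.memLp_top w).toLp (ι w)
      map_add' := fun w w' => by
        rw [← MemLp.toLp_add]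
        exact MemLp.toLp_congr _ _ (ae_of_all _ fun x => by rw [map_add])
      map_smul' := fun c w => by
        rw [RingHom.id_apply, ← MemLp.toLp_const_smul]
        exact MemLp.toLp_congr _ _ (ae_of_all _ fun x => by rw [map_smul]) }
    -- The constant in `IsC1Embedding` carries no sign condition, hence the maximum with 0.
    (max hι.bound.choose 0) fun w => by
      refine (Lp.norm_toLp (ι w) (hι.memLp_top w)).le.trans
        (ENNReal.toReal_le_of_le_ofReal (by positivity) ?_)
      rw [eLpNorm_exponent_top]
      refine eLpNormEssSup_le_of_ae_bound (ae_of_all _ fun x => ?_)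
      refine (hι.bound.choose_spec w x).1.trans ?_
      gcongr
      exact le_max_left _ _

theorem fieldLL_coe {ι : V →ₗ[ℝ] (E d → E d)} (hι : IsC1Embedding ι) (w : V) :
    fieldLL hι w =ᵐ[volume] ι w := (hι.memLp_top w).coeFn_toLp

/-- The pointwise inner product of a bounded vector field with an `L^q` vector field. -/
def innerLL : Lp (E d) ⊤ (volume : Measure (E d)) →L[ℝ]
    Lp (E d) q (volume : Measure (E d)) →L[ℝ] LL d q :=
  (innerSL ℝ : E d →L[ℝ] E d →L[ℝ] ℝ).holderL volume ⊤ q q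

theorem innerLL_coe (w : Lp (E d) ⊤ (volume : Measure (E d)))
    (b : Lp (E d) q (volume : Measure (E d))) :
    innerLL w b =ᵐ[volume] fun x => inner ℝ (w x) (b x) :=
  (innerSL ℝ : E d →L[ℝ] E d →L[ℝ] ℝ).coeFn_holder (r := q) w b

/-- The Lipschitz constant of the source term at a given time. -/
def weight (q : ℝ≥0∞) [Fact (1 ≤ q)] (W : ℝ) {ι : V →ₗ[ℝ] (E d → E d)} (hι : IsC1Embedding ι)
    (u : ℝ → LL d r) (v : ℝ → V) (s : ℝ) : ℝ :=
  W + ‖(vec : (Fin d → LL d q) →L[ℝ] _)‖ * ‖u s‖ +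
    (‖(innerLL (d := d) (q := q))‖ *
      ‖fieldLL hι‖ * ‖(vec : (Fin d → LL d q) →L[ℝ] _)‖) * ‖v s‖

theorem memLp_weight {W : ℝ} {ι : V →ₗ[ℝ] (E d → E d)} (hι : IsC1Embedding ι)
    {p : ℝ≥0∞} {u : ℝ → LL d r} (hu : MemLp u p (volume.restrict (Icc (0 : ℝ) 1)))
    {v : ℝ → V} (hv : MemLp v p (volume.restrict (Icc (0 : ℝ) 1))) :
    MemLp (weight q W hι u v) p (volume.restrict (Icc (0 : ℝ) 1)) :=
  ((memLp_const W).add (hu.norm.const_mul _)).add (hv.norm.const_mul _)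

theorem weight_nonneg {W : ℝ} (hW : 0 ≤ W) {ι : V →ₗ[ℝ] (E d → E d)} (hι : IsC1Embedding ι)
    (u : ℝ → LL d r) (v : ℝ → V) (s : ℝ) : 0 ≤ weight q W hι u v s := by
  rw [weight]; positivity

variable [ENNReal.HolderConjugate r q]

/-- The pointwise product `L^r × L^q → L¹`. -/
def mulLL : LL d r →L[ℝ] LL d q →L[ℝ] LL d 1 :=
  (ContinuousLinearMap.mul ℝ ℝ).holderL volume r q 1

theorem mulLL_coe (a : LL d r) (b : LL d q) : mulLL a b =ᵐ[volume] fun x => a x * b x :=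
  (ContinuousLinearMap.mul ℝ ℝ).coeFn_holder (r := 1) a b

/-- The source term as a map into `L¹ × L^q`. -/
def nonlin {W : ℝ} (hW : 0 ≤ W) {ι : V →ₗ[ℝ] (E d → E d)} (hι : IsC1Embedding ι)
    (u : ℝ → LL d r) (v : ℝ → V) (s : ℝ) (a : LL d q) (b : Fin d → LL d q) :
    LL d 1 × LL d q :=
  (mulLL (u s) (normLL b),
    (lipschitzWith_reaction hW).compLp (reaction_zero W) a -
      innerLL (fieldLL hι (v s)) (vec b))

theorem isNonlinearity {W : ℝ} (hW : 0 ≤ W) {ι : V →ₗ[ℝ] (E d → E d)} (hι : IsC1Embedding ι)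
    {u : ℝ → LL d r} {v : ℝ → V}
    (hu : AEStronglyMeasurable u (volume.restrict (Icc (0 : ℝ) 1)))
    (hv : AEStronglyMeasurable v (volume.restrict (Icc (0 : ℝ) 1))) :
    IsNonlinearity (weight q W hι u v) (nonlin (q := q) hW hι u v) := by
  have hnorm0 : normLL (0 : Fin d → LL d q) = 0 := by
    rw [normLL, map_zero]
    exact LipschitzWith.compLp_zero _ _
  refine ⟨fun s => ?_, fun s x y x' y' => ?_, fun T f g hT hf hg => ?_⟩
  · rw [nonlin, hnorm0, map_zero, map_zero, map_zero, LipschitzWith.compLp_zero, sub_zero]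
    rfl
  · set c := ‖(vec : (Fin d → LL d q) →L[ℝ] _)‖ with hc
    set c' := ‖(innerLL (d := d) (q := q))‖ with hc'
    have hx := norm_nonneg (x - x')
    have hy := norm_nonneg (y - y')
    have h1 : ‖(nonlin (q := q) hW hι u v s x y - nonlin hW hι u v s x' y').1‖
        ≤ c * ‖u s‖ * ‖y - y'‖ := by
      simp only [nonlin, Prod.fst_sub]
      rw [← map_sub]
      refine (((ContinuousLinearMap.mul ℝ ℝ).norm_holder_apply_apply_le _ _)).trans ?_
      have e1 : ‖ContinuousLinearMap.mul ℝ ℝ‖ ≤ 1 := ContinuousLinearMap.opNorm_mul_le ℝ ℝ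
      have e2 := norm_normLL_sub_le y y'
      calc _ ≤ 1 * ‖u s‖ * (c * ‖y - y'‖) := by gcongr
        _ = _ := by ring
    have h2 : ‖(nonlin (q := q) hW hι u v s x y - nonlin hW hι u v s x' y').2‖
        ≤ W * ‖x - x'‖ + (c' * ‖fieldLL hι‖ * c) * ‖v s‖ * ‖y - y'‖ := by
      simp only [nonlin, Prod.snd_sub]
      rw [sub_sub_sub_comm, ← map_sub, ← map_sub]
      refine (norm_sub_le _ _).trans (add_le_add ?_ ?_)
      · have := (lipschitzWith_reaction hW).norm_compLp_sub_le (reaction_zero W) x x'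
        rwa [Real.coe_toNNReal W hW] at this
      · refine (ContinuousLinearMap.le_opNorm₂ _ _ _).trans ?_
        have e1 := (fieldLL hι).le_opNorm (v s)
        have e2 := (vec : (Fin d → LL d q) →L[ℝ] _).le_opNorm (y - y')
        calc _ ≤ c' * (‖fieldLL hι‖ * ‖v s‖) * (c * ‖y - y'‖) := by gcongr
          _ = _ := by ring
    have hc0 : 0 ≤ c := norm_nonneg _
    have hc1 : 0 ≤ (c' * ‖fieldLL hι‖ * c) * ‖v s‖ := by positivity
    have hc2 : 0 ≤ c * ‖u s‖ := by positivity
    have e : weight q W hι u v s * (‖x - x'‖ + ‖y - y'‖) = W * ‖x - x'‖ + W * ‖y - y'‖ +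
        c * ‖u s‖ * ‖x - x'‖ + c * ‖u s‖ * ‖y - y'‖ +
        (c' * ‖fieldLL hι‖ * c) * ‖v s‖ * ‖x - x'‖ +
        (c' * ‖fieldLL hι‖ * c) * ‖v s‖ * ‖y - y'‖ := by
      simp only [weight, ← hc, ← hc']; ring
    have p1 := mul_nonneg hW hx
    have p2 := mul_nonneg hW hy
    have p3 := mul_nonneg hc2 hx
    have p4 := mul_nonneg hc2 hy
    have p5 := mul_nonneg hc1 hx
    have p6 := mul_nonneg hc1 hy
    rw [e]
    exact max_le (h1.trans (by linarith)) (h2.trans (by linarith))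
  · have hsub : Ioc 0 T ⊆ Icc (0 : ℝ) 1 := fun s hs => ⟨hs.1.le, hs.2.trans hT⟩
    have hmono : volume.restrict (Ioc 0 T) ≤ volume.restrict (Icc (0 : ℝ) 1) :=
      Measure.restrict_mono hsub le_rfl
    have hu' := hu.mono_measure hmono
    have hv' := hv.mono_measure hmono
    refine AEStronglyMeasurable.prodMk ?_ (AEStronglyMeasurable.sub ?_ ?_)
    · exact (mulLL (d := d) (r := r) (q := q)).aestronglyMeasurable_comp₂ hu'
        (continuous_normLL.comp_aestronglyMeasurable hg)
    · exact (LipschitzWith.continuous_compLp _ _).comp_aestronglyMeasurable hf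
    · exact (innerLL (d := d) (q := q)).aestronglyMeasurable_comp₂
        ((fieldLL hι).continuous.comp_aestronglyMeasurable hv')
        ((vec : (Fin d → LL d q) →L[ℝ] _).continuous.comp_aestronglyMeasurable hg)

/-- The weak partial derivatives as a tuple of elements of `L^q`. -/
def gradLL (f : LL d q) : Fin d → LL d q := fun i => weakPartial i f

/-- This ties the pointwise source of the statement to its splitting in L¹ + L^q. It holds even when
f s has no weak gradient, because both sides use the same default value of `weakPartial`. -/
theorem source_ae_eq {W : ℝ} (hW : 0 ≤ W) {ι : V →ₗ[ℝ] (E d → E d)} (hι : IsC1Embedding ι)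
    (u : ℝ → LL d r) (v : ℝ → V) (f : ℝ → LL d q) (s : ℝ) :
    source W ι u v f s =ᵐ[volume]
      fun x => (nonlin hW hι u v s (f s) (gradLL (f s))).1 x +
        (nonlin hW hι u v s (f s) (gradLL (f s))).2 x := by
  simp only [nonlin]
  filter_upwards [mulLL_coe (u s) (normLL (gradLL (f s))), normLL_coe (gradLL (f s)),
    Lp.coeFn_sub ((lipschitzWith_reaction hW).compLp (reaction_zero W) (f s))
      (innerLL (fieldLL hι (v s)) (vec (gradLL (f s)))),
    LipschitzWith.coeFn_compLp (lipschitzWith_reaction hW) (reaction_zero W) (f s),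
    innerLL_coe (fieldLL hι (v s)) (vec (gradLL (f s))), vec_coe (gradLL (f s)),
    fieldLL_coe hι (v s)] with x h1 h2 h3 h4 h5 h6 h7
  rw [h3, Pi.sub_apply, h4, h1, h2, h5, h6, h7]
  simp only [source, weakGrad, Function.comp_apply, gradLL]
  ring

end Source

/-! ### Pointwise convolution versus the heat operators. -/

section HeatFun

variable {d : ℕ} {q : ℝ≥0∞} [Fact (1 ≤ q)] [hqt : Fact (q ≠ ⊤)]

/-- The Gaussian lies in every L^p with p > 0, so its integrals against both summands converge at
every point and the convolution may be split. -/
theorem heatFun_ae_eq {σ t : ℝ} (hσ : 0 < σ) (ht : 0 < t) {h : E d → ℝ} (y : LL d 1 × LL d q)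
    (hy : h =ᵐ[volume] fun x => y.1 x + y.2 x) : heatFun σ t h =ᵐ[volume] heatSum σ t y := by
  have hτ := scale_pos hσ ht
  set τ := σ * √t with hτdef
  filter_upwards [Lp.coeFn_add (cv y.1 (gK d q τ)) (cv (gK d 1 τ) y.2),
    cv_coe y.1 (gK d q τ), cv_coe (gK d 1 τ) y.2] with x h1 h2 h3
  have hx : MeasurePreserving (fun z : E d => x - z) volume volume :=
    Measure.measurePreserving_sub_left volume x
  have hqx := hx.quasiMeasurePreserving
  change heatFun σ t h x = (cv y.1 (gK d q τ) + cv (gK d 1 τ) y.2) x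
  rw [h1, Pi.add_apply, h2, h3, heatFun, if_neg ht.ne', convolution_def]
  have e1 : ∫ z, ContinuousLinearMap.mul ℝ ℝ (gaussian d τ z) (h (x - z))
      = ∫ z, (gaussian d τ z * y.1 (x - z) + gaussian d τ z * y.2 (x - z)) := by
    refine integral_congr_ae ?_
    filter_upwards [hqx.ae_eq_comp hy] with z hz
    simp only [Function.comp_apply] at hz
    rw [ContinuousLinearMap.mul_apply', hz, mul_add]
  have i1 : Integrable (fun z => gaussian d τ z * y.1 (x - z)) :=
    (memLp_gaussian hτ ENNReal.top_ne_zero).integrable_mul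
      ((Lp.memLp y.1).comp_measurePreserving hx)
  have i2 : Integrable (fun z => gaussian d τ z * y.2 (x - z)) := by
    have hne : ENNReal.conjExponent q ≠ 0 :=
      (zero_lt_one.trans_le (fact_one_le_conjExponent (q := q)).out).ne'
    have := ((Lp.memLp y.2).comp_measurePreserving hx).integrable_mul
      (memLp_gaussian (d := d) (p := ENNReal.conjExponent q) hτ hne)
    refine this.congr (ae_of_all _ fun z => ?_)
    simp [mul_comm]
  rw [e1, integral_add i1 i2]
  congr 1
  -- In `sumCv` the L¹ summand is the kernel and the Gaussian is the L^q function, so the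
  -- convolution has to be reversed.
  · rw [← integral_sub_left_eq_self (fun z => gaussian d τ z * y.1 (x - z)) volume x]
    refine integral_congr_ae ?_
    filter_upwards [hqx.ae_eq_comp (gK_coe (d := d) (q := q) hτ)] with z hz
    simp only [Function.comp_apply] at hz
    rw [hz, sub_sub_cancel, mul_comm]
  · refine integral_congr_ae ?_
    filter_upwards [gK_coe (d := d) (q := 1) hτ] with z hz
    rw [hz]

theorem memLp_heatFun {σ t : ℝ} (hσ : 0 < σ) (ht : 0 < t) {h : E d → ℝ} (y : LL d 1 × LL d q)
    (hy : h =ᵐ[volume] fun x => y.1 x + y.2 x) : MemLp (heatFun σ t h) q volume :=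
  (memLp_congr_ae (heatFun_ae_eq hσ ht y hy)).2 (Lp.memLp _)

theorem heatLp_eq_heatSum {σ t : ℝ} (hσ : 0 < σ) (ht : 0 < t) {h : E d → ℝ}
    (y : LL d 1 × LL d q) (hy : h =ᵐ[volume] fun x => y.1 x + y.2 x) :
    heatLp q σ t h = heatSum σ t y := by
  rw [heatLp, dif_pos (memLp_heatFun hσ ht y hy)]
  refine Lp.ext ?_
  filter_upwards [(memLp_heatFun hσ ht y hy).coeFn_toLp, heatFun_ae_eq hσ ht y hy] with x h1 h2
  rw [h1, h2]

theorem heatLp_eq_heatOp {σ t : ℝ} (hσ : 0 < σ) (ht : 0 ≤ t) (f : LL d q) :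
    heatLp q σ t f = heatOp σ t f := by
  rcases ht.eq_or_lt with h0 | h0
  · subst h0
    have hm : MemLp (heatFun σ 0 f) q volume := by
      rw [heatFun, if_pos rfl]; exact Lp.memLp f
    rw [heatOp_zero, heatLp, dif_pos hm]
    refine Lp.ext ?_
    filter_upwards [hm.coeFn_toLp] with x hx
    rw [hx, heatFun, if_pos rfl]
  -- An L^q function is the element (0, f) of L¹ + L^q.
  · rw [heatLp_eq_heatSum hσ h0 (0, f), heatSum, sumCv_apply, heatOp_pos σ h0]
    · simp
    · filter_upwards [Lp.coeFn_zero ℝ 1 (volume : Measure (E d))] with x hx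
      simp

end HeatFun

/-! ### The norms of W^{1,q} and P_T in terms of gradient tuples. -/

section Sobolev

variable {d : ℕ} {q : ℝ≥0∞} [hq1 : Fact (1 ≤ q)]

theorem HasWeakPartial.weakPartial_eq {i : Fin d} {f g : LL d q} (h : HasWeakPartial i f g) :
    weakPartial i f = g := by
  have hex : ∃ g : LL d q, HasWeakPartial i f g := ⟨g, h⟩
  rw [weakPartial, dif_pos hex]
  exact hex.choose_spec.unique h

theorem MemW1.hasWeakPartial {f : LL d q} (h : MemW1 f) (i : Fin d) :
    HasWeakPartial i f (gradLL f i) := by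
  obtain ⟨g, hg⟩ := h i
  rw [gradLL, hg.weakPartial_eq]
  exact hg

theorem gradLL_eq {f : LL d q} {g : Fin d → LL d q} (h : ∀ i, HasWeakPartial i f (g i)) :
    gradLL f = g := funext fun i => (h i).weakPartial_eq

theorem MemW1.sub {f f' : LL d q} (h : MemW1 f) (h' : MemW1 f') : MemW1 (f - f') :=
  fun i => ⟨_, (h.hasWeakPartial i).sub (h'.hasWeakPartial i)⟩

theorem MemW1.gradLL_sub {f f' : LL d q} (h : MemW1 f) (h' : MemW1 f') :
    gradLL (f - f') = gradLL f - gradLL f' :=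
  gradLL_eq fun i => (h.hasWeakPartial i).sub (h'.hasWeakPartial i)

theorem toReal_exponent_pos (hq : q ≠ ⊤) : 0 < q.toReal :=
  ENNReal.toReal_pos (zero_lt_one.trans_le hq1.out).ne' hq

theorem enorm_gradLL_apply_le_w1Norm (hq : q ≠ ⊤) {f : LL d q} (h : MemW1 f) (i : Fin d) :
    ‖gradLL f i‖ₑ ≤ w1Norm f := by
  have hp := toReal_exponent_pos hq
  rw [w1Norm, if_pos h]
  calc ‖gradLL f i‖ₑ = (‖gradLL f i‖ₑ ^ q.toReal) ^ (1 / q.toReal) := by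
        rw [← ENNReal.rpow_mul, mul_one_div_cancel hp.ne', ENNReal.rpow_one]
    _ ≤ _ := by
        refine ENNReal.rpow_le_rpow (le_trans ?_ le_add_self) (by positivity)
        exact Finset.single_le_sum (f := fun j => ‖weakPartial j f‖ₑ ^ q.toReal)
          (fun _ _ => zero_le) (Finset.mem_univ i)

theorem enorm_gradLL_le_w1Norm (hq : q ≠ ⊤) {f : LL d q} (h : MemW1 f) :
    ‖gradLL f‖ₑ ≤ w1Norm f := by
  rw [← edist_zero_right, edist_pi_le_iff]
  intro i
  rw [Pi.zero_apply, edist_zero_right]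
  exact enorm_gradLL_apply_le_w1Norm hq h i

theorem enorm_apply_le_pi {g : Fin d → LL d q} (i : Fin d) : ‖g i‖ₑ ≤ ‖g‖ₑ := by
  rw [← edist_zero_right, ← edist_zero_right]
  exact edist_le_pi_edist g 0 i

/-- The abstract part uses the maximum norm on gradient tuples. Passing to the W^{1,q} norm costs
(1+d)^{1/q} ≤ 1+d, a factor that the choice of T₀ must compensate. -/
theorem w1Norm_le (hq : q ≠ ⊤) {f : LL d q} (h : MemW1 f) {M : ℝ≥0∞} (hf : ‖f‖ₑ ≤ M)
    (hg : ‖gradLL f‖ₑ ≤ M) : w1Norm f ≤ (1 + d) * M := by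
  have hp := toReal_exponent_pos hq
  have hp1 : 1 ≤ q.toReal := by
    simpa using ENNReal.toReal_mono hq hq1.out
  rw [w1Norm, if_pos h]
  have h1 : ‖f‖ₑ ^ q.toReal + ∑ i, ‖weakPartial i f‖ₑ ^ q.toReal ≤ (1 + d) * M ^ q.toReal := by
    rw [add_mul, one_mul]
    refine add_le_add (ENNReal.rpow_le_rpow hf hp.le) ?_
    calc ∑ i, ‖weakPartial i f‖ₑ ^ q.toReal ≤ ∑ _i : Fin d, M ^ q.toReal :=
          Finset.sum_le_sum fun i _ => ENNReal.rpow_le_rpow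
            ((enorm_apply_le_pi (g := gradLL f) i).trans hg) hp.le
      _ = d * M ^ q.toReal := by simp
  refine (ENNReal.rpow_le_rpow h1 (by positivity)).trans ?_
  rw [ENNReal.mul_rpow_of_nonneg _ _ (by positivity), ← ENNReal.rpow_mul,
    mul_one_div_cancel hp.ne', ENNReal.rpow_one]
  gcongr
  calc ((1 : ℝ≥0∞) + d) ^ (1 / q.toReal) ≤ (1 + d) ^ (1 : ℝ) :=
        ENNReal.rpow_le_rpow_of_exponent_le le_self_add ((div_le_one hp).2 hp1)
    _ = _ := ENNReal.rpow_one _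

theorem IsPath.continuousOn_gradLL (hq : q ≠ ⊤) {T : ℝ} {f : ℝ → LL d q} (hf : IsPath T f) :
    ContinuousOn (fun t => gradLL (f t)) (Ioc 0 T) := by
  intro t ht
  rw [ContinuousWithinAt, tendsto_iff_edist_tendsto_0]
  refine tendsto_of_tendsto_of_tendsto_of_le_of_le' tendsto_const_nhds (hf.continuous_w1 t ht)
    (Eventually.of_forall fun _ => zero_le) ?_
  filter_upwards [self_mem_nhdsWithin] with s hs
  rw [edist_eq_enorm_sub, ← (hf.mem_w1 s hs).gradLL_sub (hf.mem_w1 t ht)]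
  exact enorm_gradLL_le_w1Norm hq ((hf.mem_w1 s hs).sub (hf.mem_w1 t ht))

theorem isPath_of_continuousOn (hq : q ≠ ⊤) {T : ℝ} {f : ℝ → LL d q} {g : ℝ → Fin d → LL d q}
    (hf : ContinuousOn f (Icc 0 T)) (hg : ContinuousOn g (Ioc 0 T))
    (h : ∀ t ∈ Ioc 0 T, ∀ i, HasWeakPartial i (f t) (g t i)) : IsPath T f := by
  have hw : ∀ t ∈ Ioc 0 T, MemW1 (f t) := fun t ht i => ⟨_, h t ht i⟩
  refine ⟨hf, hw, fun t ht => ?_⟩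
  have h1 : Tendsto (fun s => ‖f s - f t‖ₑ) (𝓝[Ioc 0 T] t) (𝓝 0) := by
    have := tendsto_iff_edist_tendsto_0.1 ((hf.mono Ioc_subset_Icc_self) t ht)
    simpa only [edist_eq_enorm_sub] using this
  have h2 : Tendsto (fun s => ‖g s - g t‖ₑ) (𝓝[Ioc 0 T] t) (𝓝 0) := by
    have := tendsto_iff_edist_tendsto_0.1 (hg t ht)
    simpa only [edist_eq_enorm_sub] using this
  have h3 : Tendsto (fun s => (1 + (d : ℝ≥0∞)) * max ‖f s - f t‖ₑ ‖g s - g t‖ₑ)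
      (𝓝[Ioc 0 T] t) (𝓝 0) := by
    have := ENNReal.Tendsto.const_mul (a := 1 + (d : ℝ≥0∞)) (h1.max h2)
      (Or.inr (by finiteness))
    simpa using this
  refine tendsto_of_tendsto_of_tendsto_of_le_of_le' tendsto_const_nhds h3
    (Eventually.of_forall fun _ => zero_le) ?_
  filter_upwards [self_mem_nhdsWithin] with s hs
  refine w1Norm_le hq ((hw s hs).sub (hw t ht)) (le_max_left _ _) ?_
  rw [(hw s hs).gradLL_sub (hw t ht), gradLL_eq (h s hs), gradLL_eq (h t ht)]
  exact le_max_right _ _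

theorem norm_le_of_pNorm_le {T R : ℝ} (hR : 0 ≤ R) {f : ℝ → LL d q}
    (h : pNorm T f ≤ ENNReal.ofReal R) {t : ℝ} (ht : t ∈ Icc 0 T) : ‖f t‖ ≤ R := by
  have h1 : ‖f t‖ₑ ≤ pNorm T f :=
    (le_iSup₂ (f := fun t (_ : t ∈ Icc 0 T) => ‖f t‖ₑ) t ht).trans (le_max_left _ _)
  rw [← ofReal_norm] at h1
  exact (ENNReal.ofReal_le_ofReal_iff hR).1 (h1.trans h)

theorem sqrt_mul_norm_gradLL_le_of_pNorm_le (hq : q ≠ ⊤) {T R : ℝ} (hR : 0 ≤ R) {f : ℝ → LL d q}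
    (h : pNorm T f ≤ ENNReal.ofReal R) {t : ℝ} (ht : t ∈ Ioc 0 T) (hw : MemW1 (f t)) :
    √t * ‖gradLL (f t)‖ ≤ R := by
  have h1 : ENNReal.ofReal (√t) * w1Norm (f t) ≤ pNorm T f :=
    (le_iSup₂ (f := fun t (_ : t ∈ Ioc 0 T) => ENNReal.ofReal (√t) * w1Norm (f t)) t ht).trans
      (le_max_right _ _)
  have h2 : ENNReal.ofReal (√t * ‖gradLL (f t)‖) ≤ ENNReal.ofReal R := by
    rw [ENNReal.ofReal_mul (Real.sqrt_nonneg _), ofReal_norm]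
    exact (mul_le_mul_right (enorm_gradLL_le_w1Norm hq hw) _).trans (h1.trans h)
  exact (ENNReal.ofReal_le_ofReal_iff hR).1 h2

theorem pNorm_le (hq : q ≠ ⊤) {T R : ℝ} (hT : T ≤ 1) {f : ℝ → LL d q}
    (hf : ∀ t ∈ Icc 0 T, ‖f t‖ ≤ R)
    (hw : ∀ t ∈ Ioc 0 T, MemW1 (f t)) (hg : ∀ t ∈ Ioc 0 T, √t * ‖gradLL (f t)‖ ≤ R) :
    pNorm T f ≤ (1 + d) * ENNReal.ofReal R := by
  refine max_le (iSup₂_le fun t ht => ?_) (iSup₂_le fun t ht => ?_)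
  · rw [← ofReal_norm]
    exact (ENNReal.ofReal_le_ofReal (hf t ht)).trans (le_mul_of_one_le_left' le_self_add)
  · have hpos : 0 < √t := Real.sqrt_pos.2 ht.1
    have h1 : w1Norm (f t) ≤ (1 + d) * ENNReal.ofReal (R / √t) := by
      refine w1Norm_le hq (hw t ht) ?_ ?_
      · rw [← ofReal_norm]
        refine ENNReal.ofReal_le_ofReal ?_
        rw [le_div_iff₀ hpos]
        refine (mul_le_of_le_one_right (norm_nonneg _) ?_).trans (hf t (Ioc_subset_Icc_self ht))
        exact Real.sqrt_le_one.2 (ht.2.trans hT)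
      · rw [← ofReal_norm]
        refine ENNReal.ofReal_le_ofReal ?_
        rw [le_div_iff₀ hpos, mul_comm]
        exact hg t ht
    calc ENNReal.ofReal (√t) * w1Norm (f t)
        ≤ ENNReal.ofReal (√t) * ((1 + d) * ENNReal.ofReal (R / √t)) := by gcongr
      _ = (1 + d) * (ENNReal.ofReal (√t) * ENNReal.ofReal (R / √t)) := by ring
      _ = (1 + d) * ENNReal.ofReal R := by
          rw [← ENNReal.ofReal_mul hpos.le, mul_div_cancel₀ _ hpos.ne']

theorem MemP.exists_bound (hq : q ≠ ⊤) {T : ℝ} {f : ℝ → LL d q} (hf : MemP T f) :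
    ∃ R, (∀ t ∈ Icc 0 T, ‖f t‖ ≤ R) ∧ ∀ t ∈ Ioc 0 T, √t * ‖gradLL (f t)‖ ≤ R := by
  have h : pNorm T f ≤ ENNReal.ofReal (pNorm T f).toReal :=
    (ENNReal.ofReal_toReal hf.2.ne).ge
  exact ⟨(pNorm T f).toReal, fun t ht => norm_le_of_pNorm_le ENNReal.toReal_nonneg h ht,
    fun t ht => sqrt_mul_norm_gradLL_le_of_pNorm_le hq ENNReal.toReal_nonneg h ht
      (hf.1.mem_w1 t ht)⟩

end Sobolev

/-! ### Arithmetic of the exponents. -/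

section Exponents

/-- The value q = ∞ would force r = 1, but r > d/(1 - 2/p) ≥ d ≥ 1. -/
theorem exponent_ne_top {d : ℕ} (hd : 0 < d) {p r q : ℝ≥0∞} [hrq : ENNReal.HolderConjugate r q]
    (hr : (d : ℝ≥0∞) / (1 - 2 / p) < r) : q ≠ ⊤ := by
  rintro rfl
  have h1 : r⁻¹ + (⊤ : ℝ≥0∞)⁻¹ = 1⁻¹ := hrq.inv_add_inv_eq_inv
  simp only [ENNReal.inv_top, add_zero, inv_one, ENNReal.inv_eq_one] at h1
  subst h1
  have h2 : (1 : ℝ≥0∞) ≤ (d : ℝ≥0∞) / (1 - 2 / p) := by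
    calc (1 : ℝ≥0∞) ≤ (d : ℝ≥0∞) := by exact_mod_cast hd
      _ = d / 1 := (div_one _).symm
      _ ≤ _ := ENNReal.div_le_div_left tsub_le_self _
  exact absurd hr (not_lt.2 h2)

/-- Since 1 - 1/q = 1/r, the smoothing exponent is d/(2r). The claim is half of d/r < 1 - 2/p, which
is the hypothesis on r. -/
theorem smoothingExponent_add_lt {d : ℕ} {p r q : ℝ≥0∞} [hrq : ENNReal.HolderConjugate r q]
    (hp : 2 < p) (hr : (d : ℝ≥0∞) / (1 - 2 / p) < r) :
    smoothingExponent d q + 1 / 2 + p⁻¹.toReal < 1 := by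
  have hp0 : p ≠ 0 := (pos_of_gt hp).ne'
  have h2p : 2 / p < 1 := by
    rw [ENNReal.div_lt_iff (Or.inl hp0) (Or.inr (by simp)), one_mul]
    exact hp
  set x : ℝ≥0∞ := 1 - 2 / p with hx
  have hx0 : x ≠ 0 := (tsub_pos_of_lt h2p).ne'
  have hxt : x ≠ ⊤ := ne_top_of_le_ne_top ENNReal.one_ne_top tsub_le_self
  have hr0 : r ≠ 0 := (pos_of_gt hr).ne'
  have h1 : (d : ℝ≥0∞) < r * x := (ENNReal.div_lt_iff (Or.inl hx0) (Or.inl hxt)).1 hr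
  have h2 : (d : ℝ≥0∞) / r < x := by
    by_cases hrt : r = ⊤
    · rw [hrt, ENNReal.div_top]; exact pos_iff_ne_zero.2 hx0
    · rw [ENNReal.div_lt_iff (Or.inl hr0) (Or.inl hrt), mul_comm]; exact h1
  have h3 := (ENNReal.toReal_lt_toReal (ne_top_of_lt h2) hxt).2 h2
  rw [div_eq_mul_inv, ENNReal.toReal_mul, hx, ENNReal.toReal_sub_of_le h2p.le ENNReal.one_ne_top,
    div_eq_mul_inv, ENNReal.toReal_mul] at h3
  simp only [ENNReal.toReal_natCast, ENNReal.toReal_one, ENNReal.toReal_ofNat] at h3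
  have h4 : r⁻¹ + q⁻¹ = 1 := by simpa using hrq.inv_add_inv_eq_inv
  have hri : r⁻¹ ≠ ⊤ := ne_top_of_le_ne_top ENNReal.one_ne_top (h4 ▸ le_self_add)
  have hqi : q⁻¹ ≠ ⊤ := ne_top_of_le_ne_top ENNReal.one_ne_top (h4 ▸ le_add_self)
  have h5 : r⁻¹.toReal + q⁻¹.toReal = 1 := by
    rw [← ENNReal.toReal_add hri hqi, h4, ENNReal.toReal_one]
  have h6 : 1 - q⁻¹.toReal = r⁻¹.toReal := by linarith
  rw [smoothingExponent, h6]
  linarith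

theorem exists_time_bound {Q θ ε : ℝ} (hθ : 0 < θ) (hε : 0 < ε) :
    ∃ T₀ ∈ Ioc (0 : ℝ) 1, Q * T₀ ^ θ ≤ ε := by
  have hcont : Tendsto (fun t : ℝ => Q * t ^ θ) (𝓝[>] 0) (𝓝 0) := by
    have : ContinuousAt (fun t : ℝ => Q * t ^ θ) 0 :=
      ContinuousAt.mul continuousAt_const (ContinuousAt.rpow_const continuousAt_id (Or.inr hθ.le))
    have h0 := this.tendsto
    simp only [Real.zero_rpow hθ.ne', mul_zero] at h0
    exact h0.mono_left nhdsWithin_le_nhds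
  obtain ⟨T, h1, h2⟩ := ((hcont.eventually (gt_mem_nhds hε)).and
    (Ioc_mem_nhdsGT (zero_lt_one' ℝ))).exists
  exact ⟨T, h2, h1.le⟩

end Exponents

/-- The Duhamel formula can be restarted at every positive time. -/
theorem IsParabolic.duhamel_restart {X X' Y : Type*} [NormedAddCommGroup X] [NormedSpace ℝ X]
    [CompleteSpace X] [NormedAddCommGroup X'] [NormedSpace ℝ X'] [NormedAddCommGroup Y]
    [NormedSpace ℝ Y] {C α : ℝ} {S : ℝ → X →L[ℝ] X} {S' : ℝ → X' →L[ℝ] X'} {A : ℝ → Y →L[ℝ] X}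
    {B : ℝ → Y →L[ℝ] X'} {G : ℝ → X →L[ℝ] X'} (h : IsParabolic C α S S' A B G) (x₀ : X)
    {F : ℝ → Y} {c t : ℝ} (hc : 0 < c) (hct : c < t)
    (hFc : IntegrableOn (fun s => A (c - s) (F s)) (Ioc 0 c))
    (hFt : IntegrableOn (fun s => A (t - s) (F s)) (Ioc c t)) :
    duhamel S A x₀ F t =
      S (t - c) (duhamel S A x₀ F c) + ∫ s in Ioc c t, A (t - s) (F s) := by
  have hpos : 0 < t - c := sub_pos.2 hct
  have hsplit := IsSmoothing.integral_split (A := A) (A₁ := A) (G := S (t - c)) hc.le hct.le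
    (fun s y hs => by
      rw [h.smoothing.comp _ _ _ hpos.le (sub_pos.2 hs)]; congr 2; ring) hFc hFt
  rw [duhamel, duhamel, hsplit.2, map_add, h.add_apply _ _ _ hpos hc, sub_add_cancel, add_assoc]

/-! ### The concrete equation as an instance of the abstract one. -/

section Assembly

variable {d : ℕ} {q r : ℝ≥0∞} [Fact (1 ≤ q)] [hqt : Fact (q ≠ ⊤)]

/-- Weak derivatives pass through a Bochner integral once the differentiated integrand is
integrable. The endpoint s = t, where the operators do not smooth, is a null set. -/
theorem hasWeakPartial_integral_heatSum {σ : ℝ} (hσ : 0 < σ) {F : ℝ → LL d 1 × LL d q} {c t : ℝ}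
    (hA : IntegrableOn (fun s => heatSum σ (t - s) (F s)) (Ioc c t))
    (hB : IntegrableOn (fun s => gradSum σ (t - s) (F s)) (Ioc c t)) (i : Fin d) :
    HasWeakPartial i (∫ s in Ioc c t, heatSum σ (t - s) (F s))
      ((∫ s in Ioc c t, gradSum σ (t - s) (F s)) i) := by
  have h1 := (ContinuousLinearMap.proj (R := ℝ) (φ := fun _ : Fin d => LL d q)
    i).integral_comp_comm hB
  have h2 : IntegrableOn (fun s => gradSum σ (t - s) (F s) i) (Ioc c t) :=
    (ContinuousLinearMap.proj (R := ℝ) (φ := fun _ : Fin d => LL d q) i).integrable_comp hB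
  have h3 := HasWeakPartial.integral (i := i) hA h2 (by
    have hne : ∀ᵐ s ∂volume.restrict (Ioc c t), s ≠ t := ae_restrict_of_ae (by simp [ae_iff])
    filter_upwards [ae_restrict_mem measurableSet_Ioc, hne] with s hs hst
    exact hasWeakPartial_heatSum hσ (sub_pos.2 (lt_of_le_of_ne hs.2 hst)) (F s) i)
  rw [show (∫ s in Ioc c t, gradSum σ (t - s) (F s)) i
    = ∫ s in Ioc c t, gradSum σ (t - s) (F s) i from h1.symm]
  exact h3

variable [Fact (1 ≤ r)] [ENNReal.HolderConjugate r q] {V : Type*} [NormedAddCommGroup V]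
  [InnerProductSpace ℝ V] {W σ : ℝ} {ι : V →ₗ[ℝ] (E d → E d)} {u : ℝ → LL d r} {v : ℝ → V}

theorem ae_heatLp_source_eq (hW : 0 ≤ W) (hσ : 0 < σ) (hι : IsC1Embedding ι) (f : ℝ → LL d q)
    (t : ℝ) : ∀ᵐ s ∂volume.restrict (Ioc 0 t),
      MemLp (heatFun σ (t - s) (source W ι u v f s)) q volume ∧
      heatLp q σ (t - s) (source W ι u v f s)
        = heatSum σ (t - s) (nonlin hW hι u v s (f s) (gradLL (f s))) := by
  -- At s = t the kernel is the Dirac mass, and the source, known only to lie in L¹ + L^q, need not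
  -- be in L^q.
  have hne : ∀ᵐ s ∂volume.restrict (Ioc 0 t), s ≠ t := ae_restrict_of_ae (by simp [ae_iff])
  filter_upwards [ae_restrict_mem measurableSet_Ioc, hne] with s hs hst
  have hpos : 0 < t - s := sub_pos.2 (lt_of_le_of_ne hs.2 hst)
  exact ⟨memLp_heatFun hσ hpos _ (source_ae_eq hW hι u v f s),
    heatLp_eq_heatSum hσ hpos _ (source_ae_eq hW hι u v f s)⟩

theorem Psi_eq_duhamel (hW : 0 ≤ W) (hσ : 0 < σ) (hι : IsC1Embedding ι) (f₀ : LL d q)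
    (f : ℝ → LL d q) {t : ℝ} (ht : 0 ≤ t) :
    Psi W σ ι f₀ u v f t = duhamel (heatOp σ) (heatSum σ) f₀
      (fun s => nonlin hW hι u v s (f s) (gradLL (f s))) t := by
  rw [Psi, duhamel, heatLp_eq_heatOp hσ ht, intervalIntegral.integral_of_le ht]
  congr 1
  exact integral_congr_ae ((ae_heatLp_source_eq hW hσ hι f t).mono fun s hs => hs.2)

/-- Smoothing places the integrand in L^q for every s < t, so only its integrability in time is a
genuine condition. -/
theorem duhamelExists_iff (hW : 0 ≤ W) (hσ : 0 < σ) (hι : IsC1Embedding ι) {T : ℝ}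
    {f : ℝ → LL d q} : DuhamelExists W σ ι u v T f ↔ ∀ t ∈ Icc 0 T,
      IntegrableOn (fun s => heatSum σ (t - s) (nonlin hW hι u v s (f s) (gradLL (f s))))
        (Ioc 0 t) := by
  have hae := fun t => ae_heatLp_source_eq (u := u) (v := v) hW hσ hι f t
  refine forall₂_congr fun t ht => ?_
  rw [intervalIntegrable_iff_integrableOn_Ioc_of_le ht.1]
  have hiff := integrable_congr ((hae t).mono fun s hs => hs.2)
  exact ⟨fun h => hiff.1 h.2, fun h => ⟨(hae t).mono fun s hs => hs.1, hiff.2 h⟩⟩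

/-- If the values of a path at two times are given by the Duhamel formula, then the path can be
restarted at the earlier one, and its gradient satisfies the differentiated formula. -/
theorem evolution_of_eq_duhamel (hσ : 0 < σ) {f₀ a b : LL d q} {F : ℝ → LL d 1 × LL d q}
    {c t : ℝ} (hc : 0 < c) (hct : c < t)
    (hFc : IntegrableOn (fun s => heatSum σ (c - s) (F s)) (Ioc 0 c))
    (hFt : IntegrableOn (fun s => heatSum σ (t - s) (F s)) (Ioc 0 t))
    (hB : IntegrableOn (fun s => gradSum σ (t - s) (F s)) (Ioc c t))
    (ha : a = duhamel (heatOp σ) (heatSum σ) f₀ F c)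
    (hb : b = duhamel (heatOp σ) (heatSum σ) f₀ F t) :
    b = heatOp σ (t - c) a + ∫ s in Ioc c t, heatSum σ (t - s) (F s) ∧
    gradLL b = gradOp σ (t - c) a + ∫ s in Ioc c t, gradSum σ (t - s) (F s) := by
  have hpar := isParabolic (d := d) (q := q) hσ
  have hpos : 0 < t - c := sub_pos.2 hct
  have hA : IntegrableOn (fun s => heatSum σ (t - s) (F s)) (Ioc c t) :=
    hFt.mono_set (Ioc_subset_Ioc_left hc.le)
  have e1 : b = heatOp σ (t - c) a + ∫ s in Ioc c t, heatSum σ (t - s) (F s) := by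
    rw [ha, hb, hpar.duhamel_restart f₀ hc hct hFc hA]
  refine ⟨e1, gradLL_eq fun i => ?_⟩
  rw [e1]
  exact (hasWeakPartial_heatOp hσ hpos a i).add (hasWeakPartial_integral_heatSum hσ hA hB i)

/-- The gradient source is integrable away from the initial time along every path. -/
theorem IsPath.integrableOn_gradSum {N : ℝ → LL d q → (Fin d → LL d q) → LL d 1 × LL d q}
    {m : ℝ → ℝ} {θ K : ℝ} (hσ : 0 < σ) (hN : IsNonlinearity m N)
    (hk : HasKernelBound m (smoothingExponent d q + 1 / 2) θ K) {T : ℝ} (hT : T ≤ 1)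
    {f : ℝ → LL d q} (hp : IsPath T f) {c t : ℝ} (hc : 0 < c) (hct : c < t) (ht : t ≤ T) :
    IntegrableOn (fun s => gradSum σ (t - s) (N s (f s) (gradLL (f s)))) (Ioc c t) := by
  have hgrad := hp.continuousOn_gradLL hqt.out
  have s1 : Icc c T ⊆ Icc 0 T := Icc_subset_Icc_left hc.le
  have s2 : Icc c T ⊆ Ioc 0 T := fun s hs => ⟨hc.trans_le hs.1, hs.2⟩
  -- A path in X_T has no weighted gradient bound at 0, so compactness of [c, T] has to supply one.
  obtain ⟨R1, h1⟩ := isCompact_Icc.exists_bound_of_continuousOn (hp.continuousOn.mono s1)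
  obtain ⟨R2, h2⟩ := isCompact_Icc.exists_bound_of_continuousOn (hgrad.mono s2)
  refine (isParabolic (d := d) (q := q) hσ).grad_smoothing.integrableOn hk le_rfl hc.le hct
    (ht.trans hT)
    ((hN.aestronglyMeasurable_path hT (hp.continuousOn.mono Ioc_subset_Icc_self) hgrad).mono_measure
      (Measure.restrict_mono (Ioc_subset_Ioc hc.le ht) le_rfl)) (R := 2 * max R1 R2) ?_
  filter_upwards [ae_restrict_mem measurableSet_Ioc] with s hs
  have hs' : s ∈ Icc c T := ⟨hs.1.le, hs.2.trans ht⟩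
  refine hN.norm_le hk.weight_nonneg hs.1 (by linarith [hs'.2])
    ((h1 s hs').trans (le_max_left _ _)) ?_
  refine (mul_le_of_le_one_left (norm_nonneg _) ?_).trans
    ((h2 s hs').trans (le_max_right _ _))
  exact Real.sqrt_le_one.2 (by linarith [hs'.2])

/-- A mild solution satisfies the integral equation, and its gradient the differentiated
equation, from every positive initial time. -/
theorem IsMildSolution.evolution {m : ℝ → ℝ} {θ K : ℝ} (hW : 0 ≤ W) (hσ : 0 < σ)
    (hι : IsC1Embedding ι) {f₀ : LL d q}
    (hN : IsNonlinearity m (nonlin (q := q) hW hι u v))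
    (hk : HasKernelBound m (smoothingExponent d q + 1 / 2) θ K) {T : ℝ} (hT : T ≤ 1)
    {f : ℝ → LL d q} (hp : IsPath T f) (hf : IsMildSolution W σ ι f₀ u v T f) {c t : ℝ}
    (hc : 0 < c) (hct : c < t) (ht : t ≤ T) :
    f t = heatOp σ (t - c) (f c) + ∫ s in Ioc c t,
      heatSum σ (t - s) (nonlin hW hι u v s (f s) (gradLL (f s))) ∧
    gradLL (f t) = gradOp σ (t - c) (f c) + ∫ s in Ioc c t,
      gradSum σ (t - s) (nonlin hW hι u v s (f s) (gradLL (f s))) := by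
  have hex := (duhamelExists_iff hW hσ hι).1 hf.1
  have hct' : c ∈ Icc 0 T := ⟨hc.le, hct.le.trans ht⟩
  have htt : t ∈ Icc 0 T := ⟨hc.le.trans hct.le, ht⟩
  exact evolution_of_eq_duhamel (f₀ := f₀) hσ hc hct (hex c hct') (hex t htt)
    (hp.integrableOn_gradSum hσ hN hk hT hc hct ht)
    ((hf.2 c hct').trans (Psi_eq_duhamel hW hσ hι f₀ f hct'.1))
    ((hf.2 t htt).trans (Psi_eq_duhamel hW hσ hι f₀ f htt.1))

/-- The Duhamel term of a source with the critical growth lies in `W^{1,q}` at positive times. -/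
theorem hasWeakPartial_duhamel {m : ℝ → ℝ} {θ K R T : ℝ} (hσ : 0 < σ)
    (hk : HasKernelBound m (smoothingExponent d q + 1 / 2) θ K) (hT : T ≤ 1) (f₀ : LL d q)
    {F : ℝ → LL d 1 × LL d q} (hF : AEStronglyMeasurable F (volume.restrict (Ioc 0 T)))
    (hFR : ∀ᵐ s ∂volume.restrict (Ioc 0 T), ‖F s‖ ≤ R * (s ^ (-(1 / 2 : ℝ)) * m s))
    {t : ℝ} (ht : t ∈ Ioc 0 T) :
    IntegrableOn (fun s => heatSum σ (t - s) (F s)) (Ioc 0 t) ∧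
    ∀ i, HasWeakPartial i (duhamel (heatOp σ) (heatSum σ) f₀ F t)
      (duhamel (gradOp σ) (gradSum σ) f₀ F t i) := by
  have hpar := isParabolic (d := d) (q := q) hσ
  have hmono : volume.restrict (Ioc 0 t) ≤ volume.restrict (Ioc 0 T) :=
    Measure.restrict_mono (Ioc_subset_Ioc_right ht.2) le_rfl
  have hFR' : ∀ᵐ s ∂volume.restrict (Ioc 0 t),
      ‖F s‖ ≤ R * ((s - 0) ^ (-(1 / 2 : ℝ)) * m s) := by
    simp only [sub_zero]
    exact ae_mono hmono hFR
  have hA := hpar.smoothing.integrableOn hk (by linarith) le_rfl ht.1 (ht.2.trans hT)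
    (hF.mono_measure hmono) hFR'
  have hB := hpar.grad_smoothing.integrableOn hk le_rfl le_rfl ht.1 (ht.2.trans hT)
    (hF.mono_measure hmono) hFR'
  exact ⟨hA, fun i => (hasWeakPartial_heatOp hσ ht.1 f₀ i).add
    (hasWeakPartial_integral_heatSum hσ hA hB i)⟩

end Assembly

end AllenCahn

end

/-! ### The main theorem. -/

open AllenCahn
theorem mainTheorem2 {d : ℕ} (hd : 0 < d) (W σ : ℝ) (hW : 0 < W) (hσ : 0 < σ)
    (p r q : ℝ≥0∞) [Fact (1 ≤ r)] [Fact (1 ≤ q)] [ENNReal.HolderConjugate r q]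
    (hp : 2 < p) (hr : (d : ℝ≥0∞) / (1 - 2 / p) < r)
    {V : Type*} [NormedAddCommGroup V] [InnerProductSpace ℝ V] [CompleteSpace V]
    (ι : V →ₗ[ℝ] (E d → E d)) (hι : IsC1Embedding ι)
    (f₀ : LL d q)
    (u : ℝ → LL d r) (hu : MemLp u p (volume.restrict (Icc (0 : ℝ) 1)))
    (v : ℝ → V) (hv : MemLp v p (volume.restrict (Icc (0 : ℝ) 1))) :
    ∃ T₀ ∈ Ioc (0 : ℝ) 1, ∀ T ∈ Ioc (0 : ℝ) T₀,
      -- `Ψ` is a well-defined contraction of `P_T`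
      (∀ f, MemP T f → DuhamelExists W σ ι u v T f ∧ MemP T (Psi W σ ι f₀ u v f)) ∧
      (∃ κ : ℝ≥0, κ < 1 ∧ ∀ f g, MemP T f → MemP T g →
        pNorm T (Psi W σ ι f₀ u v f - Psi W σ ι f₀ u v g) ≤ κ * pNorm T (f - g)) ∧
      -- existence in `P_T`, the initial value, and uniqueness
      ∃ f, MemP T f ∧ IsMildSolution W σ ι f₀ u v T f ∧
        Tendsto f (𝓝[>] 0) (𝓝 f₀) ∧
        ∀ g, IsPath T g → IsMildSolution W σ ι f₀ u v T g → EqOn g f (Icc 0 T) := by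
  have hqt : q ≠ ⊤ := exponent_ne_top hd hr
  have : Fact (q ≠ ⊤) := ⟨hqt⟩
  set α := smoothingExponent d q with hα
  have hα0 : 0 ≤ α := smoothingExponent_nonneg
  have hαp : α + 1 / 2 + p⁻¹.toReal < 1 := smoothingExponent_add_lt hp hr
  set m := weight q W hι u v with hm
  set N := nonlin (q := q) hW.le hι u v with hNdef
  have hN : IsNonlinearity m N := isNonlinearity hW.le hι hu.1 hv.1
  have hp1 : 1 ≤ p := le_trans (by norm_num) hp.le
  obtain ⟨K, hK0, hK⟩ := exists_kernel_bound (p := p) (a := α + 1 / 2) (b := 1 / 2)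
    (by linarith) (by norm_num) hp1 hαp (by linarith) (memLp_weight (q := q) (W := W) hι hu hv)
  -- With b = 1/2 the power in `exists_kernel_bound` is 1 - 1/p - (α + 1/2) - 1/2 = θ - 1/2.
  set θ := 1 - p⁻¹.toReal - (α + 1 / 2) with hθ
  have hθ0 : 0 < θ := by linarith
  have hk : HasKernelBound m (α + 1 / 2) θ K :=
    ⟨weight_nonneg hW.le hι u v, hK0, hθ0, fun c t h1 h2 h3 => (hK c t h1 h2 h3).1,
      fun c t h1 h2 h3 => (hK c t h1 h2 h3).2⟩
  set C := heatConst d q σ with hC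
  have hpar : IsParabolic C α (heatOp (d := d) (q := q) σ) (heatOpPi σ) (heatSum σ) (gradSum σ)
    (gradOp σ) := isParabolic hσ
  have hC0 : 0 ≤ C := hpar.smoothing.nonneg
  have hd1 : (0 : ℝ) < 2 * (1 + d) := by positivity
  -- The abstract Lipschitz constant is 2CKT^θ, and `pNorm_le` loses a factor 1 + d. This threshold
  -- makes the constant in the norm of P_T at most 1/2.
  obtain ⟨T₀, hT₀, hsmall₀⟩ := exists_time_bound (Q := 2 * C * K) hθ0
    (show (0 : ℝ) < 1 / (2 * (1 + d)) by positivity)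
  refine ⟨T₀, hT₀, fun T hT => ?_⟩
  have hT1 : T ≤ 1 := hT.2.trans hT₀.2
  have hsmall : 2 * C * K * T ^ θ ≤ 1 / (2 * (1 + d)) := by
    refine le_trans ?_ hsmall₀
    have := Real.rpow_le_rpow hT.1.le hT.2 hθ0.le
    gcongr
  have hsmall' : 2 * C * K * T ^ θ ≤ 1 / 2 := by
    refine hsmall.trans ?_
    refine one_div_le_one_div_of_le (by norm_num) ?_
    have : (0 : ℝ) ≤ d := Nat.cast_nonneg d
    linarith
  -- facts about sources of elements of `P_T`
  have hmeas : ∀ f : ℝ → LL d q, IsPath T f → AEStronglyMeasurable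
      (fun s => N s (f s) (gradLL (f s))) (volume.restrict (Ioc 0 T)) := fun f hf =>
    hN.aestronglyMeasurable_path hT1 (hf.continuousOn.mono Ioc_subset_Icc_self)
      (hf.continuousOn_gradLL hqt)
  have hbound : ∀ f : ℝ → LL d q, MemP T f → ∃ R, 0 ≤ R ∧
      (∀ t ∈ Icc 0 T, ‖f t‖ ≤ R) ∧ (∀ t ∈ Ioc 0 T, √t * ‖gradLL (f t)‖ ≤ R) ∧
      ∀ᵐ s ∂volume.restrict (Ioc 0 T),
        ‖N s (f s) (gradLL (f s))‖ ≤ 2 * R * (s ^ (-(1 / 2 : ℝ)) * m s) := by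
    intro f hf
    obtain ⟨R, h1, h2⟩ := hf.exists_bound hqt
    exact ⟨R, (norm_nonneg _).trans (h1 0 ⟨le_rfl, hT.1.le⟩), h1, h2,
      hN.ae_norm_le_path hk.weight_nonneg hT1 (fun s hs => h1 s (Ioc_subset_Icc_self hs)) h2⟩
  have hPsi : ∀ (f : ℝ → LL d q) (t : ℝ), 0 ≤ t → Psi W σ ι f₀ u v f t =
      duhamel (heatOp σ) (heatSum σ) f₀ (fun s => N s (f s) (gradLL (f s))) t :=
    fun f t ht => Psi_eq_duhamel hW.le hσ hι f₀ f ht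
  have hPsi0 : ∀ f : ℝ → LL d q, Psi W σ ι f₀ u v f 0 = f₀ := by
    intro f
    rw [hPsi f 0 le_rfl, duhamel, heatOp_zero]
    simp
  have hweak : ∀ f : ℝ → LL d q, MemP T f → ∀ t ∈ Ioc 0 T, ∀ i, HasWeakPartial i
      (Psi W σ ι f₀ u v f t)
      (duhamel (gradOp σ) (gradSum σ) f₀ (fun s => N s (f s) (gradLL (f s))) t i) := by
    intro f hf t ht
    obtain ⟨R, hR, -, -, hFR⟩ := hbound f hf
    rw [hPsi f t ht.1.le]
    exact (hasWeakPartial_duhamel hσ hk hT1 f₀ (hmeas f hf.1) hFR ht).2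
  have hexists : ∀ f : ℝ → LL d q, MemP T f → DuhamelExists W σ ι u v T f := by
    intro f hf
    obtain ⟨R, hR, -, -, hFR⟩ := hbound f hf
    rw [duhamelExists_iff hW.le hσ hι]
    intro t ht
    rcases ht.1.eq_or_lt with h0 | h0
    · simp [← h0]
    · exact (hasWeakPartial_duhamel hσ hk hT1 f₀ (hmeas f hf.1) hFR ⟨h0, ht.2⟩).1
  refine ⟨fun f hf => ⟨hexists f hf, ?_⟩, ⟨1 / 2, NNReal.half_lt_self one_ne_zero, ?_⟩, ?_⟩
  · -- `Ψ` maps `P_T` into itself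
    obtain ⟨R, hR, -, -, hFR⟩ := hbound f hf
    have hR2 : 0 ≤ 2 * R := by linarith
    have hc1 := hpar.continuousOn_duhamel hk hT1 hR2 (hmeas f hf.1) hFR f₀
    have hc2 := hpar.continuousOn_grad_duhamel hk hT1 hR2 (hmeas f hf.1) hFR f₀
    have hpath : IsPath T (Psi W σ ι f₀ u v f) :=
      isPath_of_continuousOn hqt (hc1.congr fun t ht => hPsi f t ht.1) hc2 (hweak f hf)
    refine ⟨hpath, ?_⟩
    have hCf : 0 ≤ C * ‖f₀‖ := by positivity
    have hCR : 0 ≤ C * (2 * R) * K := by positivity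
    refine (pNorm_le hqt hT1 (R := ‖f₀‖ + C * ‖f₀‖ + C * (2 * R) * K) (fun t ht => ?_)
      hpath.mem_w1 (fun t ht => ?_)).trans_lt (by finiteness)
    · rcases ht.1.eq_or_lt with h0 | h0
      · rw [← h0, hPsi0]; linarith
      · rw [hPsi f t ht.1]
        exact ((hpar.norm_duhamel_le hk hT1 hR2 hFR f₀ ⟨h0, ht.2⟩).1).trans (by linarith)
    · rw [gradLL_eq (hweak f hf t ht)]
      exact ((hpar.norm_duhamel_le hk hT1 hR2 hFR f₀ ht).2).trans
        (by linarith [norm_nonneg f₀])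
  · -- the contraction estimate
    intro f g hf hg
    obtain ⟨Rf, hRf, bf, bgf, -⟩ := hbound f hf
    obtain ⟨Rg, hRg, bg, bgg, -⟩ := hbound g hg
    have hsub : ∀ t ∈ Ioc 0 T, MemW1 ((f - g) t) := fun t ht =>
      (hf.1.mem_w1 t ht).sub (hg.1.mem_w1 t ht)
    have hgsub : ∀ t ∈ Ioc 0 T, gradLL ((f - g) t) = gradLL (f t) - gradLL (g t) := fun t ht =>
      (hf.1.mem_w1 t ht).gradLL_sub (hg.1.mem_w1 t ht)
    -- Finiteness allows the distance to be treated as a real number R in the abstract estimate.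
    have hfin : pNorm T (f - g) ≠ ⊤ := by
      refine ((pNorm_le hqt hT1 (R := Rf + Rg) (fun t ht => ?_) hsub
        (fun t ht => ?_)).trans_lt (by finiteness)).ne
      · exact (norm_sub_le _ _).trans (add_le_add (bf t ht) (bg t ht))
      · rw [hgsub t ht]
        refine (mul_le_mul_of_nonneg_left (norm_sub_le _ _) (Real.sqrt_nonneg t)).trans ?_
        rw [mul_add]
        exact add_le_add (bgf t ht) (bgg t ht)
    set R := (pNorm T (f - g)).toReal with hRdef
    have hR : 0 ≤ R := ENNReal.toReal_nonneg
    have hle : pNorm T (f - g) ≤ ENNReal.ofReal R := (ENNReal.ofReal_toReal hfin).ge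
    have d1 : ∀ s ∈ Ioc 0 T, ‖f s - g s‖ ≤ R := fun s hs =>
      norm_le_of_pNorm_le hR hle (Ioc_subset_Icc_self hs)
    have d2 : ∀ s ∈ Ioc 0 T, √s * ‖gradLL (f s) - gradLL (g s)‖ ≤ R := fun s hs => by
      rw [← hgsub s hs]
      exact sqrt_mul_norm_gradLL_le_of_pNorm_le hqt hR hle hs (hsub s hs)
    have hd := fun (t : ℝ) (ht : t ∈ Ioc 0 T) =>
      hpar.norm_duhamel_sub_le hk hN hT1 (R := R) (R₁ := Rf + Rg) hR
        (hf.1.continuousOn.mono Ioc_subset_Icc_self) (hf.1.continuousOn_gradLL hqt)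
        (hg.1.continuousOn.mono Ioc_subset_Icc_self) (hg.1.continuousOn_gradLL hqt)
        (fun s hs => (bf s (Ioc_subset_Icc_self hs)).trans (by linarith))
        (fun s hs => (bgf s hs).trans (by linarith))
        (fun s hs => (bg s (Ioc_subset_Icc_self hs)).trans (by linarith))
        (fun s hs => (bgg s hs).trans (by linarith)) d1 d2 f₀ ht
    have hwf := fun t ht i => hweak f hf t ht i
    have hwg := fun t ht i => hweak g hg t ht i
    have hQ : 0 ≤ 2 * C * K * T ^ θ * R := by
      have := Real.rpow_nonneg hT.1.le θ
      positivity
    refine (pNorm_le hqt hT1 (R := 2 * C * K * T ^ θ * R) (fun t ht => ?_)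
      (fun t ht i => ⟨_, (hwf t ht i).sub (hwg t ht i)⟩) (fun t ht => ?_)).trans ?_
    · rcases ht.1.eq_or_lt with h0 | h0
      · rw [← h0, hPsi0, hPsi0, sub_self, norm_zero]; exact hQ
      · rw [hPsi f t ht.1, hPsi g t ht.1]
        exact (hd t ⟨h0, ht.2⟩).1
    · rw [gradLL_eq (fun i => (hwf t ht i).sub (hwg t ht i))]
      exact (hd t ht).2
    · have hreal : (1 + d : ℝ) * (2 * C * K * T ^ θ * R) ≤ 1 / 2 * R := by
        calc (1 + d : ℝ) * (2 * C * K * T ^ θ * R) = (2 * C * K * T ^ θ) * ((1 + d) * R) := by ring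
          _ ≤ 1 / (2 * (1 + d)) * ((1 + d) * R) := by gcongr
          _ = 1 / 2 * R := by field_simp
      have e1 : (1 + d : ℝ≥0∞) = ENNReal.ofReal (1 + d) := by
        rw [ENNReal.ofReal_add zero_le_one (Nat.cast_nonneg d), ENNReal.ofReal_one,
          ENNReal.ofReal_natCast]
      have e2 : (((1 / 2 : ℝ≥0)) : ℝ≥0∞) = ENNReal.ofReal (1 / 2) := by
        rw [ENNReal.ofReal, Real.toNNReal_div zero_le_one, Real.toNNReal_one, Real.toNNReal_ofNat]
      rw [e1, ← ENNReal.ofReal_mul (by positivity), e2, ← ENNReal.ofReal_toReal hfin,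
        ← ENNReal.ofReal_mul (by norm_num)]
      exact ENNReal.ofReal_le_ofReal hreal
  · obtain ⟨f, g, R, hf, hg, bf, bg, ef, eg⟩ := hpar.exists_fixedPoint hk hN hT1 hsmall' f₀
    have hR : 0 ≤ R := (norm_nonneg _).trans (bf 0 ⟨le_rfl, hT.1.le⟩)
    have hfI : ContinuousOn f (Ioc 0 T) := hf.mono Ioc_subset_Icc_self
    -- So far g is only the second component of the fixed point. It satisfies the differentiated
    -- Duhamel formula, which gives the weak gradient of the Duhamel formula for f.
    have hwk : ∀ t ∈ Ioc 0 T, ∀ i, HasWeakPartial i (f t) (g t i) := by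
      intro t ht i
      have := (hasWeakPartial_duhamel hσ hk hT1 f₀ (hN.aestronglyMeasurable_path hT1 hfI hg)
        (hN.ae_norm_le_path hk.weight_nonneg hT1 (fun s hs => bf s (Ioc_subset_Icc_self hs)) bg)
        ht).2 i
      rwa [← ef t (Ioc_subset_Icc_self ht), ← eg t ht] at this
    have hgf : ∀ t ∈ Ioc 0 T, gradLL (f t) = g t := fun t ht => gradLL_eq (hwk t ht)
    have hpath : IsPath T f := isPath_of_continuousOn hqt hf hg hwk
    have hP : MemP T f := by
      refine ⟨hpath, (pNorm_le hqt hT1 bf hpath.mem_w1 fun t ht => ?_).trans_lt (by finiteness)⟩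
      rw [hgf t ht]; exact bg t ht
    have hsol : IsMildSolution W σ ι f₀ u v T f := by
      refine ⟨hexists f hP, fun t ht => ?_⟩
      rw [hPsi f t ht.1, ef t ht, duhamel, duhamel]
      congr 1
      refine setIntegral_congr_fun measurableSet_Ioc fun s hs => ?_
      have hs' : s ∈ Ioc 0 T := ⟨hs.1, hs.2.trans ht.2⟩
      simp only [hgf s hs']
    have hf0 : f 0 = f₀ := by rw [hsol.2 0 ⟨le_rfl, hT.1.le⟩, hPsi0]
    refine ⟨f, hP, hsol, ?_, fun g' hg' hsol' => ?_⟩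
    · have h0 := (hf 0 ⟨le_rfl, hT.1.le⟩).tendsto
      rw [hf0] at h0
      refine h0.mono_left ?_
      rw [← nhdsWithin_Ioc_eq_nhdsGT hT.1]
      exact nhdsWithin_mono _ Ioc_subset_Icc_self
    · have hg0 : g' 0 = f₀ := by rw [hsol'.2 0 ⟨le_rfl, hT.1.le⟩, hPsi0]
      -- The competitor lies only in X_T, where the contraction does not apply, so both solutions
      -- are compared through their evolution from times c > 0.
      have ev := fun c t hc hct ht =>
        hsol.evolution hW.le hσ hι hN hk hT1 hpath (c := c) (t := t) hc hct ht
      have ev' := fun c t hc hct ht =>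
        hsol'.evolution hW.le hσ hι hN hk hT1 hg' (c := c) (t := t) hc hct ht
      exact hpar.eqOn_of_evolution hk hN hT1 hsmall' hg'.continuousOn hf
        (hg'.continuousOn_gradLL hqt) (hpath.continuousOn_gradLL hqt) (hg0.trans hf0.symm)
        (fun c t hc hct ht => (ev' c t hc hct ht).1) (fun c t hc hct ht => (ev c t hc hct ht).1)
        (fun c t hc hct ht => (ev' c t hc hct ht).2) (fun c t hc hct ht => (ev c t hc hct ht).2)
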